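/- Let $k$ be a field of characteristic zero. All operads below are symmetric operads in $k$-vector spaces. The operad $\mathrm{PostLie}$ is generated by an anti-commutative binary operation $[a_1,a_2]$ and a binary operation $a_1\triangleleft a_2$ without symmetries, subject to the identities $$[[a_1,a_2],a_3]-[[a_1,a_3],a_2]=[a_1,[a_2,a_3]],\qquad [a_1,a_2]\triangleleft a_3=[a_1\triangleleft a_3,a_2]+[a_1,a_2\triangleleft a_3],$$ $$\bigl((a_1\triangleleft a_2)\triangleleft a_3-a_1\triangleleft(a_2\triangleleft a_3)\bigr)-\bigl((a_1\triangleleft a_3)\triangleleft a_2-a_1\triangleleft(a_3\triangleleft a_2)\bigr)=a_1\triangleleft[a_2,a_3].$$ The operad $\mathrm{RBLie}$ of Rota--Baxter Lie algebras of weight one is generated by an anti-commutative binary operation $[a_1,a_2]$ and a unary operation $R$, subject to the identities $$[[a_1,a_2],a_3]-[[a_1,a_3],a_2]=[a_1,[a_2,a_3]],\qquad [R(a_1),R(a_2)]=R\bigl([R(a_1),a_2]+[a_1,R(a_2)]+[a_1,a_2]\bigr).$$ Let $\alpha\colon\mathrm{PostLie}\to\mathrm{RBLie}$ be the morphism of operads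 with $\alpha([a_1,a_2])=[a_1,a_2]$ and $\alpha(a_1\triangleleft a_2)=[a_1,R(a_2)]$, and let $\alpha^*$ be the functor from $\mathrm{RBLie}$-algebras to $\mathrm{PostLie}$-algebras given by pulling back the structure along $\alpha$. **Theorem.** The datum $(\mathrm{PostLie},\mathrm{RBLie},\alpha)$ has the PBW property. That is, $\alpha^*$ has a left adjoint $\alpha_!$ (the universal enveloping Rota--Baxter Lie algebra), and there exists an endofunctor $\mathcal X$ of the category of $k$-vector spaces such that, for every $\mathrm{PostLie}$-algebra $A$, the underlying vector space of $\alpha_!(A)$ is isomorphic to $\mathcal X$ applied to the underlying vector space of $A$, naturally with respect to morphisms of $\mathrm{PostLie}$-algebras. -/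

import Mathlib

open CategoryTheory

universe u v w

noncomputable section

namespace OperadPBW

/-! # Symmetric operads in vector spaces, their morphisms and algebras

Operads are given in the coordinate-free form: the components are indexed by finite sets (of
inputs) and bijections of finite sets, so that `obj (Fin n)` with its action of the permutations
of `Fin n` is the arity `n` component. -/

/-- A symmetric `k`-linear operad: a functor from finite sets and bijections to `k`-modules
with a unit and total compositions `p ∘ (q i)_{i ∈ I}` that are equivariant, unital and
associative. -/
structure SymOperad (k : Type u) [CommRing k] where
  obj : (I : Type) → [Finite I] → ModuleCat.{u} k
  map : {I J : Type} → [Finite I] → [Finite J] → (I ≃ J) → (obj I →ₗ[k] obj J)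
  map_refl : ∀ {I : Type} [Finite I] (p : obj I), map (Equiv.refl I) p = p
  map_trans : ∀ {I J K : Type} [Finite I] [Finite J] [Finite K] (σ : I ≃ J) (τ : J ≃ K)
    (p : obj I), map (σ.trans τ) p = map τ (map σ p)
  one : obj Unit
  comp : {I : Type} → [Finite I] → {J : I → Type} → [∀ i, Finite (J i)] →
    (obj I →ₗ[k] MultilinearMap k (fun i => obj (J i)) (obj (Σ i, J i)))
  comp_map_left : ∀ {I I' : Type} [Finite I] [Finite I'] (σ : I ≃ I') {J : I' → Type}
    [∀ i, Finite (J i)] (p : obj I) (q : ∀ i, obj (J i)),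
    comp (map σ p) q = map (Equiv.sigmaCongrLeft (β := J) σ) (comp p (fun i => q (σ i)))
  comp_map_right : ∀ {I : Type} [Finite I] {J J' : I → Type} [∀ i, Finite (J i)]
    [∀ i, Finite (J' i)] (τ : ∀ i, J i ≃ J' i) (p : obj I) (q : ∀ i, obj (J i)),
    comp p (fun i => map (τ i) (q i)) = map (Equiv.sigmaCongrRight τ) (comp p q)
  one_comp : ∀ {J : Type} [Finite J] (q : obj J),
    comp (J := fun _ : Unit => J) one (fun _ => q) =
      map (Equiv.uniqueSigma (fun _ : Unit => J)).symm q
  comp_one : ∀ {I : Type} [Finite I] (p : obj I),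
    comp (J := fun _ : I => Unit) p (fun _ => one) = map (Equiv.sigmaPUnit I).symm p
  assoc : ∀ {I : Type} [Finite I] {J : I → Type} [∀ i, Finite (J i)]
    {K : ∀ i, J i → Type} [∀ i j, Finite (K i j)] (p : obj I) (q : ∀ i, obj (J i))
    (r : ∀ i j, obj (K i j)),
    map (Equiv.sigmaAssoc K) (comp (J := fun x : (Σ i, J i) => K x.1 x.2) (comp p q)
      (fun x => r x.1 x.2)) = comp p (fun i => comp (q i) (r i))

/-- A morphism of symmetric operads. -/
structure SymOperad.Hom {k : Type u} [CommRing k] (P Q : SymOperad k) where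
  app : (I : Type) → [Finite I] → (P.obj I →ₗ[k] Q.obj I)
  app_map : ∀ {I J : Type} [Finite I] [Finite J] (σ : I ≃ J) (p : P.obj I),
    app J (P.map σ p) = Q.map σ (app I p)
  app_one : app Unit P.one = Q.one
  app_comp : ∀ {I : Type} [Finite I] {J : I → Type} [∀ i, Finite (J i)] (p : P.obj I)
    (q : ∀ i, P.obj (J i)),
    app (Σ i, J i) (P.comp p q) = Q.comp (app I p) (fun i => app (J i) (q i))

/-- An algebra over a symmetric operad `P`. -/
structure OperadAlg {k : Type u} [CommRing k] (P : SymOperad k) where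
  carrier : ModuleCat.{v} k
  act : {I : Type} → [Finite I] → (P.obj I →ₗ[k] MultilinearMap k (fun _ : I => carrier) carrier)
  act_map : ∀ {I J : Type} [Finite I] [Finite J] (σ : I ≃ J) (p : P.obj I) (a : J → carrier),
    act (P.map σ p) a = act p (fun i => a (σ i))
  act_one : ∀ a : Unit → carrier, act P.one a = a ()
  act_comp : ∀ {I : Type} [Finite I] {J : I → Type} [∀ i, Finite (J i)] (p : P.obj I)
    (q : ∀ i, P.obj (J i)) (a : (Σ i, J i) → carrier),
    act (P.comp p q) a = act p (fun i => act (q i) (fun j => a ⟨i, j⟩))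

namespace OperadAlg

variable {k : Type u} [CommRing k] {P Q : SymOperad k}

/-- A morphism of `P`-algebras: a linear map commuting with all the operations. -/
@[ext]
structure Hom (A B : OperadAlg.{u, v} P) where
  hom : A.carrier ⟶ B.carrier
  hom_act : ∀ {I : Type} [Finite I] (p : P.obj I) (a : I → A.carrier),
    hom (A.act p a) = B.act p (fun i => hom (a i))

instance : Category (OperadAlg.{u, v} P) where
  Hom A B := Hom A B
  id A := ⟨𝟙 _, fun _ _ => rfl⟩
  comp f g := ⟨f.hom ≫ g.hom, fun p a => by simp [f.hom_act, g.hom_act]⟩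
  id_comp f := Hom.ext (Category.id_comp f.hom)
  comp_id f := Hom.ext (Category.comp_id f.hom)
  assoc f g h := Hom.ext (Category.assoc f.hom g.hom h.hom)

variable (P) in
/-- The functor sending a `P`-algebra to its underlying vector space. -/
def forget : OperadAlg.{u, v} P ⥤ ModuleCat.{v} k where
  obj A := A.carrier
  map f := f.hom

/-- The functor `φ^*` from `Q`-algebras to `P`-algebras for a morphism `φ : P → Q`. -/
def pullback (φ : SymOperad.Hom P Q) : OperadAlg.{u, v} Q ⥤ OperadAlg.{u, v} P where
  obj A :=
    { carrier := A.carrier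
      act := fun {I} _ => A.act ∘ₗ φ.app I
      act_map := fun σ p a => by simp [φ.app_map, A.act_map]
      act_one := fun a => by simp [φ.app_one, A.act_one]
      act_comp := fun p q a => by simp [φ.app_comp, A.act_comp] }
  map f := ⟨f.hom, fun p a => f.hom_act (φ.app _ p) a⟩

end OperadAlg

/-- The datum `(P, Q, φ)` has the PBW property: the functor `φ^*` has a left adjoint `φ_!`
(the universal enveloping `Q`-algebra), and there is an endofunctor `X` of the category of
vector spaces such that the underlying space of `φ_! A` is isomorphic to `X` applied to the
underlying space of `A`, naturally in the `P`-algebra `A`. -/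
def HasPBWProperty {k : Type u} [CommRing k] {P Q : SymOperad k} (φ : SymOperad.Hom P Q) : Prop :=
  ∃ (U : OperadAlg.{u, max u w} P ⥤ OperadAlg.{u, max u w} Q)
    (_ : U ⊣ OperadAlg.pullback.{u, max u w} φ)
    (X : ModuleCat.{max u w} k ⥤ ModuleCat.{max u w} k),
    Nonempty (U ⋙ OperadAlg.forget Q ≅ OperadAlg.forget P ⋙ X)

/-! # Operads presented by unary and binary generating operations and identities -/

/-- Monomials in the variables `I` built from unary operations `U` and binary operations `B`. -/
inductive Mon (U B I : Type) : Type
  | var (i : I) : Mon U B I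
  | un (f : U) (t : Mon U B I) : Mon U B I
  | bin (b : B) (s t : Mon U B I) : Mon U B I

open Classical in
/-- The number of occurrences of each variable in a monomial. -/
def Mon.occ {U B I : Type} : Mon U B I → I → ℕ
  | .var j => Pi.single j 1
  | .un _ t => t.occ
  | .bin _ s t => s.occ + t.occ

/-- Interpretations of the operation symbols as (bi)linear operations on a module `A`. -/
structure Ops (k : Type u) [CommRing k] (U B : Type) (A : Type v) [AddCommGroup A]
    [Module k A] where
  un : U → A →ₗ[k] A
  bin : B → A →ₗ[k] A →ₗ[k] A

section Eval

variable {k : Type u} [CommRing k] {U B I J : Type} {A : Type v} [AddCommGroup A] [Module k A]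
  {A' : Type w} [AddCommGroup A'] [Module k A']

/-- The value of a monomial at elements of `A`. -/
def Ops.eval (o : Ops k U B A) (a : I → A) : Mon U B I → A
  | .var i => a i
  | .un f t => o.un f (o.eval a t)
  | .bin b s t => o.bin b (o.eval a s) (o.eval a t)

/-- The value of a linear combination of monomials at elements of `A`. -/
def Ops.evalLin (o : Ops k U B A) (a : I → A) : (Mon U B I →₀ k) →ₗ[k] A :=
  Finsupp.linearCombination k (o.eval a)

@[simp]
theorem Ops.evalLin_single (o : Ops k U B A) (a : I → A) (t : Mon U B I) (c : k) :
    o.evalLin a (Finsupp.single t c) = c • o.eval a t := by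
  simp [Ops.evalLin]

/-- Linear maps commuting with the operations. -/
structure Ops.IsHom (o : Ops k U B A) (o' : Ops k U B A') (f : A →ₗ[k] A') : Prop where
  un : ∀ g x, f (o.un g x) = o'.un g (f x)
  bin : ∀ b x y, f (o.bin b x y) = o'.bin b (f x) (f y)

theorem Ops.IsHom.eval {o : Ops k U B A} {o' : Ops k U B A'} {f : A →ₗ[k] A'} (h : o.IsHom o' f)
    (a : I → A) (t : Mon U B I) : f (o.eval a t) = o'.eval (fun i => f (a i)) t := by
  induction t with
  | var i => rfl
  | un g t ih => simp [Ops.eval, h.un, ih]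
  | bin b s t ihs iht => simp [Ops.eval, h.bin, ihs, iht]

theorem Ops.IsHom.evalLin {o : Ops k U B A} {o' : Ops k U B A'} {f : A →ₗ[k] A'}
    (h : o.IsHom o' f) (a : I → A) (p : Mon U B I →₀ k) :
    f (o.evalLin a p) = o'.evalLin (fun i => f (a i)) p := by
  simp [Ops.evalLin, Finsupp.linearCombination_apply, Finsupp.sum, h.eval]

open Classical in
theorem Ops.eval_update_of_occ_zero (o : Ops k U B A) (a : I → A) (i : I) (x : A)
    (t : Mon U B I) (h : t.occ i = 0) : o.eval (Function.update a i x) t = o.eval a t := by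
  induction t with
  | var j =>
    have : j ≠ i := by
      rintro rfl
      simp [Mon.occ] at h
    simp [Ops.eval, this]
  | un g t ih => simp [Ops.eval, ih h]
  | bin b s t ihs iht =>
    simp only [Mon.occ, Pi.add_apply, Nat.add_eq_zero_iff] at h
    simp [Ops.eval, ihs h.1, iht h.2]

open Classical in
theorem Ops.eval_update_of_occ_one (o : Ops k U B A) (a : I → A) (i : I)
    (t : Mon U B I) (h : t.occ i = 1) :
    ∃ f : A →ₗ[k] A, ∀ x, o.eval (Function.update a i x) t = f x := by
  induction t with
  | var j =>
    have : j = i := by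
      by_contra hne
      simp [Mon.occ, Ne.symm hne] at h
    subst this
    exact ⟨LinearMap.id, fun x => by simp [Ops.eval]⟩
  | un g t ih =>
    obtain ⟨f, hf⟩ := ih h
    exact ⟨o.un g ∘ₗ f, fun x => by simp [Ops.eval, hf]⟩
  | bin b s t ihs iht =>
    simp only [Mon.occ, Pi.add_apply] at h
    rcases Nat.eq_zero_or_pos (s.occ i) with h0 | h0
    · obtain ⟨f, hf⟩ := iht (by omega)
      exact ⟨o.bin b (o.eval a s) ∘ₗ f, fun x => by
        simp [Ops.eval, hf, o.eval_update_of_occ_zero a i x s h0]⟩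
    · obtain ⟨f, hf⟩ := ihs (by omega)
      exact ⟨(o.bin b).flip (o.eval a t) ∘ₗ f, fun x => by
        simp [Ops.eval, hf, o.eval_update_of_occ_zero a i x t (by omega)]⟩

end Eval

/-- Generating operations (unary ones `U` and binary ones `B`) and identities: the identity `r`
says that the given linear combination of monomials in the variables `vars r` vanishes. -/
structure Presentation (k : Type u) [CommRing k] where
  U : Type
  B : Type
  Rel : Type
  vars : Rel → Type
  ident : (r : Rel) → (Mon U B (vars r) →₀ k)

namespace Presentation

variable {k : Type u} [CommRing k] (T : Presentation k)

/-- The operations on a module satisfy the identities of the presentation. -/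
def IsModel {A : Type v} [AddCommGroup A] [Module k A] (o : Ops k T.U T.B A) : Prop :=
  ∀ (r : T.Rel) (a : T.vars r → A), o.evalLin a (T.ident r) = 0

/-- The operations on the space of all linear combinations of monomials. -/
def monOps (I : Type) : Ops k T.U T.B (Mon T.U T.B I →₀ k) where
  un f := Finsupp.lmapDomain k k (Mon.un f)
  bin b := Finsupp.linearCombination k (fun s => Finsupp.lmapDomain k k (Mon.bin b s))

theorem monOps_eval {I : Type} (t : Mon T.U T.B I) :
    (T.monOps I).eval (fun i => Finsupp.single (Mon.var i) 1) t = Finsupp.single t 1 := by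
  induction t with
  | var i => rfl
  | un f t ih =>
    rw [Ops.eval, ih]
    simp [monOps]
  | bin b s t ihs iht =>
    rw [Ops.eval, ihs, iht]
    simp [monOps]

/-- The ideal of all consequences of the identities. -/
inductive InIdeal (I : Type) : (Mon T.U T.B I →₀ k) → Prop
  | rel (r : T.Rel) (a : T.vars r → (Mon T.U T.B I →₀ k)) :
      InIdeal I ((T.monOps I).evalLin a (T.ident r))
  | zero : InIdeal I 0
  | add {x y} : InIdeal I x → InIdeal I y → InIdeal I (x + y)
  | smul (c : k) {x} : InIdeal I x → InIdeal I (c • x)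
  | un (f : T.U) {x} : InIdeal I x → InIdeal I ((T.monOps I).un f x)
  | left (b : T.B) {x} (y) : InIdeal I x → InIdeal I ((T.monOps I).bin b x y)
  | right (b : T.B) (x) {y} : InIdeal I y → InIdeal I ((T.monOps I).bin b x y)

/-- The ideal of all consequences of the identities, as a subspace. -/
def ideal (I : Type) : Submodule k (Mon T.U T.B I →₀ k) where
  carrier := {x | T.InIdeal I x}
  zero_mem' := .zero
  add_mem' := .add
  smul_mem' c _ h := .smul c h

/-- The free algebra on the set `I`, with the given operations subject to the given identities. -/
abbrev Free (I : Type) : Type u := (Mon T.U T.B I →₀ k) ⧸ T.ideal I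

/-- The operations of the free algebra. -/
def freeOps (I : Type) : Ops k T.U T.B (T.Free I) where
  un f := (T.ideal I).mapQ (T.ideal I) ((T.monOps I).un f) (fun _ h => InIdeal.un f h)
  bin b :=
    ((T.ideal I).liftQ ((T.ideal I).liftQ (((T.monOps I).bin b).compr₂ (T.ideal I).mkQ)
      (fun x h => by
        refine LinearMap.ext fun y => ?_
        exact (Submodule.Quotient.mk_eq_zero (T.ideal I)).2 (InIdeal.left b y h))).flip
      (fun y h => by
        refine LinearMap.ext fun x => ?_
        obtain ⟨x, rfl⟩ := Submodule.mkQ_surjective _ x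
        exact (Submodule.Quotient.mk_eq_zero (T.ideal I)).2 (InIdeal.right b x h))).flip

theorem mkQ_isHom (I : Type) : (T.monOps I).IsHom (T.freeOps I) (T.ideal I).mkQ :=
  ⟨fun _ _ => rfl, fun _ _ _ => rfl⟩

theorem free_isModel (I : Type) : T.IsModel (T.freeOps I) := by
  intro r a
  choose b hb using fun i => Submodule.mkQ_surjective (T.ideal I) (a i)
  obtain rfl : (fun i => (T.ideal I).mkQ (b i)) = a := funext hb
  rw [← (T.mkQ_isHom I).evalLin]
  exact (Submodule.Quotient.mk_eq_zero _).2 (InIdeal.rel r b)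

/-- The generators of the free algebra. -/
def gen {I : Type} (i : I) : T.Free I := (T.ideal I).mkQ (Finsupp.single (Mon.var i) 1)

/-- The element of the free algebra given by a monomial. -/
def mono {I : Type} (t : Mon T.U T.B I) : T.Free I := (T.freeOps I).eval T.gen t

theorem mkQ_single {I : Type} (t : Mon T.U T.B I) (c : k) :
    (T.ideal I).mkQ (Finsupp.single t c) = c • T.mono t := by
  have h := (T.mkQ_isHom I).eval (fun i => Finsupp.single (Mon.var i) 1) t
  rw [monOps_eval] at h
  rw [← mul_one c, ← smul_eq_mul, ← Finsupp.smul_single, map_smul, h, smul_eq_mul, mul_one]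
  rfl

section Lift

variable {T} {I : Type} {A : Type v} [AddCommGroup A] [Module k A] {o : Ops k T.U T.B A}

theorem monOps_evalLin_isHom (o : Ops k T.U T.B A) (a : I → A) :
    (T.monOps I).IsHom o (o.evalLin a) := by
  constructor
  · intro f x
    induction x using Finsupp.induction_linear with
    | zero => simp
    | add x y hx hy => simp only [map_add, hx, hy]
    | single t c => simp [monOps, Ops.eval]
  · intro b x y
    induction x using Finsupp.induction_linear with
    | zero => simp
    | add x x' hx hx' => simp only [map_add, LinearMap.add_apply, hx, hx']
    | single s c =>
      induction y using Finsupp.induction_linear with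
      | zero => simp
      | add y y' hy hy' => simp only [map_add, hy, hy']
      | single t d =>
        have h : (T.monOps I).bin b (Finsupp.single s c) (Finsupp.single t d) =
            Finsupp.single (Mon.bin b s t) (c * d) := by
          simp only [monOps, Finsupp.linearCombination_single, LinearMap.smul_apply,
            Finsupp.lmapDomain_apply, Finsupp.mapDomain_single, Finsupp.smul_single, smul_eq_mul]
        rw [h]
        simp only [Ops.evalLin_single, Ops.eval, map_smul, LinearMap.smul_apply, smul_smul,
          mul_comm]

/-- The algebra homomorphism out of the free algebra given by values of the generators. -/
def lift (ho : T.IsModel o) (a : I → A) : T.Free I →ₗ[k] A :=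
  (T.ideal I).liftQ (o.evalLin a) (by
    intro x hx
    have h := monOps_evalLin_isHom o a
    rw [LinearMap.mem_ker]
    replace hx : T.InIdeal I x := hx
    induction hx with
    | rel r b => rw [h.evalLin]; exact ho r _
    | zero => simp
    | add hx hy ihx ihy => rw [map_add, ihx, ihy, add_zero]
    | smul c hx ihx => rw [map_smul, ihx, smul_zero]
    | un f hx ihx => rw [h.un, ihx, map_zero]
    | left b y hx ihx => rw [h.bin, ihx, map_zero, LinearMap.zero_apply]
    | right b x hx ihx => rw [h.bin, ihx, map_zero])

theorem lift_isHom (ho : T.IsModel o) (a : I → A) : (T.freeOps I).IsHom o (lift ho a) := by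
  have h := monOps_evalLin_isHom o a
  constructor
  · intro f x
    obtain ⟨x, rfl⟩ := Submodule.mkQ_surjective _ x
    exact h.un f x
  · intro b x y
    obtain ⟨x, rfl⟩ := Submodule.mkQ_surjective _ x
    obtain ⟨y, rfl⟩ := Submodule.mkQ_surjective _ y
    exact h.bin b x y

@[simp]
theorem lift_gen (ho : T.IsModel o) (a : I → A) (i : I) : lift ho a (T.gen i) = a i := by
  simp [lift, gen, Ops.eval]

theorem lift_mono (ho : T.IsModel o) (a : I → A) (t : Mon T.U T.B I) :
    lift ho a (T.mono t) = o.eval a t := by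
  rw [mono, (lift_isHom ho a).eval]
  simp

theorem hom_ext {f g : T.Free I →ₗ[k] A} (hf : (T.freeOps I).IsHom o f)
    (hg : (T.freeOps I).IsHom o g) (h : ∀ i, f (T.gen i) = g (T.gen i)) : f = g := by
  refine Submodule.linearMap_qext _ (Finsupp.lhom_ext fun t c => ?_)
  rw [LinearMap.comp_apply, LinearMap.comp_apply, mkQ_single, map_smul, map_smul, mono, hf.eval,
    hg.eval]
  simp [h]

end Lift

theorem IsHom_comp {U B : Type} {A A' A'' : Type*} [AddCommGroup A] [Module k A]
    [AddCommGroup A'] [Module k A'] [AddCommGroup A''] [Module k A''] {o : Ops k U B A}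
    {o' : Ops k U B A'} {o'' : Ops k U B A''} {g : A' →ₗ[k] A''} {f : A →ₗ[k] A'}
    (hg : o'.IsHom o'' g) (hf : o.IsHom o' f) : o.IsHom o'' (g ∘ₗ f) :=
  ⟨fun u x => by simp [hf.un, hg.un], fun b x y => by simp [hf.bin, hg.bin]⟩

theorem lift_lift {I J : Type} {A : Type v} [AddCommGroup A] [Module k A]
    {o : Ops k T.U T.B A} (ho : T.IsModel o) (a : J → A) (b : I → T.Free J) (x : T.Free I) :
    lift ho a (lift (T.free_isModel J) b x) = lift ho (fun i => lift ho a (b i)) x :=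
  LinearMap.congr_fun (hom_ext (IsHom_comp (lift_isHom ho a) (lift_isHom _ b)) (lift_isHom ho _)
    (fun i => by simp)) x

theorem lift_gen_id {I : Type} (x : T.Free I) : lift (T.free_isModel I) T.gen x = x :=
  LinearMap.congr_fun (hom_ext (g := LinearMap.id) (lift_isHom _ _)
    ⟨fun _ _ => rfl, fun _ _ _ => rfl⟩ (fun i => by simp)) x

/-- The homomorphism of free algebras given by a map of variables. -/
abbrev freeMap {I J : Type} (σ : I → J) : T.Free I →ₗ[k] T.Free J :=
  lift (T.free_isModel J) (fun i => T.gen (σ i))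

/-- The span of the monomials in which each variable `i` occurs exactly `d i` times. -/
def degPart {I : Type} (d : I → ℕ) : Submodule k (T.Free I) :=
  Submodule.span k {x | ∃ t : Mon T.U T.B I, t.occ = d ∧ T.mono t = x}

theorem mono_mem {I : Type} (t : Mon T.U T.B I) : T.mono t ∈ T.degPart t.occ :=
  Submodule.subset_span ⟨t, rfl, rfl⟩

theorem gen_mem {I : Type} (i : I) : T.gen i ∈ T.degPart (Mon.occ (.var i : Mon T.U T.B I)) :=
  T.mono_mem (.var i)

theorem un_mem {I : Type} {d : I → ℕ} {x : T.Free I} (f : T.U) (hx : x ∈ T.degPart d) :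
    (T.freeOps I).un f x ∈ T.degPart d := by
  induction hx using Submodule.span_induction with
  | mem x h =>
    obtain ⟨t, rfl, rfl⟩ := h
    exact T.mono_mem (.un f t)
  | zero => simp
  | add x y _ _ hx hy => rw [map_add]; exact add_mem hx hy
  | smul c x _ hx => rw [map_smul]; exact Submodule.smul_mem _ c hx

theorem bin_mem {I : Type} {d e : I → ℕ} {x y : T.Free I} (b : T.B) (hx : x ∈ T.degPart d)
    (hy : y ∈ T.degPart e) : (T.freeOps I).bin b x y ∈ T.degPart (d + e) := by
  induction hx using Submodule.span_induction with
  | mem x h =>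
    obtain ⟨s, rfl, rfl⟩ := h
    induction hy using Submodule.span_induction with
    | mem y h =>
      obtain ⟨t, rfl, rfl⟩ := h
      exact T.mono_mem (.bin b s t)
    | zero => simp
    | add x y _ _ hx hy => rw [map_add]; exact add_mem hx hy
    | smul c x _ hx => rw [map_smul]; exact Submodule.smul_mem _ c hx
  | zero => simp
  | add x y _ _ hx hy => rw [map_add, LinearMap.add_apply]; exact add_mem hx hy
  | smul c x _ hx => rw [map_smul, LinearMap.smul_apply]; exact Submodule.smul_mem _ c hx

/-- The multilinear part of the free algebra on `I`, spanned by the monomials in which each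
variable occurs exactly once. -/
def multilinearPart (I : Type) : Submodule k (T.Free I) := T.degPart 1

theorem freeMap_mem {I J : Type} {σ : I → J} (hσ : Function.Injective σ) {d : J → ℕ}
    (hd : ∀ j, j ∉ Set.range σ → d j = 0) {x : T.Free I}
    (hx : x ∈ T.degPart (fun i => d (σ i))) : T.freeMap σ x ∈ T.degPart d := by
  classical
  have key : ∀ t : Mon T.U T.B I, T.freeMap σ (T.mono t) ∈
      T.degPart (fun j => if h : ∃ i, σ i = j then t.occ h.choose else 0) := by
    intro t
    induction t with
    | var i =>
      rw [lift_mono]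
      change T.gen (σ i) ∈ _
      convert T.gen_mem (σ i) using 2
      funext j
      by_cases h : ∃ i, σ i = j
      · obtain ⟨i', rfl⟩ := h
        have h : ∃ i, σ i = σ i' := ⟨i', rfl⟩
        rw [dif_pos h, hσ h.choose_spec]
        simp [Mon.occ, Pi.single_apply, hσ.eq_iff]
      · rw [dif_neg h]
        have : j ≠ σ i := fun e => h ⟨i, e.symm⟩
        simp [Mon.occ, this]
    | un f t ih =>
      rw [lift_mono] at ih ⊢
      exact T.un_mem f ih
    | bin b s t ihs iht =>
      rw [lift_mono] at ihs iht ⊢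
      change (T.freeOps J).bin b _ _ ∈ _
      convert T.bin_mem b ihs iht using 2
      funext j
      by_cases h : ∃ i, σ i = j <;> simp [h, Mon.occ]
  induction hx using Submodule.span_induction with
  | mem x h =>
    obtain ⟨t, ht, rfl⟩ := h
    convert key t using 2
    funext j
    by_cases h : ∃ i, σ i = j
    · rw [dif_pos h, ht]
      exact congrArg d h.choose_spec.symm
    · rw [dif_neg h, hd j h]
  | zero => simp
  | add x y _ _ hx hy => rw [map_add]; exact add_mem hx hy
  | smul c x _ hx => rw [map_smul]; exact Submodule.smul_mem _ c hx

theorem freeMap_equiv_mem {I J : Type} (σ : I ≃ J) {x : T.Free I}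
    (hx : x ∈ T.multilinearPart I) : T.freeMap σ x ∈ T.multilinearPart J :=
  T.freeMap_mem σ.injective (fun j hj => (hj (σ.surjective j)).elim) hx

/-- Substitution of elements of free algebras on `J i` for the generators `i`. -/
def subst {I : Type} {J : I → Type} (q : ∀ i, T.Free (J i)) : T.Free I →ₗ[k] T.Free (Σ i, J i) :=
  lift (T.free_isModel _) (fun i => T.freeMap (Sigma.mk i) (q i))

theorem subst_mem {I : Type} {J : I → Type} {q : ∀ i, T.Free (J i)}
    (hq : ∀ i, q i ∈ T.multilinearPart (J i)) {p : T.Free I} (hp : p ∈ T.multilinearPart I) :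
    T.subst q p ∈ T.multilinearPart (Σ i, J i) := by
  classical
  have key : ∀ t : Mon T.U T.B I, T.subst q (T.mono t) ∈
      T.degPart (fun x : (Σ i, J i) => t.occ x.1) := by
    intro t
    induction t with
    | var i =>
      rw [subst, lift_mono]
      refine T.freeMap_mem sigma_mk_injective ?_ ?_
      · rintro ⟨i', j⟩ hj
        have : i' ≠ i := by
          rintro rfl
          exact hj ⟨j, rfl⟩
        simp [Mon.occ, this]
      · convert hq i using 2
        simp only [Mon.occ, Pi.single_eq_same]
        rfl
    | un f t ih =>
      rw [subst, lift_mono] at ih ⊢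
      exact T.un_mem f ih
    | bin b s t ihs iht =>
      rw [subst, lift_mono] at ihs iht ⊢
      exact T.bin_mem b ihs iht
  replace hp : p ∈ Submodule.span k _ := hp
  induction hp using Submodule.span_induction with
  | mem x h =>
    obtain ⟨t, ht, rfl⟩ := h
    have := key t
    rw [ht] at this
    exact this
  | zero => simp
  | add x y _ _ hx hy => rw [map_add]; exact add_mem hx hy
  | smul c x _ hx => rw [map_smul]; exact Submodule.smul_mem _ c hx

open Classical in
theorem exists_linear_update {I : Type} {A : Type v} [AddCommGroup A] [Module k A]
    {o : Ops k T.U T.B A} (ho : T.IsModel o) {p : T.Free I} (hp : p ∈ T.multilinearPart I)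
    (a : I → A) (i : I) :
    ∃ f : A →ₗ[k] A, ∀ x, lift ho (Function.update a i x) p = f x := by
  replace hp : p ∈ Submodule.span k _ := hp
  induction hp using Submodule.span_induction with
  | mem x h =>
    obtain ⟨t, ht, rfl⟩ := h
    simp only [lift_mono]
    exact o.eval_update_of_occ_one a i t (by simp [ht])
  | zero => exact ⟨0, by simp⟩
  | add x y _ _ ihx ihy =>
    obtain ⟨f, hf⟩ := ihx
    obtain ⟨g, hg⟩ := ihy
    exact ⟨f + g, by simp [hf, hg]⟩
  | smul c x _ ihx =>
    obtain ⟨f, hf⟩ := ihx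
    exact ⟨c • f, by simp [hf]⟩

/-- The multilinear operation on an algebra `A` given by an element of the multilinear part of
a free algebra. -/
def multilinearLift {I : Type} {A : Type v} [AddCommGroup A] [Module k A]
    {o : Ops k T.U T.B A} (ho : T.IsModel o) (p : T.multilinearPart I) :
    MultilinearMap k (fun _ : I => A) A where
  toFun a := lift ho a p.1
  map_update_add' {inst} a i x y := by
    obtain rfl : inst = Classical.decEq I := Subsingleton.elim _ _
    obtain ⟨f, hf⟩ := T.exists_linear_update ho p.2 a i
    rw [hf, hf, hf, map_add]
  map_update_smul' {inst} a i c x := by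
    obtain rfl : inst = Classical.decEq I := Subsingleton.elim _ _
    obtain ⟨f, hf⟩ := T.exists_linear_update ho p.2 a i
    rw [hf, hf, map_smul]

/-- The composition of the operad given by the presentation. -/
def compMap {I : Type} {J : I → Type} :
    T.multilinearPart I →ₗ[k]
      MultilinearMap k (fun i => T.multilinearPart (J i)) (T.multilinearPart (Σ i, J i)) where
  toFun p :=
    { toFun := fun q => ⟨T.subst (fun i => (q i).1) p.1, T.subst_mem (fun i => (q i).2) p.2⟩
      map_update_add' := fun q i x y => Subtype.ext <| by
        have := ((T.multilinearLift (T.free_isModel (Σ i, J i)) p).compLinearMap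
          (fun i => T.freeMap (Sigma.mk i) ∘ₗ (T.multilinearPart (J i)).subtype)).map_update_add
            q i x y
        exact this
      map_update_smul' := fun q i c x => Subtype.ext <| by
        have := ((T.multilinearLift (T.free_isModel (Σ i, J i)) p).compLinearMap
          (fun i => T.freeMap (Sigma.mk i) ∘ₗ (T.multilinearPart (J i)).subtype)).map_update_smul
            q i c x
        exact this }
  map_add' p p' := by
    ext q
    exact map_add (T.subst (fun i => (q i).1)) p.1 p'.1
  map_smul' c p := by
    ext q
    exact map_smul (T.subst (fun i => (q i).1)) c p.1

/-- The operad generated by the given operations subject to the given identities. Its component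
indexed by `I` is the multilinear part of the free algebra on `I`; the composition is the
substitution. -/
def operad : SymOperad k where
  obj I _ := ModuleCat.of k (T.multilinearPart I)
  map σ := (T.freeMap σ).restrict (fun _ hx => T.freeMap_equiv_mem σ hx)
  map_refl p := Subtype.ext (T.lift_gen_id p.1)
  map_trans σ τ p := Subtype.ext <| by
    change T.freeMap _ p.1 = T.freeMap _ (T.freeMap _ p.1)
    rw [lift_lift]
    simp only [lift_gen]
    rfl
  one := ⟨T.gen (), by
    have h : (1 : Unit → ℕ) = Mon.occ (.var () : Mon T.U T.B Unit) := by
      funext i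
      simp [Mon.occ]
    rw [multilinearPart, h]
    exact T.gen_mem ()⟩
  comp := T.compMap
  comp_map_left σ J _ p q := Subtype.ext <| by
    change T.subst _ (T.freeMap _ p.1) = T.freeMap _ (T.subst _ p.1)
    rw [subst, subst, lift_lift, lift_lift]
    simp [lift_lift]
  comp_map_right τ p q := Subtype.ext <| by
    change T.subst (fun i => T.freeMap _ (q i).1) p.1 = T.freeMap _ (T.subst _ p.1)
    rw [subst, subst, lift_lift]
    simp [lift_lift]
  one_comp q := Subtype.ext <| by
    change T.subst _ (T.gen ()) = T.freeMap _ q.1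
    rw [subst, lift_gen]
    rfl
  comp_one p := Subtype.ext <| by
    change T.subst (fun _ => T.gen ()) p.1 = T.freeMap _ p.1
    simp only [subst, lift_gen]
    rfl
  assoc {I _ J _ K _} p q r := Subtype.ext <| by
    change T.freeMap _ (T.subst (J := fun x : (Σ i, J i) => K x.1 x.2) (fun x => (r x.1 x.2).1)
      (T.subst (fun i => (q i).1) p.1)) =
      T.subst (fun i => T.subst (fun j => (r i j).1) (q i).1) p.1
    simp only [subst, lift_lift, lift_gen]
    rfl

end Presentation

/-! # The operads of post-Lie algebras and of Rota-Baxter Lie algebras of weight one -/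

/-- The generating operations of the operad of post-Lie algebras: `[a, b]` and `a ◁ b`. -/
inductive PostLieOp : Type
  | bracket
  | tri

/-- The identities of post-Lie algebras. -/
inductive PostLieRel : Type
  | anticomm
  | jacobi
  | deriv
  | assoc

/-- The generating unary operation of the operad of Rota-Baxter Lie algebras. -/
inductive RBLieUnOp : Type
  | R

/-- The generating binary operation of the operad of Rota-Baxter Lie algebras. -/
inductive RBLieOp : Type
  | bracket

/-- The identities of Rota-Baxter Lie algebras. -/
inductive RBLieRel : Type
  | anticomm
  | jacobi
  | rotaBaxter

section Generators

variable {I : Type}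

/-- The monomial `[s, t]` in post-Lie operations. -/
abbrev plBr (s t : Mon Empty PostLieOp I) : Mon Empty PostLieOp I := .bin .bracket s t

/-- The monomial `s ◁ t` in post-Lie operations. -/
abbrev plTri (s t : Mon Empty PostLieOp I) : Mon Empty PostLieOp I := .bin .tri s t

/-- The monomial `[s, t]` in Rota-Baxter Lie operations. -/
abbrev rbBr (s t : Mon RBLieUnOp RBLieOp I) : Mon RBLieUnOp RBLieOp I := .bin .bracket s t

/-- The monomial `R(t)` in Rota-Baxter Lie operations. -/
abbrev rbR (t : Mon RBLieUnOp RBLieOp I) : Mon RBLieUnOp RBLieOp I := .un .R t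

end Generators

variable (k : Type u) [CommRing k]

/-- A monomial as a linear combination of monomials. -/
abbrev mon {U B I : Type} (t : Mon U B I) : Mon U B I →₀ k := Finsupp.single t 1

/-- The presentation of post-Lie algebras by generating operations and identities. -/
abbrev postLiePresentation : Presentation k where
  U := Empty
  B := PostLieOp
  Rel := PostLieRel
  vars
    | .anticomm => Fin 2
    | .jacobi => Fin 3
    | .deriv => Fin 3
    | .assoc => Fin 3
  ident
    | .anticomm =>
      letI a₁ : Mon Empty PostLieOp (Fin 2) := .var 0
      letI a₂ : Mon Empty PostLieOp (Fin 2) := .var 1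
      mon k (plBr a₁ a₂) + mon k (plBr a₂ a₁)
    | .jacobi =>
      letI a₁ : Mon Empty PostLieOp (Fin 3) := .var 0
      letI a₂ : Mon Empty PostLieOp (Fin 3) := .var 1
      letI a₃ : Mon Empty PostLieOp (Fin 3) := .var 2
      (mon k (plBr (plBr a₁ a₂) a₃) - mon k (plBr (plBr a₁ a₃) a₂)) - mon k (plBr a₁ (plBr a₂ a₃))
    | .deriv =>
      letI a₁ : Mon Empty PostLieOp (Fin 3) := .var 0
      letI a₂ : Mon Empty PostLieOp (Fin 3) := .var 1
      letI a₃ : Mon Empty PostLieOp (Fin 3) := .var 2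
      mon k (plTri (plBr a₁ a₂) a₃) - (mon k (plBr (plTri a₁ a₃) a₂) + mon k (plBr a₁ (plTri a₂ a₃)))
    | .assoc =>
      letI a₁ : Mon Empty PostLieOp (Fin 3) := .var 0
      letI a₂ : Mon Empty PostLieOp (Fin 3) := .var 1
      letI a₃ : Mon Empty PostLieOp (Fin 3) := .var 2
      ((mon k (plTri (plTri a₁ a₂) a₃) - mon k (plTri a₁ (plTri a₂ a₃))) -
        (mon k (plTri (plTri a₁ a₃) a₂) - mon k (plTri a₁ (plTri a₃ a₂)))) -
        mon k (plTri a₁ (plBr a₂ a₃))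

/-- The presentation of Rota-Baxter Lie algebras of weight one by generating operations and
identities. -/
abbrev rbLiePresentation : Presentation k where
  U := RBLieUnOp
  B := RBLieOp
  Rel := RBLieRel
  vars
    | .anticomm => Fin 2
    | .jacobi => Fin 3
    | .rotaBaxter => Fin 2
  ident
    | .anticomm =>
      letI a₁ : Mon RBLieUnOp RBLieOp (Fin 2) := .var 0
      letI a₂ : Mon RBLieUnOp RBLieOp (Fin 2) := .var 1
      mon k (rbBr a₁ a₂) + mon k (rbBr a₂ a₁)
    | .jacobi =>
      letI a₁ : Mon RBLieUnOp RBLieOp (Fin 3) := .var 0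
      letI a₂ : Mon RBLieUnOp RBLieOp (Fin 3) := .var 1
      letI a₃ : Mon RBLieUnOp RBLieOp (Fin 3) := .var 2
      (mon k (rbBr (rbBr a₁ a₂) a₃) - mon k (rbBr (rbBr a₁ a₃) a₂)) - mon k (rbBr a₁ (rbBr a₂ a₃))
    | .rotaBaxter =>
      letI a₁ : Mon RBLieUnOp RBLieOp (Fin 2) := .var 0
      letI a₂ : Mon RBLieUnOp RBLieOp (Fin 2) := .var 1
      mon k (rbBr (rbR a₁) (rbR a₂)) -
        (mon k (rbR (rbBr (rbR a₁) a₂)) + mon k (rbR (rbBr a₁ (rbR a₂))) + mon k (rbR (rbBr a₁ a₂)))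

/-- The operad of post-Lie algebras. -/
def PostLie : SymOperad k := (postLiePresentation k).operad

/-- The operad of Rota-Baxter Lie algebras of weight one. -/
def RBLie : SymOperad k := (rbLiePresentation k).operad

variable {k}

/-- The post-Lie operations `[a, b]` and `a ◁ b = [a, R(b)]` of a Rota-Baxter Lie algebra. -/
def postLieOps {A : Type v} [AddCommGroup A] [Module k A] (o : Ops k RBLieUnOp RBLieOp A) :
    Ops k Empty PostLieOp A where
  un := Empty.elim
  bin
    | .bracket => o.bin .bracket
    | .tri => (o.bin .bracket).compl₂ (o.un .R)

theorem postLieOps_isModel {A : Type v} [AddCommGroup A] [Module k A]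
    {o : Ops k RBLieUnOp RBLieOp A} (ho : (rbLiePresentation k).IsModel o) :
    (postLiePresentation k).IsModel (postLieOps o) := by
  have anti : ∀ x y : A, o.bin .bracket x y + o.bin .bracket y x = 0 := fun x y => by
    have h : o.evalLin (I := Fin 2) ![x, y] _ = 0 := ho .anticomm ![x, y]
    simpa [rbLiePresentation, Ops.eval] using h
  have jac : ∀ x y z : A, o.bin .bracket (o.bin .bracket x y) z -
      o.bin .bracket (o.bin .bracket x z) y - o.bin .bracket x (o.bin .bracket y z) = 0 :=
    fun x y z => by
      have h : o.evalLin (I := Fin 3) ![x, y, z] _ = 0 := ho .jacobi ![x, y, z]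
      simpa [rbLiePresentation, Ops.eval] using h
  have rb : ∀ x y : A, o.bin .bracket (o.un .R x) (o.un .R y) -
      (o.un .R (o.bin .bracket (o.un .R x) y) + o.un .R (o.bin .bracket x (o.un .R y)) +
        o.un .R (o.bin .bracket x y)) = 0 :=
    fun x y => by
      have h : o.evalLin (I := Fin 2) ![x, y] _ = 0 := ho .rotaBaxter ![x, y]
      simpa [rbLiePresentation, Ops.eval] using h
  intro r
  cases r with
  | anticomm =>
    intro (a : Fin 2 → A)
    change (postLieOps o).evalLin (I := Fin 2) a _ = 0
    simpa [postLiePresentation, Ops.eval, postLieOps] using anti (a 0) (a 1)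
  | jacobi =>
    intro (a : Fin 3 → A)
    change (postLieOps o).evalLin (I := Fin 3) a _ = 0
    simpa [postLiePresentation, Ops.eval, postLieOps] using jac (a 0) (a 1) (a 2)
  | deriv =>
    intro (a : Fin 3 → A)
    change (postLieOps o).evalLin (I := Fin 3) a _ = 0
    have h := jac (a 0) (a 1) (o.un .R (a 2))
    simp only [Ops.eval, postLieOps, map_sub, map_add, Ops.evalLin_single,
      one_smul, LinearMap.compl₂_apply]
    rw [← h]
    abel
  | assoc =>
    intro (a : Fin 3 → A)
    change (postLieOps o).evalLin (I := Fin 3) a _ = 0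
    have h1 := jac (a 0) (o.un .R (a 1)) (o.un .R (a 2))
    have h2 := rb (a 1) (a 2)
    have h3 := anti (o.un .R (a 1)) (a 2)
    simp only [Ops.eval, postLieOps, map_sub, Ops.evalLin_single,
      one_smul, LinearMap.compl₂_apply]
    rw [sub_eq_zero] at h2
    rw [add_eq_zero_iff_eq_neg] at h3
    rw [h2, h3] at h1
    simp only [map_add, map_neg] at h1
    rw [← h1]
    abel

variable (k)

/-- The homomorphism of post-Lie algebras from the free post-Lie algebra on `I` to the free
Rota-Baxter Lie algebra on `I` that is the identity on the generators. -/
def alphaFree (I : Type) : (postLiePresentation k).Free I →ₗ[k] (rbLiePresentation k).Free I :=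
  Presentation.lift (postLieOps_isModel ((rbLiePresentation k).free_isModel I))
    (rbLiePresentation k).gen

theorem alphaFree_isHom (I : Type) : ((postLiePresentation k).freeOps I).IsHom
    (postLieOps ((rbLiePresentation k).freeOps I)) (alphaFree k I) :=
  Presentation.lift_isHom _ _

theorem alphaFree_gen {I : Type} (i : I) :
    alphaFree k I ((postLiePresentation k).gen i) = (rbLiePresentation k).gen i :=
  Presentation.lift_gen _ _ i

theorem alphaFree_lift {I J : Type} (b : I → (postLiePresentation k).Free J)
    (x : (postLiePresentation k).Free I) :
    alphaFree k J (Presentation.lift ((postLiePresentation k).free_isModel J) b x) =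
      Presentation.lift ((rbLiePresentation k).free_isModel J) (fun i => alphaFree k J (b i))
        (alphaFree k I x) := by
  have h : (postLieOps ((rbLiePresentation k).freeOps I)).IsHom
      (postLieOps ((rbLiePresentation k).freeOps J))
      (Presentation.lift ((rbLiePresentation k).free_isModel J)
        (fun i => alphaFree k J (b i))) := by
    have h := Presentation.lift_isHom ((rbLiePresentation k).free_isModel J)
      (fun i => alphaFree k J (b i))
    refine ⟨fun g => g.elim, fun c x y => ?_⟩
    cases c with
    | bracket => exact h.bin .bracket x y
    | tri =>
      change _ = ((rbLiePresentation k).freeOps J).bin .bracket _ _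
      rw [← h.un .R y]
      exact h.bin .bracket x _
  exact LinearMap.congr_fun (Presentation.hom_ext
    (Presentation.IsHom_comp (alphaFree_isHom k J) (Presentation.lift_isHom _ b))
    (Presentation.IsHom_comp h (alphaFree_isHom k I))
    (fun i => by
      rw [LinearMap.comp_apply, LinearMap.comp_apply, Presentation.lift_gen, alphaFree_gen,
        Presentation.lift_gen])) x

theorem alphaFree_bracket {I : Type} (x y : (postLiePresentation k).Free I) :
    alphaFree k I (((postLiePresentation k).freeOps I).bin .bracket x y) =
      ((rbLiePresentation k).freeOps I).bin .bracket (alphaFree k I x) (alphaFree k I y) :=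
  (alphaFree_isHom k I).bin .bracket x y

theorem alphaFree_tri {I : Type} (x y : (postLiePresentation k).Free I) :
    alphaFree k I (((postLiePresentation k).freeOps I).bin .tri x y) =
      ((rbLiePresentation k).freeOps I).bin .bracket (alphaFree k I x)
        (((rbLiePresentation k).freeOps I).un .R (alphaFree k I y)) :=
  (alphaFree_isHom k I).bin .tri x y

theorem alphaFree_mem {I : Type} {x : (postLiePresentation k).Free I}
    (hx : x ∈ (postLiePresentation k).multilinearPart I) :
    alphaFree k I x ∈ (rbLiePresentation k).multilinearPart I := by
  have key : ∀ t : Mon Empty PostLieOp I,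
      alphaFree k I ((postLiePresentation k).mono t) ∈ (rbLiePresentation k).degPart t.occ := by
    intro t
    rw [show alphaFree k I ((postLiePresentation k).mono t) =
      (postLieOps ((rbLiePresentation k).freeOps I)).eval (rbLiePresentation k).gen t from
        Presentation.lift_mono (T := postLiePresentation k)
          (postLieOps_isModel ((rbLiePresentation k).free_isModel I)) _ t]
    induction t with
    | var i => exact (rbLiePresentation k).gen_mem i
    | un f t ih => exact f.elim
    | bin b s t ihs iht =>
      cases b with
      | bracket => exact (rbLiePresentation k).bin_mem .bracket ihs iht
      | tri =>
        exact (rbLiePresentation k).bin_mem .bracket ihs ((rbLiePresentation k).un_mem .R iht)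
  replace hx : x ∈ Submodule.span k _ := hx
  induction hx using Submodule.span_induction with
  | mem x h =>
    obtain ⟨t, ht, rfl⟩ := h
    have := key t
    rw [ht] at this
    exact this
  | zero => simp
  | add x y _ _ hx hy => rw [map_add]; exact add_mem hx hy
  | smul c x _ hx => rw [map_smul]; exact Submodule.smul_mem _ c hx

/-- The morphism of operads `α : PostLie → RBLie` with `α([a₁, a₂]) = [a₁, a₂]` and
`α(a₁ ◁ a₂) = [a₁, R(a₂)]`. -/
def alpha : SymOperad.Hom (PostLie k) (RBLie k) where
  app I _ := (alphaFree k I).restrict (fun _ hx => alphaFree_mem k hx)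
  app_map σ p := Subtype.ext <| by
    change alphaFree k _ (Presentation.freeMap _ _ p.1) =
      Presentation.freeMap _ _ (alphaFree k _ p.1)
    rw [alphaFree_lift]
    simp [alphaFree_gen]
  app_one := Subtype.ext (alphaFree_gen k ())
  app_comp p q := Subtype.ext <| by
    change alphaFree k _ (Presentation.subst _ _ p.1) =
      Presentation.subst _ (fun i => alphaFree k _ (q i).1) (alphaFree k _ p.1)
    simp only [Presentation.subst, alphaFree_lift, alphaFree_gen]

end OperadPBW

end

/-! Write U for the universal enveloping Rota–Baxter Lie algebra `EnvRB k A`, and L° for the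
sub-adjacent Lie algebra of a post-Lie algebra L, with bracket a ◁ b − b ◁ a + [a, b]. The plan is
to describe the vector space U by a recursion that involves only the vector space A. The solution is
then the same for every post-Lie structure on A, and X(V) can be taken to be U for V with zero
operations.

The Rota–Baxter identity says that R : U° → U is a Lie homomorphism. A semidirect product gives a
linear retraction `EnvRB.ret` of U onto A that is a homomorphism U° → A°; let C be its kernel
`EnvRB.Aug`, an ideal of U°. Since R(A) normalizes A (through ◁) and R(C), one expects U to be (A *
R(C)) ⋊ R(A) as a Lie algebra, with * the free product. In characteristic zero the kernel of A * C →
A × C is free on a copy of S⁺(A) ⊗ S⁺(C), so dividing by A suggests C ≅ A ⊕ C ⊕ Lie(S⁺(A) ⊗ S⁺(C)).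
The map `EnvRB.augParam` realizes this: (b, c, x) goes to the class of R(b) + R(c) + (value of x),
where a generator vᵖ ⊗ z^q has as value an iterated commutator of v and R(z).

Injectivity. By `EnvRB.exists_extension`, the values of a Lie homomorphism on A and on R(U) may be
prescribed subject to one compatibility. One choice kills A and sends R(y) to y; it detects the
summand R(b + c) (`EnvRB.eq_zero_of_R_mem`). Another lets U act on the coproduct of the enveloping
algebras of A and C, where mixed commutators are free and independent of A
(`lieValue_inl_inr_injective`). This rests on an explicit representation on the convolution algebra
of linear maps U(h) → T(U(g) ⊗ U(h)), on a leading-term argument, and on the Poincaré–Birkhoff–Witt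
theorem in the form `exists_leftInverse_toEnv`, proved with the Eulerian idempotent.

Surjectivity. Count Rota–Baxter operators. Every element of U has the form a + R(y) + (mixed
commutators) (`EnvRB.IsNormal.lie`), and mixed commutators can be symmetrized (`MixedFil.mem`). The
parameters of an element of level n + 1 have level n (`EnvRB.exists_augParam_eq`), so linear maps
can be defined by recursion, uniquely (`ParamSystem.exists_recursion`, `ParamSystem.hom_ext`);
uniqueness also gives naturality (`ParamSystem.equiv_natural`).

Finally, algebras over a presented operad are identified with models of the presentation. The
identities being multilinear, this comes down to `act_monOp` and `algOps_isModel`. -/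

noncomputable section

namespace RotaBaxterPBW

open scoped TensorProduct

attribute [local instance] LieRing.ofAssociativeRing

/-! ### Polarization -/

section Polarization

variable {k : Type*} [Field k] {V M : Type*} [AddCommGroup V] [Module k V]
  [AddCommGroup M] [Module k M]

/-- Inclusion–exclusion: each diagonal value expands into a sum over index maps `r`, and for fixed
`r` the alternating sum over the sets `T` missed by `r` vanishes unless `r` is onto. -/
theorem sum_perm_eq_polarization {n : ℕ} (g : MultilinearMap k (fun _ : Fin n => V) M)
    (x : Fin n → V) :
    ∑ T ∈ (Finset.univ : Finset (Fin n)).powerset, (-1 : ℤ) ^ T.card • g (fun _ => ∑ i ∈ Tᶜ, x i) =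
      ∑ σ : Equiv.Perm (Fin n), g (x ∘ σ) := by
  classical
  have h1 : ∀ T : Finset (Fin n), g (fun _ => ∑ i ∈ Tᶜ, x i) =
      ∑ r : Fin n → Fin n, if T ⊆ (Finset.univ.image r)ᶜ then g (x ∘ r) else 0 := by
    intro T
    rw [MultilinearMap.map_sum_finset (f := g) (g := fun _ j => x j) (A := fun _ => Tᶜ),
      ← Finset.sum_filter]
    refine Finset.sum_congr ?_ (fun r _ => rfl)
    ext r
    simp only [Fintype.mem_piFinset, Finset.mem_filter, Finset.mem_univ, true_and]
    constructor
    · intro h i hi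
      simp only [Finset.mem_compl, Finset.mem_image, Finset.mem_univ, true_and, not_exists]
      rintro a rfl
      exact (Finset.mem_compl.1 (h a)) hi
    · intro h a
      rw [Finset.mem_compl]
      intro ha
      exact Finset.mem_compl.1 (h ha) (Finset.mem_image_of_mem r (Finset.mem_univ a))
  simp_rw [h1, Finset.smul_sum]
  rw [Finset.sum_comm]
  have h2 : ∀ r : Fin n → Fin n, (∑ T ∈ (Finset.univ : Finset (Fin n)).powerset,
      (-1 : ℤ) ^ T.card • (if T ⊆ (Finset.univ.image r)ᶜ then g (x ∘ r) else 0)) =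
      if Function.Bijective r then g (x ∘ r) else 0 := by
    intro r
    have h3 : ∑ T ∈ (Finset.univ.image r)ᶜ.powerset, (-1 : ℤ) ^ T.card • g (x ∘ r) =
        if Function.Bijective r then g (x ∘ r) else 0 := by
      rw [← Finset.sum_smul, Finset.sum_powerset_neg_one_pow_card]
      have : ((Finset.univ.image r)ᶜ = ∅) ↔ Function.Bijective r := by
        rw [Finset.compl_eq_empty_iff, ← Finite.surjective_iff_bijective,
          ← Finset.coe_eq_univ, Finset.coe_image, Finset.coe_univ, Set.image_univ,
          Set.range_eq_univ]
      simp only [this, ite_smul, one_smul, zero_smul]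
    rw [← h3]
    simp only [smul_ite, smul_zero]
    rw [← Finset.sum_filter]
    refine Finset.sum_congr ?_ (fun _ _ => rfl)
    ext T
    simp
  simp_rw [h2]
  rw [← Finset.sum_filter]
  symm
  refine Finset.sum_bij (fun σ _ => (σ : Fin n → Fin n)) (fun σ _ => Finset.mem_filter.2 ⟨Finset.mem_univ _, σ.bijective⟩)
    (fun _ _ _ _ h => Equiv.coe_fn_injective h) (fun r hr => ?_) (fun _ _ => rfl)
  exact ⟨Equiv.ofBijective r (Finset.mem_filter.1 hr).2, Finset.mem_univ _, rfl⟩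

/-- When permuting the arguments does not change the value, polarization expresses n! times that
value by diagonal values, and n! is invertible in characteristic zero. -/
theorem multilinear_eq_zero_of_diag [CharZero k] {n : ℕ} (g : MultilinearMap k (fun _ : Fin n => V) M)
    (S : Submodule k V) (hdiag : ∀ y ∈ S, g (fun _ => y) = 0) (x : Fin n → V) (hx : ∀ i, x i ∈ S)
    (hsymm : ∀ σ : Equiv.Perm (Fin n), g (x ∘ σ) = g x) : g x = 0 := by
  have h := sum_perm_eq_polarization g x
  rw [Finset.sum_eq_zero (fun T _ => by
    rw [hdiag _ (Submodule.sum_mem _ fun i _ => hx i), smul_zero]), Finset.sum_congr rfl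
    (fun σ _ => hsymm σ), Finset.sum_const, Finset.card_univ] at h
  rw [← Nat.cast_smul_eq_nsmul k] at h
  refine (smul_eq_zero.1 h.symm).resolve_left ?_
  exact_mod_cast Fintype.card_ne_zero

/-- The product in the tensor algebra of the elements of a list. -/
def word (l : List V) : TensorAlgebra k V := (l.map (TensorAlgebra.ι k)).prod

@[simp] theorem word_nil : word (k := k) ([] : List V) = 1 := rfl

@[simp] theorem word_cons (x : V) (l : List V) :
    word (k := k) (x :: l) = TensorAlgebra.ι k x * word l := by simp [word]

theorem word_append (l l' : List V) : word (k := k) (l ++ l') = word l * word l' := by simp [word]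

theorem word_replicate (n : ℕ) (x : V) :
    word (k := k) (List.replicate n x) = TensorAlgebra.ι k x ^ n := by simp [word]

theorem span_word : Submodule.span k (Set.range (word (k := k) (V := V))) = ⊤ := by
  rw [eq_top_iff]
  rintro x -
  induction x using TensorAlgebra.induction with
  | algebraMap r =>
    rw [Algebra.algebraMap_eq_smul_one]
    exact Submodule.smul_mem _ _ (Submodule.subset_span ⟨[], rfl⟩)
  | ι x => exact Submodule.subset_span ⟨[x], by simp⟩
  | mul a b ha hb =>
    have := Submodule.mul_mem_mul ha hb
    rw [Submodule.span_mul_span] at this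
    refine Submodule.span_mono ?_ this
    rintro _ ⟨_, ⟨l, rfl⟩, _, ⟨l', rfl⟩, rfl⟩
    exact ⟨l ++ l', word_append l l'⟩
  | add a b ha hb => exact add_mem ha hb

/-- The common step of all symmetrization arguments: once `f` is insensitive to the order of the
letters, only powers have to be checked. Insensitivity is required for the rearrangements of this
one word only, so that it may come from an induction on length. -/
theorem map_word_eq_zero [CharZero k] (f : TensorAlgebra k V →ₗ[k] M) (S : Submodule k V) (l : List V)
    (hpow : ∀ x ∈ S, f (TensorAlgebra.ι k x ^ l.length) = 0) (hl : ∀ x ∈ l, x ∈ S)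
    (hperm : ∀ l', l'.Perm l → f (word l') = f (word l)) : f (word l) = 0 := by
  have key : ∀ x : Fin l.length → V,
      (f.compMultilinearMap (TensorAlgebra.tprod k V l.length)) x = f (word (List.ofFn x)) := by
    intro x
    simp [TensorAlgebra.tprod_apply, word, List.map_ofFn, Function.comp_def]
  have h := multilinear_eq_zero_of_diag (f.compMultilinearMap (TensorAlgebra.tprod k V l.length)) S
    (fun y hy => by rw [key, List.ofFn_const, word_replicate, hpow y hy]) l.get
    (fun i => hl _ (List.get_mem l i)) (fun σ => by
      rw [key, key, List.ofFn_get]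
      refine hperm _ ?_
      conv_rhs => rw [← List.ofFn_get l]
      exact Equiv.Perm.ofFn_comp_perm σ l.get)
  rwa [key, List.ofFn_get] at h

/-- Adjacent swaps generate all permutations. The strengthened claim carries a prefix `p`, so that a
swap deep inside the list is still a swap in a rearrangement of all of `l`. -/
theorem eq_of_perm_of_swap {α β : Type*} (F : List α → β) (l : List α)
    (hswap : ∀ l₁ x y l₂, (l₁ ++ x :: y :: l₂).Perm l →
      F (l₁ ++ x :: y :: l₂) = F (l₁ ++ y :: x :: l₂)) {l' : List α} (h : l'.Perm l) :
    F l' = F l := by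
  suffices ∀ {l₁ l₂ : List α}, l₁.Perm l₂ → ∀ p, (p ++ l₁).Perm l → F (p ++ l₁) = F (p ++ l₂) from
    this h [] h
  intro l₁ l₂ h
  induction h with
  | nil => intros; rfl
  | @cons x l₁ l₂ h ih =>
    intro p hp
    have := ih (p ++ [x]) (by simpa using hp)
    simpa using this
  | swap x y l => intro p hp; exact hswap p y x l hp
  | @trans l₁ l₂ l₃ h₁ h₂ ih₁ ih₂ =>
    intro p hp
    rw [ih₁ p hp, ih₂ p (((List.perm_append_left_iff p).2 h₁).symm.trans hp)]

end Polarization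

/-! ### The tensor algebra: derivations, degrees, free Lie algebras -/

section Derivations

variable {k : Type*} [Field k]

/-- The derivation given by an algebra homomorphism to dual numbers. -/
def sndHom {R S : Type*} [Ring R] [Algebra k R] [Ring S] [Algebra k S] (Φ : R →ₐ[k] DualNumber S) :
    R →ₗ[k] S :=
  TrivSqZeroExt.sndHom S S |>.restrictScalars k |>.comp Φ.toLinearMap

theorem sndHom_mul {R S : Type*} [Ring R] [Algebra k R] [Ring S] [Algebra k S]
    (Φ : R →ₐ[k] DualNumber S) (x y : R) :
    sndHom Φ (x * y) = (Φ x).fst * sndHom Φ y + sndHom Φ x * (Φ y).fst := by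
  simp [sndHom]

variable {V : Type*} [AddCommGroup V] [Module k V]

/-- The homomorphism to dual numbers given by a linear map. -/
def tensorDualHom (d : V →ₗ[k] TensorAlgebra k V) :
    TensorAlgebra k V →ₐ[k] DualNumber (TensorAlgebra k V) :=
  TensorAlgebra.lift k
    ((TrivSqZeroExt.inlAlgHom k (TensorAlgebra k V) (TensorAlgebra k V)).toLinearMap ∘ₗ
      TensorAlgebra.ι k +
      (TrivSqZeroExt.inrHom (TensorAlgebra k V) (TensorAlgebra k V)).restrictScalars k ∘ₗ d)

theorem tensorDualHom_fst (d : V →ₗ[k] TensorAlgebra k V) (x : TensorAlgebra k V) :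
    (tensorDualHom d x).fst = x := by
  have : (TrivSqZeroExt.fstHom k (TensorAlgebra k V) (TensorAlgebra k V)).comp (tensorDualHom d) =
      AlgHom.id k _ := by
    ext v
    simp [tensorDualHom]
  exact DFunLike.congr_fun this x

/-- The derivation of the tensor algebra given by its values on the generators. -/
def tensorDer (d : V →ₗ[k] TensorAlgebra k V) : TensorAlgebra k V →ₗ[k] TensorAlgebra k V :=
  sndHom (tensorDualHom d)

@[simp] theorem tensorDer_ι (d : V →ₗ[k] TensorAlgebra k V) (v : V) :
    tensorDer d (TensorAlgebra.ι k v) = d v := by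
  simp [tensorDer, sndHom, tensorDualHom]

theorem tensorDer_mul (d : V →ₗ[k] TensorAlgebra k V) (x y : TensorAlgebra k V) :
    tensorDer d (x * y) = x * tensorDer d y + tensorDer d x * y := by
  rw [tensorDer, sndHom_mul, tensorDualHom_fst, tensorDualHom_fst]

@[simp] theorem tensorDer_one (d : V →ₗ[k] TensorAlgebra k V) : tensorDer d 1 = 0 := by
  simp [tensorDer, sndHom]

end Derivations

/-! ### The grading of the tensor algebra -/

section Degree

variable {k : Type*} [Field k] {V : Type*} [AddCommGroup V] [Module k V]

/-- The homomorphism `T(V) → T(V)[X]` multiplying the elements of `V` by `X`. -/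
def scaling : TensorAlgebra k V →ₐ[k] Polynomial (TensorAlgebra k V) :=
  TensorAlgebra.lift k (((Polynomial.monomial 1).restrictScalars k).comp (TensorAlgebra.ι k))

@[simp] theorem scaling_ι (x : V) :
    scaling (TensorAlgebra.ι k x) = Polynomial.monomial 1 (TensorAlgebra.ι k x) := by
  simp [scaling]

/-- The homogeneous component of an element of the tensor algebra. -/
def deg (n : ℕ) : TensorAlgebra k V →ₗ[k] TensorAlgebra k V :=
  ((Polynomial.lcoeff (TensorAlgebra k V) n).restrictScalars k).comp scaling.toLinearMap

theorem deg_apply (n : ℕ) (x : TensorAlgebra k V) : deg n x = (scaling x).coeff n := rfl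

theorem scaling_word (l : List V) :
    scaling (k := k) (word l) = Polynomial.monomial l.length (word l) := by
  induction l with
  | nil => simp
  | cons x l ih => simp [ih, Polynomial.monomial_mul_monomial, add_comm]

theorem deg_word (n : ℕ) (l : List V) :
    deg (k := k) n (word l) = if l.length = n then word l else 0 := by
  rw [deg_apply, scaling_word, Polynomial.coeff_monomial]

theorem deg_mul (n : ℕ) (x y : TensorAlgebra k V) :
    deg n (x * y) = ∑ p ∈ Finset.HasAntidiagonal.antidiagonal n, deg p.1 x * deg p.2 y := by
  simp [deg_apply, Polynomial.coeff_mul]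

theorem eval_scaling (x : TensorAlgebra k V) : (scaling x).eval 1 = x := by
  have h : x ∈ Submodule.span k (Set.range (word (k := k) (V := V))) := by
    rw [span_word]; trivial
  induction h using Submodule.span_induction with
  | mem x h => obtain ⟨l, rfl⟩ := h; simp [scaling_word]
  | zero => simp
  | add x y _ _ hx hy => simp [hx, hy]
  | smul c x _ hx => rw [map_smul, Polynomial.eval_smul, hx]

theorem exists_sum_deg (x : TensorAlgebra k V) :
    ∃ N, (∀ n, N ≤ n → deg n x = 0) ∧ x = ∑ n ∈ Finset.range N, deg n x := by
  refine ⟨(scaling x).natDegree + 1, fun n hn => ?_, ?_⟩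
  · exact Polynomial.coeff_eq_zero_of_natDegree_lt (Nat.lt_of_succ_le hn)
  · conv_lhs => rw [← eval_scaling x, Polynomial.eval_eq_sum_range]
    simp [deg_apply]

/-- Division of the homogeneous elements by their degree. -/
def divDeg : TensorAlgebra k V →ₗ[k] TensorAlgebra k V :=
  (Polynomial.lsum (fun n => (n : k)⁻¹ • (LinearMap.id : TensorAlgebra k V →ₗ[k] _))).comp
    scaling.toLinearMap

/-- Homogeneity of degree `n` is expressed by `scaling`. For `n = 0` the inverse is `0`, so `divDeg`
kills constants. -/
theorem divDeg_of_scaling {n : ℕ} {x : TensorAlgebra k V}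
    (h : scaling x = Polynomial.monomial n x) : divDeg x = (n : k)⁻¹ • x := by
  simp [divDeg, h, Polynomial.sum_monomial_index]

end Degree

/-! ### Derivations of the tensor algebra with values in a left module -/

section Cocycle

variable {k : Type*} [Field k] {V M : Type*} [AddCommGroup V] [Module k V]
  [AddCommGroup M] [Module k M]

local notation "T" => TensorAlgebra k V
local notation "ε" => (TensorAlgebra.algebraMapInv : TensorAlgebra k V →ₐ[k] k)

@[simp] theorem algebraMapInv_ι (x : V) : ε (TensorAlgebra.ι k x) = 0 := by
  simp [TensorAlgebra.algebraMapInv]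

variable (k V) in
/-- The action of the tensor algebra used to define `splitLast`. -/
def splitLastAction : T →ₐ[k] Module.End k ((T ⊗[k] V) × k) :=
  TensorAlgebra.lift k <| LinearMap.mk₂ k
    -- The scalar coordinate is `1` only before any letter has acted. The first letter to act on
    -- `(0, 1)` is the last letter of the word: it goes to the right factor and resets the scalar to
    -- `0`; the others multiply on the left.
    (fun v p => ((LinearMap.mulLeft k (TensorAlgebra.ι k v)).rTensor V p.1 + p.2 • (1 ⊗ₜ v), 0))
    (fun v v' p => by
      ext1
      · have : LinearMap.mulLeft k (TensorAlgebra.ι k (v + v')) =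
          LinearMap.mulLeft k (TensorAlgebra.ι k v) + LinearMap.mulLeft k (TensorAlgebra.ι k v') := by
          ext; simp [add_mul]
        simp only [this, LinearMap.rTensor_add, LinearMap.add_apply, TensorProduct.tmul_add,
          smul_add, Prod.fst_add]
        abel
      · simp)
    (fun c v p => by
      ext1
      · have : LinearMap.mulLeft k (TensorAlgebra.ι k (c • v)) =
          c • LinearMap.mulLeft k (TensorAlgebra.ι k v) := by
          ext; simp
        simp only [this, LinearMap.rTensor_smul, LinearMap.smul_apply, TensorProduct.tmul_smul,
          smul_add, Prod.smul_fst, smul_comm p.2 c]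
      · simp)
    (fun v p q => by
      ext1
      · simp only [Prod.fst_add, Prod.snd_add, map_add, add_smul]
        abel
      · simp)
    (fun c v p => by
      ext1
      · simp [smul_smul]
      · simp)

variable (k V) in
/-- The linear map with `v₁ ⋯ vₙ ↦ v₁ ⋯ vₙ₋₁ ⊗ vₙ`. -/
def splitLast : T →ₗ[k] T ⊗[k] V :=
  LinearMap.fst k _ _ ∘ₗ LinearMap.applyₗ ((0, 1) : (T ⊗[k] V) × k) ∘ₗ
    (splitLastAction k V).toLinearMap

@[simp] theorem splitLast_one : splitLast k V 1 = 0 := by simp [splitLast]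

theorem splitLast_ι_mul (v : V) (x : T) : splitLast k V (TensorAlgebra.ι k v * x) =
    (LinearMap.mulLeft k (TensorAlgebra.ι k v)).rTensor V (splitLast k V x) + ε x • (1 ⊗ₜ v) := by
  -- The scalar coordinate of the state is the counit, since every letter resets it to `0`.
  have h : (splitLastAction k V x (0, 1)).2 = ε x := by
    have hx : x ∈ Submodule.span k (Set.range (word (k := k) (V := V))) := by
      rw [span_word]; trivial
    induction hx using Submodule.span_induction with
    | mem x h =>
      obtain ⟨l, rfl⟩ := h
      cases l with
      | nil => simp
      | cons x l => simp [splitLastAction]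
    | zero => simp
    | add x y _ _ hx hy => simp [hx, hy]
    | smul c x _ hx => simp [hx]
  simp [splitLast, ← h, splitLastAction]

/-- For an action `α` of the tensor algebra on `M`, the linear map with
`v₁ ⋯ vₙ ↦ v₁ • ⋯ vₙ₋₁ • g vₙ`. -/
def cocycle (α : T →ₐ[k] Module.End k M) : (V →ₗ[k] M) →ₗ[k] T →ₗ[k] M where
  toFun g := TensorProduct.lift (α.toLinearMap.compl₂ g) ∘ₗ splitLast k V
  map_add' g g' := by
    rw [← LinearMap.add_comp]
    congr 1
    ext
    simp
  map_smul' c g := by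
    rw [RingHom.id_apply, ← LinearMap.smul_comp]
    congr 1
    ext
    simp

@[simp] theorem cocycle_one (α : T →ₐ[k] Module.End k M) (g : V →ₗ[k] M) :
    cocycle α g 1 = 0 := by simp [cocycle]

theorem cocycle_ι_mul (α : T →ₐ[k] Module.End k M) (g : V →ₗ[k] M) (v : V) (x : T) :
    cocycle α g (TensorAlgebra.ι k v * x) =
    α (TensorAlgebra.ι k v) (cocycle α g x) + ε x • g v := by
  have h : ∀ y : T ⊗[k] V, TensorProduct.lift (α.toLinearMap.compl₂ g)
      ((LinearMap.mulLeft k (TensorAlgebra.ι k v)).rTensor V y) =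
      α (TensorAlgebra.ι k v) (TensorProduct.lift (α.toLinearMap.compl₂ g) y) := by
    intro y
    induction y with
    | zero => simp
    | add y z hy hz => simp only [map_add, hy, hz]
    | tmul y z => simp
  simp [cocycle, splitLast_ι_mul, h]

@[simp] theorem cocycle_ι (α : T →ₐ[k] Module.End k M) (g : V →ₗ[k] M) (v : V) :
    cocycle α g (TensorAlgebra.ι k v) = g v := by
  have := cocycle_ι_mul α g v 1
  simpa using this

/-- This is the Leibniz rule when `T` acts on `M` on the left through `α` and on the right through
the counit; `cocycle α g` is the derivation extending `g`. -/
theorem cocycle_mul (α : T →ₐ[k] Module.End k M) (g : V →ₗ[k] M) (x y : T) :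
    cocycle α g (x * y) = α x (cocycle α g y) + ε y • cocycle α g x := by
  have hx : x ∈ Submodule.span k (Set.range (word (k := k) (V := V))) := by
    rw [span_word]; trivial
  induction hx using Submodule.span_induction with
  | mem x h =>
    obtain ⟨l, rfl⟩ := h
    induction l with
    | nil => simp
    | cons v l ih =>
      rw [word_cons, mul_assoc, cocycle_ι_mul, ih, cocycle_ι_mul]
      simp only [map_add, map_smul, map_mul, Module.End.mul_apply, smul_add, smul_smul, add_assoc]
      rw [mul_comm]
  | zero => simp
  | add a b _ _ ha hb =>
    simp only [add_mul, map_add, ha, hb, LinearMap.add_apply, smul_add]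
    abel
  | smul c a _ ha =>
    simp only [smul_mul_assoc, map_smul, ha, LinearMap.smul_apply, smul_add, smul_comm c]

theorem cocycle_comp (α : T →ₐ[k] Module.End k M) (g : V →ₗ[k] M) {M' : Type*} [AddCommGroup M'] [Module k M'] (α' : T →ₐ[k] Module.End k M')
    (f : M →ₗ[k] M') (h : ∀ v m, f (α (TensorAlgebra.ι k v) m) = α' (TensorAlgebra.ι k v) (f m))
    (x : T) : f (cocycle α g x) = cocycle α' (f ∘ₗ g) x := by
  have hx : x ∈ Submodule.span k (Set.range (word (k := k) (V := V))) := by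
    rw [span_word]; trivial
  induction hx using Submodule.span_induction with
  | mem x h =>
    obtain ⟨l, rfl⟩ := h
    induction l with
    | nil => simp
    | cons v l ih => simp [cocycle_ι_mul, h, ih]
  | zero => simp
  | add a b _ _ ha hb => simp only [map_add, ha, hb]
  | smul c a _ ha => simp only [map_smul, ha]

end Cocycle

/-! ### Lie elements of the tensor algebra and their values -/

section FreeLie

variable {k : Type*} [Field k] {V : Type*} [AddCommGroup V] [Module k V]
  {J : Type*} [LieRing J] [LieAlgebra k J]

local notation "T" => TensorAlgebra k V

variable (k V) in
/-- The free Lie algebra on a vector space, as a subalgebra of the tensor algebra. -/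
abbrev FreeLie : LieSubalgebra k T := LieSubalgebra.lieSpan k T (Set.range (TensorAlgebra.ι k))

/-- The action of the tensor algebra of `V` on a Lie algebra `J` given by a linear map `V → J`. -/
def adAction (f : V →ₗ[k] J) : T →ₐ[k] Module.End k J :=
  TensorAlgebra.lift k ((LieAlgebra.ad k J).toLinearMap ∘ₗ f)

@[simp] theorem adAction_ι (f : V →ₗ[k] J) (v : V) (y : J) :
    adAction f (TensorAlgebra.ι k v) y = ⁅f v, y⁆ := by
  simp [adAction]

/-- Homogeneous Lie elements of the tensor algebra, together with their degrees and values. -/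
inductive HomogLie (f : V →ₗ[k] J) : ℕ → T → J → Prop
  | ι (v : V) : HomogLie f 1 (TensorAlgebra.ι k v) (f v)
  | lie {m n x y x' y'} : HomogLie f m x y → HomogLie f n x' y' → HomogLie f (m + n) ⁅x, x'⁆ ⁅y, y'⁆

/-- The value of Lie elements, as a linear map on the tensor algebra. -/
def lieValue (f : V →ₗ[k] J) : T →ₗ[k] J := cocycle (adAction f) f ∘ₗ divDeg

/-- The Dynkin–Specht–Wever argument. A Lie element acts through the adjoint action of its value and
has counit zero; the Leibniz rule for the cocycle then gives m + n times the bracket on a bracket of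
elements of degrees m and n. The five properties are proved together because the last one uses the
others for both entries. -/
theorem HomogLie.props {f : V →ₗ[k] J} {n : ℕ} {x : T} {y : J} (h : HomogLie f n x y) :
    0 < n ∧ scaling x = Polynomial.monomial n x ∧ adAction f x = LieAlgebra.ad k J y ∧
      TensorAlgebra.algebraMapInv x = 0 ∧ cocycle (adAction f) f x = n • y := by
  induction h with
  | ι v => exact ⟨one_pos, by simp, by ext; simp, by simp, by simp⟩
  | @lie m n x y x' y' _ _ ih ih' =>
    obtain ⟨p, a, b, c, d⟩ := ih
    obtain ⟨p', a', b', c', d'⟩ := ih'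
    refine ⟨by omega, ?_, ?_, ?_, ?_⟩
    · rw [LieRing.of_associative_ring_bracket, map_sub, map_mul, map_mul, a, a',
        Polynomial.monomial_mul_monomial, Polynomial.monomial_mul_monomial, add_comm n m, map_sub]
    · rw [LieRing.of_associative_ring_bracket, map_sub, map_mul, map_mul, b, b', LieHom.map_lie,
        LieRing.of_associative_ring_bracket]
    · rw [LieRing.of_associative_ring_bracket, map_sub, map_mul, map_mul, c, c']
      simp
    · rw [LieRing.of_associative_ring_bracket, map_sub, cocycle_mul, cocycle_mul, b, b', c, c', d,
        d']
      simp only [LieAlgebra.ad_apply, lie_nsmul, zero_smul, add_zero]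
      rw [← lie_skew y' y, smul_neg, sub_neg_eq_add, ← add_smul, add_comm n m]

/-- Division by the degree turns n times the value into the value. In particular the value in
`HomogLie` depends only on the element, and linearly so. -/
theorem HomogLie.lieValue_eq [CharZero k] {f : V →ₗ[k] J} {n : ℕ} {x : T} {y : J} (h : HomogLie f n x y) :
    lieValue f x = y := by
  obtain ⟨p, a, b, c, d⟩ := h.props
  rw [lieValue, LinearMap.comp_apply, divDeg_of_scaling a, map_smul, d, ← Nat.cast_smul_eq_nsmul k,
    smul_smul, inv_mul_cancel₀ (by exact_mod_cast p.ne'), one_smul]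

theorem freeLie_le_span (f : V →ₗ[k] J) {x : T} (hx : x ∈ FreeLie k V) :
    x ∈ Submodule.span k {x | ∃ n y, HomogLie f n x y} := by
  induction hx using LieSubalgebra.lieSpan_induction with
  | mem x h => obtain ⟨v, rfl⟩ := h; exact Submodule.subset_span ⟨1, f v, .ι v⟩
  | zero => exact zero_mem _
  | add x y _ _ hx hy => exact add_mem hx hy
  | smul c x _ hx => exact Submodule.smul_mem _ c hx
  | lie x y h h' hx hy =>
    clear h h'
    induction hx, hy using Submodule.span_induction₂ with
    | mem_mem x y hx hy =>
      obtain ⟨m, a, ha⟩ := hx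
      obtain ⟨n, b, hb⟩ := hy
      exact Submodule.subset_span ⟨_, _, ha.lie hb⟩
    | zero_left y hy => simp
    | zero_right x hx => simp
    | add_left x y z _ _ _ h₁ h₂ => rw [add_lie]; exact add_mem h₁ h₂
    | add_right x y z _ _ _ h₁ h₂ => rw [lie_add]; exact add_mem h₁ h₂
    | smul_left r x y _ _ h => rw [smul_lie]; exact Submodule.smul_mem _ _ h
    | smul_right r x y _ _ h => rw [lie_smul]; exact Submodule.smul_mem _ _ h

/-- Together with `lieValue_ι` this is the universal property of the free Lie algebra. The map
`lieValue f` is defined on all tensors, which keeps later formulas linear, but its multiplicativity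
concerns Lie elements. -/
theorem lieValue_lie [CharZero k] (f : V →ₗ[k] J) {x y : T} (hx : x ∈ FreeLie k V) (hy : y ∈ FreeLie k V) :
    lieValue f ⁅x, y⁆ = ⁅lieValue f x, lieValue f y⁆ := by
  replace hx := freeLie_le_span f hx
  replace hy := freeLie_le_span f hy
  induction hx, hy using Submodule.span_induction₂ with
  | mem_mem x y hx hy =>
    obtain ⟨m, a, ha⟩ := hx
    obtain ⟨n, b, hb⟩ := hy
    rw [ha.lieValue_eq, hb.lieValue_eq, (ha.lie hb).lieValue_eq]
  | zero_left y hy => simp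
  | zero_right x hx => simp
  | add_left x y z _ _ _ h₁ h₂ => rw [add_lie, map_add, h₁, h₂, map_add, add_lie]
  | add_right x y z _ _ _ h₁ h₂ => rw [lie_add, map_add, h₁, h₂, map_add, lie_add]
  | smul_left r x y _ _ h => rw [smul_lie, map_smul, h, map_smul, smul_lie]
  | smul_right r x y _ _ h => rw [lie_smul, map_smul, h, map_smul, lie_smul]

@[simp] theorem lieValue_ι [CharZero k] (f : V →ₗ[k] J) (v : V) : lieValue f (TensorAlgebra.ι k v) = f v :=
  (HomogLie.ι v).lieValue_eq

end FreeLie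

/-! ### The Poincaré–Birkhoff–Witt theorem -/

theorem word_induction {k : Type*} [Field k] {V : Type*} [AddCommGroup V] [Module k V]
    {p : TensorAlgebra k V → Prop} (x : TensorAlgebra k V) (hword : ∀ l, p (word l)) (hzero : p 0)
    (hadd : ∀ x y, p x → p y → p (x + y)) (hsmul : ∀ (c : k) x, p x → p (c • x)) : p x := by
  have h : x ∈ Submodule.span k (Set.range (word (k := k) (V := V))) := by
    rw [span_word]; trivial
  induction h using Submodule.span_induction with
  | mem x h => obtain ⟨l, rfl⟩ := h; exact hword l
  | zero => exact hzero
  | add x y _ _ hx hy => exact hadd x y hx hy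
  | smul c x _ hx => exact hsmul c x hx

/-! ### The second Adams operation and the Eulerian idempotent -/

section Primitive

variable {k : Type*} [Field k] {V : Type*} [AddCommGroup V] [Module k V]

local notation "T" => TensorAlgebra k V

variable (k V) in
/-- The comultiplication of the tensor algebra for which the elements of `V` are primitive. -/
def tensorComul : T →ₐ[k] T ⊗[k] T :=
  TensorAlgebra.lift k
    ((Algebra.TensorProduct.includeLeft (R := k) (S := k) (A := T) (B := T)).toLinearMap ∘ₗ
        TensorAlgebra.ι k +
      (Algebra.TensorProduct.includeRight (R := k) (A := T) (B := T)).toLinearMap ∘ₗ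
        TensorAlgebra.ι k)

theorem tensorComul_freeLie {f : T} (hf : f ∈ FreeLie k V) :
    tensorComul k V f = f ⊗ₜ 1 + 1 ⊗ₜ f := by
  induction hf using LieSubalgebra.lieSpan_induction with
  | mem x h => obtain ⟨v, rfl⟩ := h; simp [tensorComul]
  | zero => simp
  | add x y _ _ hx hy => rw [map_add, hx, hy, TensorProduct.add_tmul, TensorProduct.tmul_add]; abel
  | smul c x _ hx => rw [map_smul, hx, smul_add, TensorProduct.tmul_smul, TensorProduct.smul_tmul']
  | lie x y _ _ hx hy =>
    simp only [LieRing.of_associative_ring_bracket, map_sub, map_mul, hx, hy, mul_add, add_mul,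
      Algebra.TensorProduct.tmul_mul_tmul, one_mul, mul_one, TensorProduct.sub_tmul,
      TensorProduct.tmul_sub]
    abel

theorem sum_choose_smul_pow {R S : Type*} [Ring R] [Algebra k R] [Ring S] [Algebra k S] (x : R)
    (y : S) (n : ℕ) : (x ⊗ₜ[k] (1 : S) + (1 : R) ⊗ₜ[k] y) ^ n =
      ∑ m ∈ Finset.range (n + 1), ((Nat.choose n m : ℕ) : k) • ((x ^ m) ⊗ₜ[k] (y ^ (n - m))) := by
  have h : Commute (x ⊗ₜ[k] (1 : S)) ((1 : R) ⊗ₜ[k] y) := by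
    simp [Commute, SemiconjBy]
  rw [h.add_pow]
  refine Finset.sum_congr rfl fun m _ => ?_
  rw [Algebra.TensorProduct.tmul_pow, Algebra.TensorProduct.tmul_pow,
    Algebra.TensorProduct.tmul_mul_tmul, one_pow, one_pow, one_mul, mul_one,
    (Nat.cast_commute _ _).symm.eq, ← nsmul_eq_mul, Nat.cast_smul_eq_nsmul]

variable (k V) in
/-- The second Adams operation of the tensor algebra. -/
def adamsTwo : Module.End k T := LinearMap.mul' k T ∘ₗ (tensorComul k V).toLinearMap

/-- A Lie element is primitive, so the coproduct of its n-th power is a binomial sum; multiplying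
the factors back together leaves the sum of the binomial coefficients. -/
theorem adamsTwo_pow {f : T} (hf : f ∈ FreeLie k V) (n : ℕ) :
    adamsTwo k V (f ^ n) = (2 : k) ^ n • f ^ n := by
  simp only [adamsTwo, LinearMap.comp_apply, AlgHom.toLinearMap_apply, map_pow,
    tensorComul_freeLie hf, sum_choose_smul_pow, map_sum, map_smul, LinearMap.mul'_apply]
  rw [Finset.sum_congr rfl (g := fun m => ((Nat.choose n m : ℕ) : k) • f ^ n), ← Finset.sum_smul]
  · congr 1
    exact_mod_cast congrArg (Nat.cast (R := k)) (Nat.sum_range_choose n)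
  · intro m hm
    rw [← pow_add, Nat.add_sub_cancel' (Nat.lt_succ_iff.1 (Finset.mem_range.1 hm))]

variable (k V) in
/-- The value of an element of the tensor algebra of the free Lie algebra. -/
def evalFreeLie : TensorAlgebra k (FreeLie k V) →ₐ[k] T :=
  TensorAlgebra.lift k (FreeLie k V).toSubmodule.subtype

@[simp] theorem evalFreeLie_ι (x : FreeLie k V) :
    evalFreeLie k V (TensorAlgebra.ι k x) = x := by
  rw [evalFreeLie, TensorAlgebra.lift_ι_apply]
  rfl

/-- The generators of the free Lie algebra. -/
def FreeLie.of (v : V) : FreeLie k V :=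
  ⟨TensorAlgebra.ι k v, LieSubalgebra.subset_lieSpan ⟨v, rfl⟩⟩

theorem evalFreeLie_word_of (l : List V) :
    evalFreeLie k V (word (l.map FreeLie.of)) = word l := by
  induction l with
  | nil => simp
  | cons v l ih => simp [ih, FreeLie.of]

theorem evalFreeLie_swap (l₁ l₂ : List (FreeLie k V)) (x y : FreeLie k V) :
    evalFreeLie k V (word (l₁ ++ x :: y :: l₂)) = evalFreeLie k V (word (l₁ ++ y :: x :: l₂)) +
      evalFreeLie k V (word (l₁ ++ ⁅x, y⁆ :: l₂)) := by
  simp only [word_append, word_cons, map_mul, evalFreeLie_ι, LieSubalgebra.coe_bracket,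
    LieRing.of_associative_ring_bracket]
  noncomm_ring

/-- Swapping two neighbouring letters in a word of Lie elements changes its value by a word with one
letter fewer. Modulo shorter words the value is therefore symmetric, and polarization reduces it to
powers. -/
theorem span_freeLie_pow [CharZero k] :
    Submodule.span k {x : T | ∃ f ∈ FreeLie k V, ∃ n : ℕ, x = f ^ n} = ⊤ := by
  set S := Submodule.span k {x : T | ∃ f ∈ FreeLie k V, ∃ n : ℕ, x = f ^ n} with hS
  have key : ∀ n, ∀ l : List (FreeLie k V), l.length = n → evalFreeLie k V (word l) ∈ S := by
    intro n
    induction n with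
    | zero =>
      intro l hl
      rw [List.length_eq_zero_iff.1 hl]
      exact Submodule.subset_span ⟨0, zero_mem _, 0, by simp⟩
    | succ n ih =>
      intro l hl
      have := map_word_eq_zero (S.mkQ ∘ₗ (evalFreeLie k V).toLinearMap) ⊤ l (fun x _ => by
          simp only [LinearMap.comp_apply, AlgHom.toLinearMap_apply, map_pow, evalFreeLie_ι,
            Submodule.mkQ_apply, Submodule.Quotient.mk_eq_zero]
          exact Submodule.subset_span ⟨x, x.2, _, rfl⟩)
        (fun _ _ => trivial) (fun l' hl' => by
          refine eq_of_perm_of_swap (fun l => (S.mkQ ∘ₗ (evalFreeLie k V).toLinearMap) (word l)) l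
            (fun l₁ x y l₂ h => ?_) hl'
          have h1 := ih (l₁ ++ ⁅x, y⁆ :: l₂) (by
            have := h.length_eq
            simp only [List.length_append, List.length_cons] at this ⊢
            omega)
          simp only [LinearMap.comp_apply, AlgHom.toLinearMap_apply]
          rw [evalFreeLie_swap, map_add, (Submodule.mkQ_apply S _).trans
            ((Submodule.Quotient.mk_eq_zero S).2 h1), add_zero])
      simpa using this
  rw [eq_top_iff]
  rintro x -
  induction x using word_induction with
  | hword l => rw [← evalFreeLie_word_of]; exact key _ _ rfl
  | hzero => exact zero_mem _
  | hadd x y hx hy => exact add_mem hx hy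
  | hsmul c x hx => exact Submodule.smul_mem _ c hx

/-- The first Eulerian idempotent. The n-th power of a Lie element is an eigenvector of the Adams
operation with eigenvalue 2ⁿ; in characteristic zero 2ⁿ = 2 only for n = 1, and these powers span.
So one can project onto the eigenspace of 2 along the other eigenspaces. -/
theorem exists_projection [CharZero k] : ∃ e : T →ₗ[k] T, (∀ f ∈ FreeLie k V, e f = f) ∧
    ∀ f ∈ FreeLie k V, ∀ n ≠ 1, e (f ^ n) = 0 := by
  have hind := Module.End.eigenspaces_iSupIndep (adamsTwo k V)
  have hmem : ∀ f ∈ FreeLie k V, ∀ n, f ^ n ∈ (adamsTwo k V).eigenspace (2 ^ n) :=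
    fun f hf n => Module.End.mem_eigenspace_iff.2 (adamsTwo_pow hf n)
  have hne : ∀ n : ℕ, n ≠ 1 → (2 : k) ^ n ≠ 2 := by
    intro n hn h
    have : (2 : ℕ) ^ n = 2 ^ 1 := by exact_mod_cast h
    exact hn (Nat.pow_right_injective le_rfl this)
  have hmem' : ∀ f ∈ FreeLie k V, ∀ n ≠ 1,
      f ^ n ∈ ⨆ j, ⨆ (_ : j ≠ (2 : k)), (adamsTwo k V).eigenspace j := fun f hf n hn =>
    Submodule.mem_iSup_of_mem (2 ^ n) (Submodule.mem_iSup_of_mem (hne n hn) (hmem f hf n))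
  have hmem1 : ∀ f ∈ FreeLie k V, f ∈ (adamsTwo k V).eigenspace 2 := fun f hf => by
    have := hmem f hf 1
    rwa [pow_one, pow_one] at this
  have hc : IsCompl ((adamsTwo k V).eigenspace 2)
      (⨆ j, ⨆ (_ : j ≠ (2 : k)), (adamsTwo k V).eigenspace j) := by
    refine ⟨hind 2, ?_⟩
    rw [codisjoint_iff, eq_top_iff, ← span_freeLie_pow, Submodule.span_le]
    rintro _ ⟨f, hf, n, rfl⟩
    by_cases hn : n = 1
    · subst hn
      rw [pow_one]
      exact Submodule.mem_sup_left (hmem1 f hf)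
    · exact Submodule.mem_sup_right (hmem' f hf n hn)
  refine ⟨Submodule.subtype _ ∘ₗ Submodule.projectionOnto _ _ hc, fun f hf => ?_,
    fun f hf n hn => ?_⟩
  · have := Submodule.projectionOnto_apply_left hc ⟨f, hmem1 f hf⟩
    rw [LinearMap.comp_apply]
    exact congrArg Subtype.val this
  · rw [LinearMap.comp_apply, (Submodule.projectionOnto_apply_eq_zero_iff hc).2 (hmem' f hf n hn), map_zero]

end Primitive

/-! ### The enveloping algebra as a coalgebra, and the inverse of symmetrization -/

section Enveloping

variable {k : Type*} [Field k] {g : Type*} [LieRing g] [LieAlgebra k g]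

local notation "U" => UniversalEnvelopingAlgebra k g

variable (k g) in
/-- The comultiplication of the universal enveloping algebra. -/
def envComul : U →ₐ[k] U ⊗[k] U :=
  UniversalEnvelopingAlgebra.lift k
    { toLinearMap := (Algebra.TensorProduct.includeLeft (R := k) (S := k) (A := U)
          (B := U)).toLinearMap ∘ₗ (UniversalEnvelopingAlgebra.ι k).toLinearMap +
        (Algebra.TensorProduct.includeRight (R := k) (A := U) (B := U)).toLinearMap ∘ₗ
          (UniversalEnvelopingAlgebra.ι k).toLinearMap
      map_lie' := fun {x y} => by
        have h : ∀ z : g, ((Algebra.TensorProduct.includeLeft (R := k) (S := k) (A := U)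
          (B := U)).toLinearMap ∘ₗ (UniversalEnvelopingAlgebra.ι k).toLinearMap +
          (Algebra.TensorProduct.includeRight (R := k) (A := U) (B := U)).toLinearMap ∘ₗ
          (UniversalEnvelopingAlgebra.ι k).toLinearMap) z =
            UniversalEnvelopingAlgebra.ι k z ⊗ₜ[k] (1 : U) +
              (1 : U) ⊗ₜ[k] UniversalEnvelopingAlgebra.ι k z := fun _ => rfl
        change (_ + _ : g →ₗ[k] U ⊗[k] U) ⁅x, y⁆ = ⁅(_ + _ : g →ₗ[k] U ⊗[k] U) x,
          (_ + _ : g →ₗ[k] U ⊗[k] U) y⁆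
        simp only [h, LieHom.map_lie, LieRing.of_associative_ring_bracket,
          mul_add, add_mul, Algebra.TensorProduct.tmul_mul_tmul, one_mul, mul_one,
          TensorProduct.sub_tmul, TensorProduct.tmul_sub]
        abel }

@[simp] theorem envComul_ι (x : g) : envComul k g (UniversalEnvelopingAlgebra.ι k x) =
    UniversalEnvelopingAlgebra.ι k x ⊗ₜ 1 + 1 ⊗ₜ UniversalEnvelopingAlgebra.ι k x := by
  rw [envComul, UniversalEnvelopingAlgebra.lift_ι_apply]
  rfl

variable (k g) in
/-- The counit of the universal enveloping algebra. -/
def envCounit : U →ₐ[k] k := UniversalEnvelopingAlgebra.lift k 0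

@[simp] theorem envCounit_ι (x : g) :
    envCounit k g (UniversalEnvelopingAlgebra.ι k x) = 0 := by
  rw [envCounit, UniversalEnvelopingAlgebra.lift_ι_apply]
  rfl

instance envCoalgebra : Coalgebra k U where
  comul := (envComul k g).toLinearMap
  counit := (envCounit k g).toLinearMap
  coassoc := by
    have : ((Algebra.TensorProduct.assoc k k k U U U).toAlgHom.comp
        ((Algebra.TensorProduct.map (envComul k g) (AlgHom.id k U)).comp (envComul k g))) =
        (Algebra.TensorProduct.map (AlgHom.id k U) (envComul k g)).comp (envComul k g) := by
      ext x
      simp [-UniversalEnvelopingAlgebra.ι_apply, TensorProduct.add_tmul, TensorProduct.tmul_add,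
        Algebra.TensorProduct.one_def, add_assoc]
    exact congrArg AlgHom.toLinearMap this
  rTensor_counit_comp_comul := by
    have h : (Algebra.TensorProduct.lid k U).toAlgHom.comp
        ((Algebra.TensorProduct.map (envCounit k g) (AlgHom.id k U)).comp (envComul k g)) =
        AlgHom.id k U := by
      ext x
      simp [-UniversalEnvelopingAlgebra.ι_apply]
    refine LinearMap.ext fun x => (TensorProduct.lid k U).injective ?_
    rw [TensorProduct.mk_apply, TensorProduct.lid_tmul, one_smul]
    exact DFunLike.congr_fun h x
  lTensor_counit_comp_comul := by
    have h : (Algebra.TensorProduct.rid k k U).toAlgHom.comp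
        ((Algebra.TensorProduct.map (AlgHom.id k U) (envCounit k g)).comp (envComul k g)) =
        AlgHom.id k U := by
      ext x
      simp [-UniversalEnvelopingAlgebra.ι_apply]
    refine LinearMap.ext fun x => (TensorProduct.rid k U).injective ?_
    rw [LinearMap.flip_apply, TensorProduct.mk_apply, TensorProduct.rid_tmul, one_smul]
    exact DFunLike.congr_fun h x

theorem envComul_pow (x : g) (n : ℕ) : envComul k g (UniversalEnvelopingAlgebra.ι k x ^ n) =
    ∑ m ∈ Finset.range (n + 1), ((Nat.choose n m : ℕ) : k) •
      ((UniversalEnvelopingAlgebra.ι k x ^ m) ⊗ₜ[k]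
        (UniversalEnvelopingAlgebra.ι k x ^ (n - m))) := by
  rw [map_pow, envComul_ι, sum_choose_smul_pow]

local notation "T" => TensorAlgebra k g

/-- A linear map on the tensor algebra with `x ^ n ↦ 0` for `n ≠ 1` and `x ↦ x`, vanishing on the
relations of the universal enveloping algebra. -/
theorem exists_eulerian_tensor [CharZero k] : ∃ e : T →ₗ[k] g, (∀ x n, e (TensorAlgebra.ι k x ^ n) =
    if n = 1 then x else 0) ∧ ∀ (s t : T) (x y : g), e (s * (TensorAlgebra.ι k x *
      TensorAlgebra.ι k y - TensorAlgebra.ι k y * TensorAlgebra.ι k x -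
      TensorAlgebra.ι k ⁅x, y⁆) * t) = 0 := by
  obtain ⟨p, hp, hp'⟩ := exists_projection (k := k) (V := g)
  set q : T →ₗ[k] g := lieValue (k := k) (LinearMap.id : g →ₗ[k] g) with hq
  have hι : ∀ x : g, TensorAlgebra.ι k x ∈ FreeLie k g := fun x => (FreeLie.of x).2
  set e := q ∘ₗ p with he
  have hpow : ∀ f ∈ FreeLie k g, ∀ n ≠ 1, e (f ^ n) = 0 := fun f hf n hn => by
    rw [he, LinearMap.comp_apply, hp' f hf n hn, map_zero]
  -- On Lie elements the kernel of `q` is an ideal. So if a word contains a letter from this kernel,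
  -- the shorter word produced by a swap does too, and by induction `e` is symmetric on such words;
  -- powers with exponent at least two are killed by `p`.
  have key : ∀ n, ∀ l : List (FreeLie k g), l.length = n → (∃ j ∈ l, q j = 0) →
      e (evalFreeLie k g (word l)) = 0 := by
    intro n
    induction n with
    | zero =>
      rintro l hl ⟨j, hj, -⟩
      rw [List.length_eq_zero_iff.1 hl] at hj
      simp at hj
    | succ n ih =>
      intro l hl hj
      -- Words of length one are separate because `p` fixes first powers; there it is `q` that
      -- vanishes.
      rcases Nat.eq_zero_or_pos n with rfl | hn
      · obtain ⟨j, rfl⟩ := List.length_eq_one_iff.1 hl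
        obtain ⟨j', hj', h⟩ := hj
        obtain rfl : j' = j := by simpa using hj'
        simpa [he, hp _ j'.2] using h
      refine map_word_eq_zero (e ∘ₗ (evalFreeLie k g).toLinearMap) ⊤ l (fun x _ => ?_)
        (fun _ _ => trivial) (fun l' hl' => ?_)
      · simp only [LinearMap.comp_apply, AlgHom.toLinearMap_apply, map_pow, evalFreeLie_ι]
        exact hpow x x.2 _ (by omega)
      · refine eq_of_perm_of_swap (fun l => (e ∘ₗ (evalFreeLie k g).toLinearMap) (word l)) l
          (fun l₁ x y l₂ h => ?_) hl'
        simp only [LinearMap.comp_apply, AlgHom.toLinearMap_apply]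
        rw [evalFreeLie_swap, map_add, ih (l₁ ++ ⁅x, y⁆ :: l₂) (by
            have := h.length_eq
            simp only [List.length_append, List.length_cons] at this ⊢
            omega), add_zero]
        obtain ⟨j, hjl, hj⟩ := hj
        have hjl' := h.mem_iff.2 hjl
        have hxy : q (⁅x, y⁆ : FreeLie k g) = ⁅q (x : T), q (y : T)⁆ :=
          lieValue_lie (k := k) (V := g) (LinearMap.id : g →ₗ[k] g) x.2 y.2
        simp only [List.mem_append, List.mem_cons] at hjl'
        rcases hjl' with h | rfl | rfl | h
        · exact ⟨j, by simp [h], hj⟩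
        · exact ⟨⁅j, y⁆, by simp, by rw [hxy, hj, zero_lie]⟩
        · exact ⟨⁅x, j⁆, by simp, by rw [hxy, hj, lie_zero]⟩
        · exact ⟨j, by simp [h], hj⟩
  refine ⟨e, fun x n => ?_, fun s t x y => ?_⟩
  · split_ifs with hn
    · rw [hn, pow_one, he, LinearMap.comp_apply, hp _ (hι x), hq, lieValue_ι, LinearMap.id_apply]
    · exact hpow _ (hι x) n hn
  -- The defining relation is a Lie element with value ⁅x, y⁆ − ⁅x, y⁆ = 0, so `key` applies to any
  -- word in which it is a letter.
  · set r : FreeLie k g :=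
      ⁅FreeLie.of (k := k) x, FreeLie.of (k := k) y⁆ - FreeLie.of (k := k) ⁅x, y⁆ with hr
    have hr' : (r : T) = TensorAlgebra.ι k x * TensorAlgebra.ι k y -
      TensorAlgebra.ι k y * TensorAlgebra.ι k x - TensorAlgebra.ι k ⁅x, y⁆ := rfl
    have hqr : q r = 0 := by
      have h1 := lieValue_lie (k := k) (LinearMap.id : g →ₗ[k] g) (hι x) (hι y)
      rw [hr', ← LieRing.of_associative_ring_bracket, map_sub, h1]
      simp [q]
    rw [← hr']
    induction s using word_induction with
    | hword l =>
      induction t using word_induction with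
      | hword l' =>
        have := key _ (l.map FreeLie.of ++ r :: l'.map FreeLie.of) rfl ⟨r, by simp, hqr⟩
        rwa [word_append, word_cons, map_mul (evalFreeLie k g), map_mul (evalFreeLie k g),
            evalFreeLie_ι, evalFreeLie_word_of,
          evalFreeLie_word_of, ← mul_assoc] at this
      | hzero => simp
      | hadd a b ha hb => rw [mul_add, map_add, ha, hb, add_zero]
      | hsmul c a ha => rw [mul_smul_comm, map_smul, ha, smul_zero]
    | hzero => simp
    | hadd a b ha hb => rw [add_mul, add_mul, map_add, ha, hb, add_zero]
    | hsmul c a ha => rw [smul_mul_assoc, smul_mul_assoc, map_smul, ha, smul_zero]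

/-- The functional on tensors vanishes on the ideal of relations, hence descends to the quotient of
the tensor algebra. The enveloping algebra acts on that quotient, and acting on the class of 1
transports the functional. -/
theorem exists_eulerian [CharZero k] : ∃ e : U →ₗ[k] g, ∀ x n, e (UniversalEnvelopingAlgebra.ι k x ^ n) =
    if n = 1 then x else 0 := by
  obtain ⟨e, he, he'⟩ := exists_eulerian_tensor (k := k) (g := g)
  -- The right factors `t` make this left ideal two-sided.
  set N : Submodule T T := Submodule.span T {z | ∃ (x y : g) (t : T), z = (TensorAlgebra.ι k x *
      TensorAlgebra.ι k y - TensorAlgebra.ι k y * TensorAlgebra.ι k x -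
      TensorAlgebra.ι k ⁅x, y⁆) * t} with hN
  have heN : N.restrictScalars k ≤ LinearMap.ker e := by
    intro z hz
    rw [Submodule.restrictScalars_mem] at hz
    rw [LinearMap.mem_ker]
    suffices ∀ s, e (s * z) = 0 by simpa using this 1
    induction hz using Submodule.span_induction with
    | mem z h =>
      obtain ⟨x, y, t, rfl⟩ := h
      intro s
      rw [← mul_assoc]
      exact he' s t x y
    | zero => simp
    | add a b _ _ ha hb => intro s; rw [mul_add, map_add, ha, hb, add_zero]
    | smul c a _ ha => intro s; rw [smul_eq_mul, ← mul_assoc, ha]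
  let e' : (T ⧸ N) →ₗ[k] g :=
    { toFun := Quotient.lift e (fun a b hab => by
        have h : a - b ∈ N := (Submodule.quotientRel_def N).1 hab
        have := heN h
        rwa [LinearMap.mem_ker, map_sub, sub_eq_zero] at this)
      map_add' := by rintro ⟨a⟩ ⟨b⟩; exact map_add e a b
      map_smul' := by rintro c ⟨a⟩; exact map_smul e c a }
  have he'mk : ∀ t : T, e' (Submodule.Quotient.mk t) = e t := fun t => rfl
  let ρ : g →ₗ⁅k⁆ Module.End k (T ⧸ N) :=
    { toLinearMap := (Algebra.lsmul k k (T ⧸ N)).toLinearMap ∘ₗ TensorAlgebra.ι k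
      map_lie' := fun {x y} => by
        refine LinearMap.ext fun z => ?_
        obtain ⟨t, rfl⟩ := Submodule.Quotient.mk_surjective N z
        change Submodule.Quotient.mk (TensorAlgebra.ι k ⁅x, y⁆ * t) =
          (Submodule.Quotient.mk (TensorAlgebra.ι k x * (TensorAlgebra.ι k y * t)) -
            Submodule.Quotient.mk (TensorAlgebra.ι k y * (TensorAlgebra.ι k x * t)) : T ⧸ N)
        rw [← Submodule.Quotient.mk_sub]
        refine ((Submodule.Quotient.eq N).2 (Submodule.subset_span ⟨x, y, t, ?_⟩)).symm
        noncomm_ring }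
  refine ⟨e' ∘ₗ LinearMap.applyₗ (Submodule.Quotient.mk (1 : T)) ∘ₗ
    (UniversalEnvelopingAlgebra.lift k ρ).toLinearMap, fun x n => ?_⟩
  have hpow : ∀ n, (ρ x ^ n) (Submodule.Quotient.mk 1) =
      (Submodule.Quotient.mk (TensorAlgebra.ι k x ^ n) : T ⧸ N) := by
    intro n
    induction n with
    | zero => simp
    | succ n ih =>
      rw [pow_succ', Module.End.mul_apply, ih, pow_succ']
      rfl
  simp only [LinearMap.comp_apply, AlgHom.toLinearMap_apply, map_pow,
    UniversalEnvelopingAlgebra.lift_ι_apply, LinearMap.applyₗ_apply_apply]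
  rw [hpow, he'mk, he]

/-- Induction on the degree. In the convolution of `e` with the inverse known up to degree N, the
binomial coproduct of xⁿ keeps only the term m = 1, which is n · x · xⁿ⁻¹; division by the degree
removes n. The counit term supplies the case n = 0. -/
theorem exists_leftInverse_upTo [CharZero k] (N : ℕ) : ∃ v : U →ₗ[k] T, ∀ (x : g) (n : ℕ), n ≤ N →
    v (UniversalEnvelopingAlgebra.ι k x ^ n) = TensorAlgebra.ι k x ^ n := by
  obtain ⟨e, he⟩ := exists_eulerian (k := k) (g := g)
  induction N with
  | zero =>
    refine ⟨Algebra.linearMap k T ∘ₗ (envCounit k g).toLinearMap, fun x n hn => ?_⟩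
    obtain rfl : n = 0 := by omega
    simp
  | succ N ih =>
    obtain ⟨v, hv⟩ := ih
    refine ⟨divDeg ∘ₗ LinearMap.mul' k T ∘ₗ TensorProduct.map (TensorAlgebra.ι k ∘ₗ e) v ∘ₗ
      (envComul k g).toLinearMap + Algebra.linearMap k T ∘ₗ (envCounit k g).toLinearMap,
      fun x n hn => ?_⟩
    simp only [LinearMap.add_apply, LinearMap.comp_apply, AlgHom.toLinearMap_apply, envComul_pow,
      map_sum, map_smul, TensorProduct.map_tmul, he, LinearMap.mul'_apply]
    rcases n with _ | n
    · simp
    · have hsc : divDeg (TensorAlgebra.ι k x ^ (n + 1)) =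
          ((n + 1 : ℕ) : k)⁻¹ • TensorAlgebra.ι k x ^ (n + 1) := by
        refine divDeg_of_scaling ?_
        have := scaling_word (k := k) (List.replicate (n + 1) x)
        rwa [word_replicate, List.length_replicate] at this
      rw [Finset.sum_eq_single 1]
      · simp only [if_true, Nat.choose_one_right, Nat.add_sub_cancel]
        rw [hv x n (by omega), ← pow_succ', hsc, smul_smul, mul_inv_cancel₀
          (by exact_mod_cast Nat.succ_ne_zero n), one_smul]
        simp [-UniversalEnvelopingAlgebra.ι_apply]
      · intro m _ hm
        simp [hm]
      · intro h
        simp at h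

variable (k g) in
/-- The canonical homomorphism from the tensor algebra to the universal enveloping algebra. -/
def toEnv : T →ₐ[k] U := TensorAlgebra.lift k (UniversalEnvelopingAlgebra.ι k).toLinearMap

@[simp] theorem toEnv_ι (x : g) :
    toEnv k g (TensorAlgebra.ι k x) = UniversalEnvelopingAlgebra.ι k x := by
  rw [toEnv, TensorAlgebra.lift_ι_apply]
  rfl

/-- The Poincaré–Birkhoff–Witt theorem: symmetric tensors are determined by their images in the
universal enveloping algebra. -/
theorem exists_leftInverse_toEnv [CharZero k] : ∃ v : U →ₗ[k] T, ∀ (x : g) (n : ℕ),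
    v (UniversalEnvelopingAlgebra.ι k x ^ n) = TensorAlgebra.ι k x ^ n := by
  set S := Submodule.span k {z : T | ∃ (x : g) (n : ℕ), z = TensorAlgebra.ι k x ^ n} with hS
  -- An element of `S` involves finitely many powers, so an inverse valid up to some degree already
  -- recovers it.
  have key : ∀ z ∈ S, ∃ N, ∀ v : U →ₗ[k] T, (∀ (x : g) (n : ℕ), n ≤ N →
      v (UniversalEnvelopingAlgebra.ι k x ^ n) = TensorAlgebra.ι k x ^ n) →
      v (toEnv k g z) = z := by
    intro z hz
    induction hz using Submodule.span_induction with
    | mem z h =>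
      obtain ⟨x, n, rfl⟩ := h
      exact ⟨n, fun v hv => by rw [map_pow, toEnv_ι, hv x n le_rfl]⟩
    | zero => exact ⟨0, fun v _ => by simp⟩
    | add a b _ _ ha hb =>
      obtain ⟨N, hN⟩ := ha
      obtain ⟨N', hN'⟩ := hb
      exact ⟨max N N', fun v hv => by
        rw [map_add, map_add, hN v (fun x n hn => hv x n (hn.trans (le_max_left _ _))),
          hN' v (fun x n hn => hv x n (hn.trans (le_max_right _ _)))]⟩
    | smul c a _ ha =>
      obtain ⟨N, hN⟩ := ha
      exact ⟨N, fun v hv => by rw [map_smul, map_smul, hN v hv]⟩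
  -- Injectivity on `S` is tested on one element, hence one bound N, at a time; over a field it
  -- yields a single left inverse valid in all degrees.
  have hinj : LinearMap.ker ((toEnv k g).toLinearMap.domRestrict S) = ⊥ := by
    rw [LinearMap.ker_eq_bot']
    rintro ⟨z, hz⟩ h
    obtain ⟨N, hN⟩ := key z hz
    obtain ⟨v, hv⟩ := exists_leftInverse_upTo (k := k) (g := g) N
    have h1 := hN v hv
    rw [show toEnv k g z = 0 from h, map_zero] at h1
    exact Subtype.ext h1.symm
  obtain ⟨v, hv⟩ := LinearMap.exists_leftInverse_of_injective _ hinj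
  refine ⟨S.subtype ∘ₗ v, fun x n => ?_⟩
  have h := LinearMap.congr_fun hv ⟨TensorAlgebra.ι k x ^ n, Submodule.subset_span ⟨x, n, rfl⟩⟩
  have h2 := congrArg Subtype.val h
  simpa [-UniversalEnvelopingAlgebra.ι_apply] using h2

end Enveloping

/-! ### The coproduct of two universal enveloping algebras -/

section Coproduct

variable (k : Type*) [Field k] (g h : Type*) [LieRing g] [LieAlgebra k g] [LieRing h]
  [LieAlgebra k h]

/-- The relations of the coproduct of the universal enveloping algebras of two Lie algebras. -/
inductive CoprodRel : TensorAlgebra k (g × h) → TensorAlgebra k (g × h) → Prop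
  | inl (x y : g) : CoprodRel
      (TensorAlgebra.ι k (⁅x, y⁆, 0) + TensorAlgebra.ι k (y, 0) * TensorAlgebra.ι k (x, 0))
      (TensorAlgebra.ι k (x, 0) * TensorAlgebra.ι k (y, 0))
  | inr (x y : h) : CoprodRel
      (TensorAlgebra.ι k (0, ⁅x, y⁆) + TensorAlgebra.ι k (0, y) * TensorAlgebra.ι k (0, x))
      (TensorAlgebra.ι k (0, x) * TensorAlgebra.ι k (0, y))

/-- The coproduct of the universal enveloping algebras of two Lie algebras. -/
def EnvCoprod := RingQuot (CoprodRel k g h)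

instance : Ring (EnvCoprod k g h) := inferInstanceAs (Ring (RingQuot (CoprodRel k g h)))

instance : Algebra k (EnvCoprod k g h) := inferInstanceAs (Algebra k (RingQuot (CoprodRel k g h)))

namespace EnvCoprod

/-- The quotient map from the tensor algebra. -/
def mk : TensorAlgebra k (g × h) →ₐ[k] EnvCoprod k g h := RingQuot.mkAlgHom k (CoprodRel k g h)

theorem mk_surjective : Function.Surjective (mk k g h) := RingQuot.mkAlgHom_surjective k _

variable {k g h}

theorem mk_rel {x y : TensorAlgebra k (g × h)} (hxy : CoprodRel k g h x y) :
    mk k g h x = mk k g h y := RingQuot.mkAlgHom_rel k hxy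

variable (k g h)

/-- The homomorphism from the first Lie algebra. -/
def inl : g →ₗ⁅k⁆ EnvCoprod k g h where
  toLinearMap := (mk k g h).toLinearMap ∘ₗ TensorAlgebra.ι k ∘ₗ LinearMap.inl k g h
  map_lie' {x y} := by
    have := mk_rel (CoprodRel.inl (k := k) (h := h) x y)
    rw [map_add, map_mul, map_mul] at this
    exact eq_sub_of_add_eq this

/-- The homomorphism from the second Lie algebra. -/
def inr : h →ₗ⁅k⁆ EnvCoprod k g h where
  toLinearMap := (mk k g h).toLinearMap ∘ₗ TensorAlgebra.ι k ∘ₗ LinearMap.inr k g h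
  map_lie' {x y} := by
    have := mk_rel (CoprodRel.inr (k := k) (g := g) x y)
    rw [map_add, map_mul, map_mul] at this
    exact eq_sub_of_add_eq this

variable {k g h}

@[elab_as_elim]
theorem induction {p : EnvCoprod k g h → Prop} (hinl : ∀ x, p (inl k g h x))
    (hinr : ∀ x, p (inr k g h x)) (hc : ∀ c, p (algebraMap k _ c))
    (hadd : ∀ x y, p x → p y → p (x + y)) (hmul : ∀ x y, p x → p y → p (x * y))
    (x : EnvCoprod k g h) : p x := by
  obtain ⟨x, rfl⟩ := mk_surjective k g h x
  induction x using TensorAlgebra.induction with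
  | algebraMap c => rw [AlgHom.commutes]; exact hc c
  | ι v =>
    have : mk k g h (TensorAlgebra.ι k v) = inl k g h v.1 + inr k g h v.2 := by
      change _ = mk k g h (TensorAlgebra.ι k (v.1, 0)) + mk k g h (TensorAlgebra.ι k (0, v.2))
      rw [← map_add, ← map_add]
      simp
    rw [this]
    exact hadd _ _ (hinl _) (hinr _)
  | mul x y hx hy => rw [map_mul]; exact hmul _ _ hx hy
  | add x y hx hy => rw [map_add]; exact hadd _ _ hx hy

variable {B : Type*} [Ring B] [Algebra k B]

/-- The universal property of the coproduct. -/
def lift (f : g →ₗ⁅k⁆ B) (f' : h →ₗ⁅k⁆ B) : EnvCoprod k g h →ₐ[k] B :=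
  RingQuot.liftAlgHom k ⟨TensorAlgebra.lift k ((f : g →ₗ[k] B).coprod (f' : h →ₗ[k] B)), by
    intro x y hxy
    cases hxy with
    | inl x y => simp [LieRing.of_associative_ring_bracket]
    | inr x y => simp [LieRing.of_associative_ring_bracket]⟩

theorem lift_mk (f : g →ₗ⁅k⁆ B) (f' : h →ₗ⁅k⁆ B) (x : TensorAlgebra k (g × h)) :
    lift f f' (mk k g h x) =
      TensorAlgebra.lift k ((f : g →ₗ[k] B).coprod (f' : h →ₗ[k] B)) x :=
  RingQuot.liftAlgHom_mkAlgHom_apply _ _ _ _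

@[simp] theorem lift_inl (f : g →ₗ⁅k⁆ B) (f' : h →ₗ⁅k⁆ B) (x : g) :
    lift f f' (inl k g h x) = f x := by
  refine (lift_mk f f' _).trans ?_
  simp

@[simp] theorem lift_inr (f : g →ₗ⁅k⁆ B) (f' : h →ₗ⁅k⁆ B) (x : h) :
    lift f f' (inr k g h x) = f' x := by
  refine (lift_mk f f' _).trans ?_
  simp

/-- The homomorphism to dual numbers given by linear maps. -/
def dualLie {g' : Type*} [LieRing g'] [LieAlgebra k g'] (i : g' →ₗ⁅k⁆ B) (d : g' →ₗ[k] B)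
    (hd : ∀ x y, d ⁅x, y⁆ = ⁅d x, i y⁆ + ⁅i x, d y⁆) : g' →ₗ⁅k⁆ DualNumber B where
  toLinearMap := (TrivSqZeroExt.inlAlgHom k B B).toLinearMap ∘ₗ (i : g' →ₗ[k] B) +
    (TrivSqZeroExt.inrHom B B).restrictScalars k ∘ₗ d
  map_lie' {x y} := by
    refine TrivSqZeroExt.ext ?_ ?_
    · simp [LieRing.of_associative_ring_bracket]
    · simp [LieRing.of_associative_ring_bracket, hd]
      abel

theorem dualLie_apply {g' : Type*} [LieRing g'] [LieAlgebra k g'] (i : g' →ₗ⁅k⁆ B)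
    (d : g' →ₗ[k] B) (hd : ∀ x y, d ⁅x, y⁆ = ⁅d x, i y⁆ + ⁅i x, d y⁆) (x : g') :
    dualLie i d hd x = TrivSqZeroExt.inl (i x) + TrivSqZeroExt.inr (d x) := rfl

/-- A derivation is the second coordinate of an algebra homomorphism to dual numbers lifting the
identity, so the universal property of the coproduct provides it. -/
theorem exists_derivation (d : g →ₗ[k] g) (d' : h →ₗ[k] h)
    (hd : ∀ x y, d ⁅x, y⁆ = ⁅d x, y⁆ + ⁅x, d y⁆)
    (hd' : ∀ x y, d' ⁅x, y⁆ = ⁅d' x, y⁆ + ⁅x, d' y⁆) :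
    ∃ D : EnvCoprod k g h →ₗ[k] EnvCoprod k g h, (∀ x y, D (x * y) = D x * y + x * D y) ∧
      (∀ x, D (inl k g h x) = inl k g h (d x)) ∧ ∀ x, D (inr k g h x) = inr k g h (d' x) := by
  set Φ := lift
    (dualLie (inl k g h) ((inl k g h : g →ₗ[k] EnvCoprod k g h) ∘ₗ d) (fun x y => by simp [hd]))
    (dualLie (inr k g h) ((inr k g h : h →ₗ[k] EnvCoprod k g h) ∘ₗ d') (fun x y => by simp [hd']))
    with hΦ
  have hfst : ∀ x, (Φ x).fst = x := by
    intro x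
    induction x using induction with
    | hinl x => simp [hΦ, dualLie_apply]
    | hinr x => simp [hΦ, dualLie_apply]
    | hc c => rw [AlgHom.commutes]; rfl
    | hadd x y hx hy => simp [hx, hy]
    | hmul x y hx hy => simp [hx, hy]
  refine ⟨sndHom Φ, fun x y => ?_, fun x => ?_, fun x => ?_⟩
  · rw [sndHom_mul, hfst, hfst, add_comm]
  · simp [sndHom, hΦ, dualLie_apply]
  · simp [sndHom, hΦ, dualLie_apply]

theorem derivation_ext {D D' : EnvCoprod k g h →ₗ[k] B} {φ : EnvCoprod k g h →ₐ[k] B}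
    (hD : ∀ x y, D (x * y) = D x * φ y + φ x * D y)
    (hD' : ∀ x y, D' (x * y) = D' x * φ y + φ x * D' y)
    (hl : ∀ x, D (inl k g h x) = D' (inl k g h x))
    (hr : ∀ x, D (inr k g h x) = D' (inr k g h x)) : D = D' := by
  have h1 : D 1 = 0 := by simpa using hD 1 1
  have h1' : D' 1 = 0 := by simpa using hD' 1 1
  refine LinearMap.ext fun x => ?_
  induction x using induction with
  | hinl x => exact hl x
  | hinr x => exact hr x
  | hc c => rw [Algebra.algebraMap_eq_smul_one, map_smul, map_smul, h1, h1']
  | hadd x y hx hy => rw [map_add, map_add, hx, hy]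
  | hmul x y hx hy => rw [hD, hD', hx, hy]

end EnvCoprod

end Coproduct

/-! ### A representation of the coproduct of two enveloping algebras -/

section Theta

variable {k : Type*} [Field k] {V Z J J' : Type*} [AddCommGroup V] [Module k V] [AddCommGroup Z]
  [Module k Z] [LieRing J] [LieAlgebra k J] [LieRing J'] [LieAlgebra k J']

/-- The linear map with
`v₁ ⋯ vₚ ⊗ z₁ ⋯ z_q ↦ [v₁, [⋯, [vₚ₋₁, [z₁, [⋯, [z_q, vₚ]]]]]]`. -/
def theta (f : V →ₗ[k] J) (h : Z →ₗ[k] J) : TensorAlgebra k V ⊗[k] TensorAlgebra k Z →ₗ[k] J :=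
  TensorProduct.lift
    (cocycle (adAction f) ∘ₗ LinearMap.lcomp k J f ∘ₗ (adAction h).toLinearMap).flip

theorem theta_tmul (f : V →ₗ[k] J) (h : Z →ₗ[k] J) (s : TensorAlgebra k V)
    (t : TensorAlgebra k Z) :
    theta f h (s ⊗ₜ t) = cocycle (adAction f) (adAction h t ∘ₗ f) s := rfl

theorem theta_ι_mul (f : V →ₗ[k] J) (h : Z →ₗ[k] J) (v : V) (s : TensorAlgebra k V)
    (t : TensorAlgebra k Z) : theta f h ((TensorAlgebra.ι k v * s) ⊗ₜ t) =
      ⁅f v, theta f h (s ⊗ₜ t)⁆ + TensorAlgebra.algebraMapInv s • adAction h t (f v) := by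
  rw [theta_tmul, theta_tmul, cocycle_ι_mul, adAction_ι]
  rfl

theorem theta_one (f : V →ₗ[k] J) (h : Z →ₗ[k] J) (t : TensorAlgebra k Z) :
    theta f h (1 ⊗ₜ t) = 0 := by
  rw [theta_tmul, cocycle_one]

theorem adAction_map (f : V →ₗ[k] J) (φ : J →ₗ⁅k⁆ J') (s : TensorAlgebra k V) (x : J) :
    φ (adAction f s x) = adAction ((φ : J →ₗ[k] J') ∘ₗ f) s (φ x) := by
  induction s using word_induction with
  | hword l =>
    induction l with
    | nil => simp
    | cons v l ih => simp [ih]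
  | hzero => simp
  | hadd s t hs ht => simp [hs, ht]
  | hsmul c s hs => simp [hs]

theorem theta_comp (f : V →ₗ[k] J) (h : Z →ₗ[k] J) (φ : J →ₗ⁅k⁆ J')
    (w : TensorAlgebra k V ⊗[k] TensorAlgebra k Z) :
    φ (theta f h w) = theta ((φ : J →ₗ[k] J') ∘ₗ f) ((φ : J →ₗ[k] J') ∘ₗ h) w := by
  induction w using TensorProduct.induction_on with
  | zero => simp
  | tmul s t =>
    rw [theta_tmul, theta_tmul]
    refine (cocycle_comp (adAction f) _ (adAction ((φ : J →ₗ[k] J') ∘ₗ f)) (φ : J →ₗ[k] J')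
      (fun v m => by simp) s).trans ?_
    congr 2
    ext v
    exact adAction_map h φ t (f v)
  | add x y hx hy => rw [map_add, map_add, map_add, hx, hy]

variable (k V Z) in
/-- The free Lie algebra generated by the tensors `vᵖ ⊗ z^q` with `p, q ≥ 1`. -/
def mixedLie : LieSubalgebra k (TensorAlgebra k (TensorAlgebra k V ⊗[k] TensorAlgebra k Z)) :=
  LieSubalgebra.lieSpan k _ {x | ∃ (v : V) (z : Z) (p q : ℕ), x = TensorAlgebra.ι k
    ((TensorAlgebra.ι k v ^ (p + 1)) ⊗ₜ[k] (TensorAlgebra.ι k z ^ (q + 1)))}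

theorem mixedLie_le : mixedLie k V Z ≤ FreeLie k (TensorAlgebra k V ⊗[k] TensorAlgebra k Z) := by
  rw [mixedLie, LieSubalgebra.lieSpan_le]
  rintro _ ⟨v, z, p, q, rfl⟩
  exact LieSubalgebra.subset_lieSpan ⟨_, rfl⟩

end Theta

/-! ### Leading terms in the tensor algebra -/

section LeadingTerm

variable {k : Type*} [Field k] {W : Type*} [AddCommGroup W] [Module k W]

local notation "T" => TensorAlgebra k W

theorem deg_one_mul {x y : T} : deg 1 (x * y) = deg 0 x * deg 1 y + deg 1 x * deg 0 y := by
  rw [deg_mul, Finset.Nat.antidiagonal_succ]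
  simp

theorem deg_zero_mul {x y : T} : deg 0 (x * y) = deg 0 x * deg 0 y := by
  rw [deg_mul]
  simp

theorem deg_zero_ι (w : W) : deg 0 (TensorAlgebra.ι k w) = 0 := by
  simpa using deg_word (k := k) 0 [w]

theorem deg_one_ι (w : W) : deg 1 (TensorAlgebra.ι k w) = TensorAlgebra.ι k w := by
  simpa using deg_word (k := k) 1 [w]

theorem deg_word_of_leadingTerm (G : T →ₐ[k] T) (l : List W)
    (h0 : ∀ w ∈ l, deg 0 (G (TensorAlgebra.ι k w)) = 0)
    (h1 : ∀ w ∈ l, deg 1 (G (TensorAlgebra.ι k w)) = TensorAlgebra.ι k w) :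
    (∀ i < l.length, deg i (G (word l)) = 0) ∧ deg l.length (G (word l)) = word l := by
  induction l with
  | nil => simpa using deg_word (k := k) (V := W) 0 []
  | cons w l ih =>
    obtain ⟨ih0, ih1⟩ := ih (fun w hw => h0 w (by simp [hw])) (fun w hw => h1 w (by simp [hw]))
    have h0' := h0 w (by simp)
    refine ⟨fun i hi => ?_, ?_⟩
    · rw [word_cons, map_mul, deg_mul]
      refine Finset.sum_eq_zero fun p hp => ?_
      have hp' := Finset.HasAntidiagonal.mem_antidiagonal.1 hp
      rcases Nat.eq_zero_or_pos p.1 with h | h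
      · rw [h, h0', zero_mul]
      · rw [ih0 p.2 (by simp only [List.length_cons] at hi; omega), mul_zero]
    · rw [word_cons, map_mul, deg_mul, Finset.sum_eq_single (1, l.length)]
      · rw [h1 w (by simp), ih1]
      · intro p hp hne
        have hp' := Finset.HasAntidiagonal.mem_antidiagonal.1 hp
        rw [List.length_cons] at hp'
        rcases Nat.eq_zero_or_pos p.1 with h | h
        · rw [h, h0', zero_mul]
        · rw [ih0 p.2 (by
            by_contra hlt
            exact hne (Prod.ext (by simp; omega) (by simp; omega))), mul_zero]
      · intro h
        exact absurd (Finset.HasAntidiagonal.mem_antidiagonal.2 (by simp [add_comm])) h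

/-- On the subalgebra generated by `S`, the homomorphism `G` is the identity plus terms of higher
degree. The lowest nonzero component of `x` would therefore survive unchanged in `G x`. -/
theorem eq_zero_of_leadingTerm (G : T →ₐ[k] T) (S : Set W)
    (h0 : ∀ w ∈ S, deg 0 (G (TensorAlgebra.ι k w)) = 0)
    (h1 : ∀ w ∈ S, deg 1 (G (TensorAlgebra.ι k w)) = TensorAlgebra.ι k w) {x : T}
    (hx : x ∈ Algebra.adjoin k (TensorAlgebra.ι k '' S)) (hG : G x = 0) : x = 0 := by
  have hspan : x ∈ Submodule.span k {y : T | ∃ l : List W, (∀ w ∈ l, w ∈ S) ∧ y = word l} := by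
    rw [← Subalgebra.mem_toSubmodule, Algebra.adjoin_eq_span] at hx
    refine Submodule.span_mono ?_ hx
    intro y hy
    induction hy using Submonoid.closure_induction with
    | mem y h => obtain ⟨w, hw, rfl⟩ := h; exact ⟨[w], by simpa using hw, by simp⟩
    | one => exact ⟨[], by simp, by simp⟩
    | mul y z _ _ hy hz =>
      obtain ⟨l, hl, rfl⟩ := hy
      obtain ⟨l', hl', rfl⟩ := hz
      refine ⟨l ++ l', fun w hw => ?_, by simp [word_append]⟩
      rcases List.mem_append.1 hw with h | h
      exacts [hl w h, hl' w h]
  have hgr : ∀ i, (∀ j < i, deg j (G (deg i x)) = 0) ∧ deg i (G (deg i x)) = deg i x := by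
    intro i
    clear hG hx
    induction hspan using Submodule.span_induction with
    | mem y h =>
      obtain ⟨l, hl, rfl⟩ := h
      rw [deg_word]
      split_ifs with h
      · subst h
        exact deg_word_of_leadingTerm G l (fun w hw => h0 w (hl w hw)) (fun w hw => h1 w (hl w hw))
      · simp
    | zero => simp
    | add a b _ _ ha hb =>
      refine ⟨fun j hj => ?_, ?_⟩
      · rw [map_add, map_add, map_add, ha.1 j hj, hb.1 j hj, add_zero]
      · rw [map_add, map_add, map_add, ha.2, hb.2]
    | smul c a _ ha =>
      refine ⟨fun j hj => ?_, ?_⟩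
      · rw [map_smul, map_smul, map_smul, ha.1 j hj, smul_zero]
      · rw [map_smul, map_smul, map_smul, ha.2]
  obtain ⟨N, hN', hN⟩ := exists_sum_deg x
  have hzero : ∀ n, deg n x = 0 := by
    intro n
    induction n using Nat.strong_induction_on with
    | _ n ih =>
      by_cases hn : n < N
      · have h2 := congrArg (deg n) hG
        rw [hN, map_sum, map_sum, map_zero, Finset.sum_eq_single n] at h2
        · rw [← h2, (hgr n).2]
        · intro i _ hi
          rcases lt_or_gt_of_ne hi with h | h
          · rw [ih i h, map_zero, map_zero]
          · exact (hgr i).1 n h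
        · intro h
          exact absurd (Finset.mem_range.2 hn) h
      · exact hN' n (not_lt.1 hn)
  rw [hN]
  exact Finset.sum_eq_zero fun i _ => hzero i

end LeadingTerm

/-! ### Actions of the two Lie algebras on the convolution algebra -/

section Representation

variable {k : Type*} [Field k] {g h : Type*} [LieRing g] [LieAlgebra k g] [LieRing h]
  [LieAlgebra k h]

local notation "Ug" => UniversalEnvelopingAlgebra k g
local notation "Uh" => UniversalEnvelopingAlgebra k h
local notation "Tens" => TensorAlgebra k (Ug ⊗[k] Uh)
local notation "Conv" => WithConv (Uh →ₗ[k] Tens)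

/-- The action of a linear endomorphism of the values on the convolution algebra. -/
def postcomp (D : Tens →ₗ[k] Tens) : Module.End k Conv where
  toFun f := WithConv.toConv (D ∘ₗ f.ofConv)
  map_add' f f' := WithConv.ext (by simp [LinearMap.comp_add])
  map_smul' c f := WithConv.ext (by simp [LinearMap.comp_smul])

theorem postcomp_mul {D : Tens →ₗ[k] Tens} (hD : ∀ x y, D (x * y) = x * D y + D x * y)
    (f f' : Conv) : postcomp D (f * f') = f * postcomp D f' + postcomp D f * f' := by
  refine WithConv.ext (LinearMap.ext fun q => ?_)
  change D (LinearMap.mul' k Tens (TensorProduct.map f.ofConv f'.ofConv _)) =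
    LinearMap.mul' k Tens (TensorProduct.map f.ofConv (D ∘ₗ f'.ofConv) _) +
    LinearMap.mul' k Tens (TensorProduct.map (D ∘ₗ f.ofConv) f'.ofConv _)
  induction (CoalgebraStruct.comul (R := k) q) using TensorProduct.induction_on with
  | zero => simp
  | tmul a b => simp [hD]
  | add a b ha hb =>
    simp only [map_add, ha, hb]
    abel

/-- The action of the second Lie algebra on the convolution algebra. -/
def precomp (c : h) : Module.End k Conv where
  toFun f := WithConv.toConv (f.ofConv ∘ₗ LinearMap.mulRight k (UniversalEnvelopingAlgebra.ι k c))
  map_add' f f' := WithConv.ext (by simp [LinearMap.add_comp])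
  map_smul' c f := WithConv.ext (by simp [LinearMap.smul_comp])

/-- Elements of `h` are primitive, so right multiplication by them is a coderivation, and composing
with a coderivation is a derivation for convolution. -/
theorem precomp_mul (c : h) (f f' : Conv) :
    precomp c (f * f') = f * precomp c f' + precomp c f * f' := by
  refine WithConv.ext (LinearMap.ext fun q => ?_)
  change LinearMap.mul' k Tens (TensorProduct.map f.ofConv f'.ofConv
      (envComul k h (q * UniversalEnvelopingAlgebra.ι k c))) =
    LinearMap.mul' k Tens (TensorProduct.map f.ofConv (precomp c f').ofConv (envComul k h q)) +
    LinearMap.mul' k Tens (TensorProduct.map (precomp c f).ofConv f'.ofConv (envComul k h q))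
  rw [map_mul, envComul_ι]
  induction (envComul k h q) using TensorProduct.induction_on with
  | zero => simp
  | tmul a b =>
    rw [mul_add, Algebra.TensorProduct.tmul_mul_tmul, Algebra.TensorProduct.tmul_mul_tmul, mul_one,
      mul_one, map_add, map_add, add_comm]
    rfl
  | add a b ha hb =>
    simp only [map_add, add_mul, ha, hb]
    abel

variable (k g h) in
/-- The generators of the tensor algebra, as a linear map to the convolution algebra. -/
def kap : Ug →ₗ[k] Conv where
  toFun u := WithConv.toConv (TensorAlgebra.ι k ∘ₗ TensorProduct.mk k Ug Uh u)
  map_add' u u' := WithConv.ext (by ext; simp)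
  map_smul' c u := WithConv.ext (LinearMap.ext fun q => by
    change TensorAlgebra.ι k ((c • u) ⊗ₜ[k] q) = c • TensorAlgebra.ι k (u ⊗ₜ[k] q)
    rw [← map_smul, TensorProduct.smul_tmul'])

theorem kap_apply (u : Ug) (q : Uh) : kap k g h u q = TensorAlgebra.ι k (u ⊗ₜ q) := rfl

/-- The values of the derivation given by an element of the first Lie algebra. -/
def derGen (a : g) : Ug ⊗[k] Uh →ₗ[k] Tens :=
  TensorProduct.lift ((WithConv.linearEquiv k (Uh →ₗ[k] Tens)).toLinearMap ∘ₗ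
    (kap k g h ∘ₗ LinearMap.mulLeft k (UniversalEnvelopingAlgebra.ι k a) -
      LinearMap.mulLeft k (kap k g h (UniversalEnvelopingAlgebra.ι k a)) ∘ₗ kap k g h))

theorem derGen_tmul (a : g) (u : Ug) (q : Uh) : derGen a (u ⊗ₜ q) =
    kap k g h (UniversalEnvelopingAlgebra.ι k a * u) q -
      (kap k g h (UniversalEnvelopingAlgebra.ι k a) * kap k g h u) q := rfl

/-- The derivation is chosen so that adding left multiplication by κ(a) gives the operator κ(u) ↦
κ(a u). This is how `actLeft` incorporates left multiplication in the enveloping algebra of `g`. -/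
theorem postcomp_kap (a : g) (u : Ug) : postcomp (tensorDer (derGen a)) (kap k g h u) =
    kap k g h (UniversalEnvelopingAlgebra.ι k a * u) -
      kap k g h (UniversalEnvelopingAlgebra.ι k a) * kap k g h u := by
  refine WithConv.ext (LinearMap.ext fun q => ?_)
  change tensorDer (derGen a) (TensorAlgebra.ι k (u ⊗ₜ q)) = _
  rw [tensorDer_ι, derGen_tmul]
  rfl

/-- The values κ(u)(q) are the generators u ⊗ q, which determine a derivation of the tensor algebra.
-/
theorem postcomp_ext {D D' : Tens →ₗ[k] Tens} (hD : ∀ x y, D (x * y) = x * D y + D x * y)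
    (hD' : ∀ x y, D' (x * y) = x * D' y + D' x * y)
    (hkap : ∀ u, postcomp D (kap k g h u) = postcomp D' (kap k g h u)) : D = D' := by
  have h1 : D 1 = 0 := by simpa using hD 1 1
  have h1' : D' 1 = 0 := by simpa using hD' 1 1
  refine LinearMap.ext fun x => ?_
  induction x using TensorAlgebra.induction with
  | algebraMap c => rw [Algebra.algebraMap_eq_smul_one, map_smul, map_smul, h1, h1']
  | ι w =>
    induction w using TensorProduct.induction_on with
    | zero => simp
    | tmul u q => exact LinearMap.congr_fun (congrArg WithConv.ofConv (hkap u)) q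
    | add a b ha hb => rw [map_add, map_add, map_add, ha, hb]
  | add x y hx hy => rw [map_add, map_add, hx, hy]
  | mul x y hx hy => rw [hD, hD', hx, hy]

theorem tensorDer_derGen_add (a b : g) : tensorDer (derGen (k := k) (h := h) (a + b)) =
    tensorDer (derGen a) + tensorDer (derGen b) := by
  refine postcomp_ext (tensorDer_mul _) (fun x y => ?_) (fun u => ?_)
  · simp only [LinearMap.add_apply, tensorDer_mul, mul_add, add_mul]
    abel
  · have : postcomp (tensorDer (derGen a) + tensorDer (derGen b)) (kap k g h u) =
        postcomp (tensorDer (derGen a)) (kap k g h u) +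
          postcomp (tensorDer (derGen b)) (kap k g h u) := rfl
    rw [this]
    simp only [postcomp_kap, map_add, add_mul]
    abel

theorem tensorDer_derGen_smul (c : k) (a : g) : tensorDer (derGen (k := k) (h := h) (c • a)) =
    c • tensorDer (derGen a) := by
  refine postcomp_ext (tensorDer_mul _) (fun x y => ?_) (fun u => ?_)
  · simp only [LinearMap.smul_apply, tensorDer_mul, smul_add, mul_smul_comm, smul_mul_assoc]
  · have : postcomp (c • tensorDer (derGen a)) (kap k g h u) =
        c • postcomp (tensorDer (derGen a)) (kap k g h u) := rfl
    rw [this]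
    simp only [postcomp_kap, map_smul, smul_mul_assoc, smul_sub]

/-- Both sides are derivations, so it is enough to compare them on κ(u); there the cross terms κ(a)
κ(b u) and κ(b) κ(a u) cancel after antisymmetrization. -/
theorem tensorDer_derGen_lie (a b : g) : tensorDer (derGen (k := k) (h := h) ⁅a, b⁆) =
    ⁅tensorDer (derGen (k := k) (h := h) a), tensorDer (derGen (k := k) (h := h) b)⁆ := by
  refine postcomp_ext (tensorDer_mul _) (fun x y => ?_) (fun u => ?_)
  · simp only [LieRing.of_associative_ring_bracket, LinearMap.sub_apply, Module.End.mul_apply,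
      tensorDer_mul, map_add, mul_sub, sub_mul]
    abel
  · have h1 : ∀ a b : g, postcomp (tensorDer (derGen a) * tensorDer (derGen b)) (kap k g h u) =
        postcomp (tensorDer (derGen a)) (postcomp (tensorDer (derGen b)) (kap k g h u)) :=
      fun _ _ => rfl
    have h2 : postcomp (⁅tensorDer (derGen (k := k) (h := h) a),
        tensorDer (derGen (k := k) (h := h) b)⁆) (kap k g h u) =
        postcomp (tensorDer (derGen a)) (postcomp (tensorDer (derGen b)) (kap k g h u)) -
        postcomp (tensorDer (derGen b)) (postcomp (tensorDer (derGen a)) (kap k g h u)) := rfl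
    rw [h2]
    simp only [postcomp_kap, map_sub, postcomp_mul (tensorDer_mul _), LieHom.map_lie,
      LieRing.of_associative_ring_bracket, sub_mul, mul_sub, mul_assoc]
    abel

variable (k g h) in
/-- The action of the first Lie algebra on the convolution algebra. -/
def actLeft : g →ₗ⁅k⁆ Module.End k Conv where
  toFun a := postcomp (tensorDer (derGen a)) +
    LinearMap.mulLeft k (kap k g h (UniversalEnvelopingAlgebra.ι k a))
  map_add' a b := by
    refine LinearMap.ext fun f => ?_
    rw [tensorDer_derGen_add]
    change (postcomp (tensorDer (derGen a)) f + postcomp (tensorDer (derGen b)) f) + _ * f =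
      (_ + _ * f) + (_ + _ * f)
    rw [map_add, map_add, add_mul]
    abel
  map_smul' c a := by
    refine LinearMap.ext fun f => ?_
    rw [tensorDer_derGen_smul]
    change c • postcomp (tensorDer (derGen a)) f + _ * f = c • (_ + _ * f)
    rw [map_smul, map_smul, smul_mul_assoc, smul_add]
  map_lie' {a b} := by
    refine LinearMap.ext fun f => ?_
    have h2 : postcomp (⁅tensorDer (derGen (k := k) (h := h) a),
        tensorDer (derGen (k := k) (h := h) b)⁆) f =
        postcomp (tensorDer (derGen a)) (postcomp (tensorDer (derGen b)) f) -
        postcomp (tensorDer (derGen b)) (postcomp (tensorDer (derGen a)) f) := rfl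
    rw [tensorDer_derGen_lie]
    simp only [LieRing.of_associative_ring_bracket, LinearMap.sub_apply, Module.End.mul_apply,
      LinearMap.add_apply, LinearMap.mulLeft_apply] at h2 ⊢
    rw [h2]
    simp only [map_add, postcomp_mul (tensorDer_mul _), LieHom.map_lie, postcomp_kap,
      LieRing.of_associative_ring_bracket, map_sub, sub_mul, mul_add, mul_assoc]
    abel

variable (k g h) in
/-- The action of the second Lie algebra on the convolution algebra. -/
def actRight : h →ₗ⁅k⁆ Module.End k Conv where
  toFun := precomp
  map_add' a b := by
    refine LinearMap.ext fun f => WithConv.ext (LinearMap.ext fun q => ?_)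
    change f (q * _) = f (q * _) + f (q * _)
    rw [← map_add, map_add, mul_add]
  map_smul' c a := by
    refine LinearMap.ext fun f => WithConv.ext (LinearMap.ext fun q => ?_)
    change f (q * _) = c • f (q * _)
    rw [← map_smul, map_smul, mul_smul_comm]
  map_lie' {a b} := by
    refine LinearMap.ext fun f => WithConv.ext (LinearMap.ext fun q => ?_)
    change f (q * _) = f (q * _ * _) - f (q * _ * _)
    rw [← map_sub, LieHom.map_lie, LieRing.of_associative_ring_bracket, mul_sub, mul_assoc,
      mul_assoc]

end Representation

/-! ### Mixed commutators in the coproduct of two enveloping algebras -/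

section LieValueMap

variable {k : Type*} [Field k] [CharZero k] {V J J' : Type*} [AddCommGroup V] [Module k V]
  [LieRing J] [LieAlgebra k J] [LieRing J'] [LieAlgebra k J']

theorem lieValue_comp (f : V →ₗ[k] J) (φ : J →ₗ⁅k⁆ J') {x : TensorAlgebra k V}
    (hx : x ∈ FreeLie k V) : φ (lieValue f x) = lieValue ((φ : J →ₗ[k] J') ∘ₗ f) x := by
  induction hx using LieSubalgebra.lieSpan_induction with
  | mem x hx => obtain ⟨v, rfl⟩ := hx; simp
  | zero => simp
  | add x y _ _ hx hy => rw [map_add, map_add, map_add, hx, hy]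
  | smul c x _ hx => rw [map_smul, map_smul, map_smul, hx]
  | lie x y hx' hy' hx hy =>
    rw [lieValue_lie _ hx' hy', lieValue_lie _ hx' hy', LieHom.map_lie, hx, hy]

end LieValueMap

/-! ### Commutators of derivations and left multiplications -/

section InnerDerivations

variable {k : Type*} [Field k] {V Z B : Type*} [AddCommGroup V] [Module k V] [AddCommGroup Z]
  [Module k Z] [Ring B] [Algebra k B]

/-- The action of the tensor algebra by commutators with `D v + κ v`. -/
def innerAction (κ : V →ₗ[k] B) (D : V →ₗ[k] Module.End k B) :
    TensorAlgebra k V →ₐ[k] Module.End k B :=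
  TensorAlgebra.lift k (D + LinearMap.mul k B ∘ₗ κ - (LinearMap.mul k B).flip ∘ₗ κ)

theorem innerAction_ι (κ : V →ₗ[k] B) (D : V →ₗ[k] Module.End k B) (v : V) (x : B) :
    innerAction κ D (TensorAlgebra.ι k v) x = D v x + κ v * x - x * κ v := by
  rw [innerAction, TensorAlgebra.lift_ι_apply]
  rfl

/-- The elements whose left multiplications are mixed commutators. -/
def innerTheta (κ : V →ₗ[k] B) (D : V →ₗ[k] Module.End k B) (τ : Z →ₗ[k] Module.End k B) :
    TensorAlgebra k V ⊗[k] TensorAlgebra k Z →ₗ[k] B :=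
  TensorProduct.lift (cocycle (innerAction κ D) ∘ₗ LinearMap.lcomp k B κ ∘ₗ
    (TensorAlgebra.lift k τ).toLinearMap).flip

theorem innerTheta_one (κ : V →ₗ[k] B) (D : V →ₗ[k] Module.End k B) (τ : Z →ₗ[k] Module.End k B)
    (t : TensorAlgebra k Z) : innerTheta κ D τ (1 ⊗ₜ t) = 0 :=
  cocycle_one _ _

theorem innerTheta_ι_mul (κ : V →ₗ[k] B) (D : V →ₗ[k] Module.End k B)
    (τ : Z →ₗ[k] Module.End k B) (v : V) (s : TensorAlgebra k V) (t : TensorAlgebra k Z) :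
    innerTheta κ D τ ((TensorAlgebra.ι k v * s) ⊗ₜ t) =
      D v (innerTheta κ D τ (s ⊗ₜ t)) + κ v * innerTheta κ D τ (s ⊗ₜ t) -
        innerTheta κ D τ (s ⊗ₜ t) * κ v +
        TensorAlgebra.algebraMapInv s • TensorAlgebra.lift k τ t (κ v) := by
  rw [← innerAction_ι]
  exact cocycle_ι_mul _ _ v s

variable {κ : V →ₗ[k] B} {D : V →ₗ[k] Module.End k B} {τ : Z →ₗ[k] Module.End k B}

/-- The commutator of a derivation with left multiplication by x is left multiplication by the
derivative of x, and each `τ z` commutes with each `D v`. So `D v` survives only in the constant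
term of `t`, which accounts for the counit. -/
theorem adAction_derivation (hτ : ∀ z x y, τ z (x * y) = x * τ z y + τ z x * y)
    (hc : ∀ v z x, τ z (D v x) = D v (τ z x)) (t : TensorAlgebra k Z) (v : V) :
    adAction τ t (D v + LinearMap.mul k B (κ v)) =
      LinearMap.mul k B (TensorAlgebra.lift k τ t (κ v)) +
      TensorAlgebra.algebraMapInv t • D v := by
  have key : ∀ z x, ⁅τ z, LinearMap.mul k B x⁆ = LinearMap.mul k B (τ z x) := fun z x => by
    refine LinearMap.ext fun y => ?_
    simp [LieRing.of_associative_ring_bracket, hτ]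
  have key' : ∀ z (c : k), ⁅τ z, c • D v⁆ = 0 := fun z c => by
    refine LinearMap.ext fun y => ?_
    simp [LieRing.of_associative_ring_bracket, hc]
  induction t using word_induction with
  | hword l =>
    induction l with
    | nil => simp [add_comm]
    | cons z l ih =>
      rw [word_cons, map_mul, Module.End.mul_apply, ih, adAction_ι, lie_add, key, key']
      simp
  | hzero => simp
  | hadd s t hs ht =>
    simp only [map_add, LinearMap.add_apply (f := adAction τ s), hs, ht,
      LinearMap.add_apply (f := TensorAlgebra.lift k τ s), add_smul]
    abel
  | hsmul c s hs =>
    simp only [map_smul, LinearMap.smul_apply _ (adAction τ s), hs,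
      LinearMap.smul_apply _ (TensorAlgebra.lift k τ s), smul_assoc, smul_add]

/-- Without a constant term in `t` the innermost commutator is a left multiplication. Bracketing a
left multiplication with `D v` plus left multiplication by `κ v` gives a left multiplication again,
by the element that `innerAction` records. -/
theorem theta_derivation (hD : ∀ v x y, D v (x * y) = x * D v y + D v x * y)
    (hτ : ∀ z x y, τ z (x * y) = x * τ z y + τ z x * y)
    (hc : ∀ v z x, τ z (D v x) = D v (τ z x)) (s : TensorAlgebra k V) {t : TensorAlgebra k Z}
    (ht : TensorAlgebra.algebraMapInv t = 0) :
    theta (D + LinearMap.mul k B ∘ₗ κ) τ (s ⊗ₜ t) =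
      LinearMap.mul k B (innerTheta κ D τ (s ⊗ₜ t)) := by
  rw [theta_tmul]
  refine Eq.symm ((cocycle_comp _ _ (adAction (D + LinearMap.mul k B ∘ₗ κ))
    (LinearMap.mul k B) (fun a f => ?_) s).trans ?_)
  · rw [adAction_ι, innerAction_ι]
    refine LinearMap.ext fun y => ?_
    simp only [LieRing.of_associative_ring_bracket, LinearMap.sub_apply, Module.End.mul_apply,
      LinearMap.add_apply, LinearMap.comp_apply, LinearMap.mul_apply', hD, sub_mul, add_mul,
      mul_add, mul_assoc]
    abel
  · congr 2
    refine LinearMap.ext fun v => Eq.symm ?_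
    refine (adAction_derivation hτ hc t v).trans ?_
    rw [ht, zero_smul, add_zero]
    rfl

/-- Left multiplications are closed under commutators, so the conclusion for generators passes to
the Lie algebra they generate. The exponents of `z` being positive, the generators have no constant
term. -/
theorem lieValue_derivation [CharZero k] (hD : ∀ v x y, D v (x * y) = x * D v y + D v x * y)
    (hτ : ∀ z x y, τ z (x * y) = x * τ z y + τ z x * y)
    (hc : ∀ v z x, τ z (D v x) = D v (τ z x))
    {x : TensorAlgebra k (TensorAlgebra k V ⊗[k] TensorAlgebra k Z)} (hx : x ∈ mixedLie k V Z) :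
    lieValue (theta (D + LinearMap.mul k B ∘ₗ κ) τ) x =
      LinearMap.mul k B (TensorAlgebra.lift k (innerTheta κ D τ) x) := by
  induction hx using LieSubalgebra.lieSpan_induction with
  | mem x hx =>
    obtain ⟨v, z, p, q, rfl⟩ := hx
    rw [lieValue_ι, TensorAlgebra.lift_ι_apply, theta_derivation hD hτ hc _ (by simp)]
  | zero => simp
  | add x y _ _ hx hy => rw [map_add, map_add, map_add, hx, hy]
  | smul c x _ hx => rw [map_smul, map_smul, map_smul, hx]
  | lie x y hx' hy' hx hy =>
    rw [lieValue_lie _ (mixedLie_le hx') (mixedLie_le hy'), hx, hy,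
      LieRing.of_associative_ring_bracket, LieRing.of_associative_ring_bracket]
    refine LinearMap.ext fun f => ?_
    simp [mul_assoc]

theorem eval_lift_mulRight {Q M : Type*} [Ring Q] [Algebra k Q] [AddCommGroup M] [Module k M]
    (e : Q →ₗ[k] B →ₗ[k] M) (c : Z →ₗ[k] Q) (he : ∀ q z x, e q (τ z x) = e (q * c z) x)
    (t : TensorAlgebra k Z) (q : Q) (x : B) :
    e q (TensorAlgebra.lift k τ t x) = e (q * TensorAlgebra.lift k c t) x := by
  induction t using word_induction generalizing q x with
  | hword l =>
    induction l generalizing q x with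
    | nil => simp
    | cons z l ih => simp [he, ih, mul_assoc]
  | hzero => simp
  | hadd s t hs ht => simp [hs, ht, mul_add]
  | hsmul c s hs => simp [hs]

end InnerDerivations

/-! ### The representation of the coproduct and evaluation at the unit -/

section MixedCommutators

variable {k : Type*} [Field k] {g h : Type*} [LieRing g] [LieAlgebra k g] [LieRing h]
  [LieAlgebra k h]

local notation "Ug" => UniversalEnvelopingAlgebra k g
local notation "Uh" => UniversalEnvelopingAlgebra k h
local notation "Tens" => TensorAlgebra k (Ug ⊗[k] Uh)
local notation "Conv" => WithConv (Uh →ₗ[k] Tens)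

variable (k g h) in
/-- The derivations of the convolution algebra given by the first Lie algebra. -/
def derAct : g →ₗ[k] Module.End k Conv where
  toFun a := postcomp (tensorDer (derGen a))
  map_add' a b := by rw [tensorDer_derGen_add]; rfl
  map_smul' c a := by rw [tensorDer_derGen_smul]; rfl

variable (k g h) in
/-- The generators of the first Lie algebra in the convolution algebra. -/
def kapι : g →ₗ[k] Conv := kap k g h ∘ₗ (UniversalEnvelopingAlgebra.ι k (L := g)).toLinearMap

variable (k g h) in
/-- The representation of the coproduct of the enveloping algebras. -/
def coprodRep : EnvCoprod k g h →ₐ[k] Module.End k Conv :=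
  EnvCoprod.lift (actLeft k g h) (actRight k g h)

/-- The derivations coming from the first Lie algebra act on values and those from the second on
arguments, hence they commute. Mixed commutators thus act by left multiplication and can be studied
inside the convolution algebra. -/
theorem coprodRep_lieValue [CharZero k]
    {x : TensorAlgebra k (TensorAlgebra k g ⊗[k] TensorAlgebra k h)} (hx : x ∈ mixedLie k g h) :
    coprodRep k g h (lieValue (theta (EnvCoprod.inl k g h).toLinearMap
      (EnvCoprod.inr k g h).toLinearMap) x) =
    LinearMap.mul k Conv (TensorAlgebra.lift k
      (innerTheta (kapι k g h) (derAct k g h) (actRight k g h).toLinearMap) x) := by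
  refine (lieValue_comp _ (AlgHom.toLieHom (coprodRep k g h)) (mixedLie_le hx)).trans ?_
  refine Eq.trans ?_ (lieValue_derivation (fun a => postcomp_mul (tensorDer_mul (derGen a)))
    precomp_mul (fun a c f => rfl) hx)
  congr 2
  refine LinearMap.ext fun w => ?_
  refine (theta_comp _ _ (AlgHom.toLieHom (coprodRep k g h)) w).trans ?_
  congr 2
  · exact LinearMap.ext fun a => EnvCoprod.lift_inl _ _ a
  · exact LinearMap.ext fun a => EnvCoprod.lift_inr _ _ a

variable (k g h) in
/-- The evaluation of the elements of the convolution algebra. -/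
def evalConv : Uh →ₗ[k] Conv →ₗ[k] Tens :=
  (WithConv.linearEquiv k (Uh →ₗ[k] Tens)).toLinearMap.flip

theorem evalConv_apply (f : Conv) (q : Uh) : evalConv k g h q f = f q := rfl

theorem evalConv_lift_actRight (t : TensorAlgebra k h) (f : Conv) (q : Uh) :
    evalConv k g h q (TensorAlgebra.lift k (actRight k g h).toLinearMap t f) =
      evalConv k g h (q * toEnv k h t) f :=
  eval_lift_mulRight (evalConv k g h) _ (fun _ _ _ => rfl) t q f

variable (k g h) in
/-- The evaluation of the elements of the convolution algebra at the unit. -/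
def evalOne : Conv →ₐ[k] Tens :=
  AlgHom.ofLinearMap (evalConv k g h 1)
    (by
      rw [evalConv_apply, LinearMap.convOne_apply]
      change algebraMap k _ (envCounit k h 1) = 1
      rw [map_one, map_one])
    -- The unit of the enveloping algebra is group-like, so evaluation at it is multiplicative for
    -- convolution.
    (fun f f' => by
      change LinearMap.mul' k Tens (TensorProduct.map f.ofConv f'.ofConv (envComul k h 1)) = _
      rw [map_one, Algebra.TensorProduct.one_def, TensorProduct.map_tmul, LinearMap.mul'_apply]
      rfl)

end MixedCommutators

/-! ### Mixed commutators generate a free Lie algebra -/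

section DegreeLemmas

variable {k : Type*} [Field k] {W W' : Type*} [AddCommGroup W] [Module k W] [AddCommGroup W']
  [Module k W']

theorem deg_tensorDer (d : W →ₗ[k] TensorAlgebra k W) (e : W →ₗ[k] W)
    (h0 : ∀ w, deg 0 (d w) = 0) (h1 : ∀ w, deg 1 (d w) = TensorAlgebra.ι k (e w))
    (y : TensorAlgebra k W) : deg 0 (tensorDer d y) = 0 ∧
      deg 1 (tensorDer d y) = tensorDer (TensorAlgebra.ι k ∘ₗ e) (deg 1 y) := by
  induction y using word_induction with
  | hword l =>
    induction l with
    | nil =>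
      have : deg (k := k) (V := W) 1 1 = 0 := by simpa using deg_word (k := k) (V := W) 1 []
      simp [this]
    | cons w l ih =>
      simp only [word_cons, tensorDer_mul, tensorDer_ι, map_add, deg_zero_mul, deg_one_mul,
        deg_zero_ι, deg_one_ι, h0, h1, ih.1, zero_mul, mul_zero, add_zero, zero_add,
        LinearMap.comp_apply]
      refine ⟨trivial, ?_⟩
      cases l with
      | nil =>
        have : deg (k := k) (V := W) 0 1 = 1 := by simpa using deg_word (k := k) (V := W) 0 []
        simp [this]
      | cons w' l => rw [deg_word]; simp
  | hzero => simp
  | hadd x y hx hy => simp only [map_add, hx.1, hy.1, hx.2, hy.2, add_zero, and_self]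
  | hsmul c x hx => simp only [map_smul, hx.1, hx.2, smul_zero, and_self]

theorem deg_lift (f : W →ₗ[k] W') (n : ℕ) (y : TensorAlgebra k W) :
    deg n (TensorAlgebra.lift k (TensorAlgebra.ι k ∘ₗ f) y) =
      TensorAlgebra.lift k (TensorAlgebra.ι k ∘ₗ f) (deg n y) := by
  have hw : ∀ l : List W, TensorAlgebra.lift k (TensorAlgebra.ι k ∘ₗ f) (word l) =
      word (l.map f) := fun l => by
    induction l with
    | nil => simp
    | cons w l ih => simp [ih]
  induction y using word_induction with
  | hword l =>
    rw [hw, deg_word, deg_word, List.length_map]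
    split_ifs
    · rw [hw]
    · rw [map_zero]
  | hzero => simp
  | hadd x y hx hy => simp only [map_add, hx, hy]
  | hsmul c x hx => simp only [map_smul, hx]

theorem deg_mul'_map {Q : Type*} [AddCommGroup Q] [Module k Q] (f f' : Q →ₗ[k] TensorAlgebra k W)
    (hf : ∀ q, deg 0 (f q) = 0) (hf' : ∀ q, deg 0 (f' q) = 0) (z : Q ⊗[k] Q) :
    deg 0 (LinearMap.mul' k _ (TensorProduct.map f f' z)) = 0 ∧
      deg 1 (LinearMap.mul' k _ (TensorProduct.map f f' z)) = 0 := by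
  induction z using TensorProduct.induction_on with
  | zero => simp
  | tmul a b => simp [deg_zero_mul, deg_one_mul, hf, hf']
  | add a b ha hb => simp only [map_add, ha, hb, add_zero, and_self]

end DegreeLemmas

/-! ### Leading terms of mixed commutators -/

section MixedCommutators

variable {k : Type*} [Field k] {g h : Type*} [LieRing g] [LieAlgebra k g] [LieRing h]
  [LieAlgebra k h]

local notation "Ug" => UniversalEnvelopingAlgebra k g
local notation "Uh" => UniversalEnvelopingAlgebra k h
local notation "Tens" => TensorAlgebra k (Ug ⊗[k] Uh)
local notation "Conv" => WithConv (Uh →ₗ[k] Tens)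

/-- Convolution products of functions without constant term start in degree two, so they do not
contribute to leading terms. -/
theorem deg_convMul (f f' : Conv) (hf : ∀ q, deg 0 (f q) = 0) (hf' : ∀ q, deg 0 (f' q) = 0)
    (q : Uh) : deg 0 ((f * f') q) = 0 ∧ deg 1 ((f * f') q) = 0 :=
  deg_mul'_map f.ofConv f'.ofConv hf hf' (envComul k h q)

theorem deg_zero_kap (u : Ug) (q : Uh) : deg 0 (kap k g h u q) = 0 := deg_zero_ι _

theorem deg_derGen (a : g) (w : Ug ⊗[k] Uh) : deg 0 (derGen a w) = 0 ∧
    deg 1 (derGen a w) = TensorAlgebra.ι k ((LinearMap.mulLeft k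
      (UniversalEnvelopingAlgebra.ι k a)).rTensor Uh w) := by
  induction w using TensorProduct.induction_on with
  | zero => simp
  | tmul u q =>
    have := deg_convMul (kap k g h (UniversalEnvelopingAlgebra.ι k a)) (kap k g h u)
      (deg_zero_kap _) (deg_zero_kap _) q
    rw [derGen_tmul, map_sub, map_sub, this.1, this.2, deg_zero_kap, sub_zero, sub_zero, kap_apply,
      deg_one_ι]
    exact ⟨rfl, rfl⟩
  | add a b ha hb => simp only [map_add, ha.1, ha.2, hb.1, hb.2, add_zero, and_self]

theorem map_innerTheta_ι_mul {V Z B M : Type*} [AddCommGroup V] [Module k V] [AddCommGroup Z]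
    [Module k Z] [Ring B] [Algebra k B] [AddCommGroup M] [Module k M] (e : B →ₗ[k] M)
    (κ : V →ₗ[k] B) (D : V →ₗ[k] Module.End k B) (τ : Z →ₗ[k] Module.End k B) (v : V)
    (s : TensorAlgebra k V) (t : TensorAlgebra k Z) :
    e (innerTheta κ D τ ((TensorAlgebra.ι k v * s) ⊗ₜ t)) =
      e (D v (innerTheta κ D τ (s ⊗ₜ t))) + e (κ v * innerTheta κ D τ (s ⊗ₜ t)) -
        e (innerTheta κ D τ (s ⊗ₜ t) * κ v) +
        TensorAlgebra.algebraMapInv s • e (TensorAlgebra.lift k τ t (κ v)) := by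
  rw [innerTheta_ι_mul, map_add, map_sub, map_add, map_smul]

/-- Modulo degree two, products with κ(a) disappear and the derivation of a acts as left
multiplication by a on the first tensor factor. Letter by letter this builds the image of `s` in the
enveloping algebra; its constant term is subtracted because the commutator vanishes for s = 1. The
letters of `t` act by right multiplication on the argument `q`. -/
theorem deg_innerTheta (s : TensorAlgebra k g) (t : TensorAlgebra k h) (q : Uh) :
    deg 0 (evalConv k g h q (innerTheta (kapι k g h) (derAct k g h) (actRight k g h).toLinearMap
      (s ⊗ₜ t))) = 0 ∧
    deg 1 (evalConv k g h q (innerTheta (kapι k g h) (derAct k g h) (actRight k g h).toLinearMap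
      (s ⊗ₜ t))) = TensorAlgebra.ι k
        ((toEnv k g s - algebraMap k Ug (TensorAlgebra.algebraMapInv s)) ⊗ₜ (q * toEnv k h t)) := by
  induction s using word_induction generalizing q with
  | hword l =>
    induction l generalizing q with
    | nil => rw [word_nil, innerTheta_one]; simp
    | cons a l ih =>
      set x := innerTheta (kapι k g h) (derAct k g h) (actRight k g h).toLinearMap (word l ⊗ₜ t)
        with hx
      have h1 := deg_convMul (kapι k g h a) x (deg_zero_kap _) (fun q => (ih q).1) q
      have h2 := deg_convMul x (kapι k g h a) (fun q => (ih q).1) (deg_zero_kap _) q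
      have h3 := deg_tensorDer (derGen a) _ (fun w => (deg_derGen a w).1)
        (fun w => (deg_derGen a w).2) (evalConv k g h q x)
      rw [(ih q).2, tensorDer_ι] at h3
      have h4 : evalConv k g h q (innerTheta (kapι k g h) (derAct k g h)
          (actRight k g h).toLinearMap (word (a :: l) ⊗ₜ t)) =
          tensorDer (derGen a) (evalConv k g h q x) + (kapι k g h a * x) q -
            (x * kapι k g h a) q + TensorAlgebra.algebraMapInv (word l : TensorAlgebra k g) •
              TensorAlgebra.ι k (UniversalEnvelopingAlgebra.ι k a ⊗ₜ (q * toEnv k h t)) := by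
        refine (map_innerTheta_ι_mul (evalConv k g h q) (kapι k g h) (derAct k g h)
          (actRight k g h).toLinearMap a (word l) t).trans ?_
        exact congrArg (fun y => _ + TensorAlgebra.algebraMapInv (word l : TensorAlgebra k g) • y)
          (evalConv_lift_actRight t (kapι k g h a) q)
      have h5 : toEnv k g (word (a :: l) : TensorAlgebra k g) - algebraMap k Ug
          (TensorAlgebra.algebraMapInv (word (a :: l) : TensorAlgebra k g)) =
          UniversalEnvelopingAlgebra.ι k a *
            (toEnv k g (word l : TensorAlgebra k g) - algebraMap k Ug (TensorAlgebra.algebraMapInv (word l : TensorAlgebra k g))) +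
          TensorAlgebra.algebraMapInv (word l : TensorAlgebra k g) • UniversalEnvelopingAlgebra.ι k a := by
        rw [word_cons, map_mul (toEnv k g), toEnv_ι, mul_sub, ← Algebra.commutes,
          ← Algebra.smul_def, sub_add_cancel, map_mul TensorAlgebra.algebraMapInv, algebraMapInv_ι,
          zero_mul, map_zero, sub_zero]
      rw [h4, h5]
      generalize tensorDer (derGen a) (evalConv k g h q x) = y1 at h3 ⊢
      generalize (kapι k g h a * x) q = y2 at h1 ⊢
      generalize (x * kapι k g h a) q = y3 at h2 ⊢
      generalize toEnv k g (word l : TensorAlgebra k g) - algebraMap k Ug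
        (TensorAlgebra.algebraMapInv (word l : TensorAlgebra k g)) = u at h3 ⊢
      simp only [map_add, map_sub, map_smul, h1.1, h1.2, h2.1, h2.2, h3.1, h3.2, deg_zero_ι,
        deg_one_ι, add_zero, sub_zero, smul_zero, true_and, LinearMap.comp_apply,
        LinearMap.rTensor_tmul, LinearMap.mulLeft_apply, TensorProduct.add_tmul,
        ← TensorProduct.smul_tmul']
  | hzero => simp
  | hadd x y hx hy =>
    simp only [TensorProduct.add_tmul, map_add, (hx q).1, (hx q).2, (hy q).1, (hy q).2, add_zero,
      true_and]
    rw [← map_add, ← TensorProduct.add_tmul]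
    congr 2
    abel
  | hsmul c x hx =>
    simp only [← TensorProduct.smul_tmul', map_smul, (hx q).1, (hx q).2, smul_zero, true_and]
    rw [← map_smul, TensorProduct.smul_tmul', smul_sub, smul_eq_mul, map_mul,
      ← Algebra.smul_def]

theorem mixedLie_le_adjoin {V Z : Type*} [AddCommGroup V] [Module k V] [AddCommGroup Z]
    [Module k Z] {x : TensorAlgebra k (TensorAlgebra k V ⊗[k] TensorAlgebra k Z)}
    (hx : x ∈ mixedLie k V Z) :
    x ∈ Algebra.adjoin k (TensorAlgebra.ι k '' {w | ∃ (v : V) (z : Z) (p q : ℕ), w =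
      ((TensorAlgebra.ι k v ^ (p + 1)) ⊗ₜ[k] (TensorAlgebra.ι k z ^ (q + 1)))}) := by
  induction hx using LieSubalgebra.lieSpan_induction with
  | mem x hx =>
    obtain ⟨v, z, p, q, rfl⟩ := hx
    exact Algebra.subset_adjoin ⟨_, ⟨v, z, p, q, rfl⟩, rfl⟩
  | zero => exact zero_mem _
  | add x y _ _ hx hy => exact add_mem hx hy
  | smul c x _ hx => exact Subalgebra.smul_mem _ hx c
  | lie x y _ _ hx hy =>
    rw [LieRing.of_associative_ring_bracket]
    exact sub_mem (mul_mem hx hy) (mul_mem hy hx)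

/-- Follow a mixed Lie element to the convolution algebra, evaluate at 1, and undo symmetrization by
the Poincaré–Birkhoff–Witt inverses. On the generators vᵖ ⊗ z^q the composite is the identity up to
higher degree, so `eq_zero_of_leadingTerm` applies. Allowing the value `inl a` shows at the same
time that mixed commutators meet the first Lie algebra trivially. -/
theorem lieValue_inl_inr_injective [CharZero k]
    {x : TensorAlgebra k (TensorAlgebra k g ⊗[k] TensorAlgebra k h)} (hx : x ∈ mixedLie k g h)
    (a : g) (hxa : lieValue (theta (EnvCoprod.inl k g h).toLinearMap
      (EnvCoprod.inr k g h).toLinearMap) x = EnvCoprod.inl k g h a) : x = 0 := by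
  obtain ⟨v, hv⟩ := exists_leftInverse_toEnv (k := k) (g := g)
  obtain ⟨v', hv'⟩ := exists_leftInverse_toEnv (k := k) (g := h)
  -- Subtracting the constant term makes `v''` kill 1 while keeping positive powers; the generator a
  -- ⊗ 1 met at the end then disappears.
  set v'' : Uh →ₗ[k] TensorAlgebra k h := v' -
    Algebra.linearMap k _ ∘ₗ TensorAlgebra.algebraMapInv.toLinearMap ∘ₗ v' with hv''
  have hv1 : v'' 1 = 0 := by
    have := hv' 0 0
    rw [pow_zero, pow_zero] at this
    simp [hv'', this]
  have hvs : ∀ z n, v'' (UniversalEnvelopingAlgebra.ι k z ^ (n + 1)) =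
      TensorAlgebra.ι k z ^ (n + 1) := fun z n => by
    rw [hv'', LinearMap.sub_apply, LinearMap.comp_apply, LinearMap.comp_apply, hv']
    simp
  set X := TensorAlgebra.lift k (innerTheta (kapι k g h) (derAct k g h)
    (actRight k g h).toLinearMap) with hX
  set G' : Tens →ₐ[k] TensorAlgebra k (TensorAlgebra k g ⊗[k] TensorAlgebra k h) :=
    TensorAlgebra.lift k (TensorAlgebra.ι k ∘ₗ TensorProduct.map v v'') with hG'
  refine eq_zero_of_leadingTerm (G'.comp ((evalOne k g h).comp X)) _ ?_ ?_
    (mixedLie_le_adjoin hx) ?_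
  · rintro _ ⟨b, z, p, q, rfl⟩
    rw [AlgHom.comp_apply, AlgHom.comp_apply, hX, TensorAlgebra.lift_ι_apply, hG', deg_lift]
    exact (congrArg G' (deg_innerTheta _ _ 1).1).trans (map_zero G')
  · rintro _ ⟨b, z, p, q, rfl⟩
    rw [AlgHom.comp_apply, AlgHom.comp_apply, hX, TensorAlgebra.lift_ι_apply, hG', deg_lift]
    refine (congrArg G' (deg_innerTheta _ _ 1).2).trans ?_
    rw [hG', TensorAlgebra.lift_ι_apply, LinearMap.comp_apply, TensorProduct.map_tmul, one_mul,
      map_pow (toEnv k h), toEnv_ι, hvs, map_pow (toEnv k g), toEnv_ι,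
      map_pow TensorAlgebra.algebraMapInv, algebraMapInv_ι, zero_pow (Nat.succ_ne_zero p), map_zero,
      sub_zero, hv]
  -- Apply both operators to the unit of the convolution algebra: the derivation kills it, leaving
  -- κ(a) = X(x). At 1 this is the generator a ⊗ 1, which `v''` annihilates.
  · have h1 := coprodRep_lieValue hx
    rw [hxa, coprodRep, EnvCoprod.lift_inl] at h1
    have h2 := LinearMap.congr_fun h1 1
    have hp : postcomp (tensorDer (derGen a)) (1 : Conv) = 0 := by
      have := postcomp_mul (tensorDer_mul (derGen a)) (1 : Conv) 1
      rw [one_mul, one_mul, mul_one] at this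
      exact left_eq_add.1 this
    have h3 : kap k g h (UniversalEnvelopingAlgebra.ι k a) = X x := by
      have h4 : postcomp (tensorDer (derGen a)) (1 : Conv) +
        kap k g h (UniversalEnvelopingAlgebra.ι k a) * 1 = X x * 1 := h2
      rwa [hp, zero_add, mul_one, mul_one] at h4
    rw [AlgHom.comp_apply, AlgHom.comp_apply, ← h3]
    change G' (TensorAlgebra.ι k (_ ⊗ₜ 1)) = 0
    rw [hG', TensorAlgebra.lift_ι_apply, LinearMap.comp_apply, TensorProduct.map_tmul, hv1,
      TensorProduct.tmul_zero, map_zero]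

end MixedCommutators

/-! ### Post-Lie algebras and Rota-Baxter Lie algebras -/

/-- The additional operation of a post-Lie algebra. -/
class PostLieAlgebra (k A : Type*) [Field k] [LieRing A] [LieAlgebra k A] where
  tri : A →ₗ[k] A →ₗ[k] A
  lie_tri : ∀ a b c, tri ⁅a, b⁆ c = ⁅tri a c, b⁆ + ⁅a, tri b c⁆
  tri_lie : ∀ a b c, tri a ⁅b, c⁆ =
    tri (tri a b) c - tri a (tri b c) - (tri (tri a c) b - tri a (tri c b))

/-- A Rota-Baxter operator of weight one on a Lie algebra. -/
class RotaBaxterLie (k L : Type*) [Field k] [LieRing L] [LieAlgebra k L] where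
  R : L →ₗ[k] L
  lie_R : ∀ x y, ⁅R x, R y⁆ = R (⁅R x, y⁆ + ⁅x, R y⁆ + ⁅x, y⁆)

section Basic

variable (k : Type*) [Field k]

instance RotaBaxterLie.postLie (L : Type*) [LieRing L] [LieAlgebra k L] [RotaBaxterLie k L] :
    PostLieAlgebra k L where
  tri := (LieModule.toEnd k L L : L →ₗ[k] Module.End k L).compl₂ (RotaBaxterLie.R (k := k))
  lie_tri a b c := by
    simp only [LinearMap.compl₂_apply, LieHom.coe_toLinearMap, LieModule.toEnd_apply_apply]
    rw [lie_lie, ← lie_skew b ⁅a, RotaBaxterLie.R (k := k) c⁆]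
    abel
  tri_lie a b c := by
    simp only [LinearMap.compl₂_apply, LieHom.coe_toLinearMap, LieModule.toEnd_apply_apply]
    have h1 := RotaBaxterLie.lie_R (k := k) b c
    have h2 : ⁅a, ⁅RotaBaxterLie.R (k := k) b, RotaBaxterLie.R (k := k) c⁆⁆ =
        ⁅⁅a, RotaBaxterLie.R (k := k) b⁆, RotaBaxterLie.R (k := k) c⁆ -
          ⁅⁅a, RotaBaxterLie.R (k := k) c⁆, RotaBaxterLie.R (k := k) b⁆ := by
      rw [leibniz_lie, ← lie_skew ⁅a, RotaBaxterLie.R (k := k) c⁆]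
      abel
    rw [h1, ← lie_skew _ c, map_add, map_add, map_neg, lie_add, lie_add, lie_neg] at h2
    rw [eq_sub_of_add_eq' h2]
    abel

theorem RotaBaxterLie.tri_apply {L : Type*} [LieRing L] [LieAlgebra k L] [RotaBaxterLie k L]
    (x y : L) : PostLieAlgebra.tri (k := k) x y = ⁅x, RotaBaxterLie.R (k := k) y⁆ := rfl

variable (A : Type*) [LieRing A] [LieAlgebra k A] [PostLieAlgebra k A]

/-- The sub-adjacent Lie bracket of a post-Lie algebra. -/
def subBracket : A →ₗ[k] A →ₗ[k] A :=
  PostLieAlgebra.tri - PostLieAlgebra.tri.flip + (LieModule.toEnd k A A : A →ₗ[k] Module.End k A)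

variable {k A} in
theorem subBracket_apply (a b : A) : subBracket k A a b = PostLieAlgebra.tri (k := k) a b -
    PostLieAlgebra.tri (k := k) b a + ⁅a, b⁆ := rfl

-- The axiom `tri_lie` rearranged: a ↦ −(· ◁ a) is a representation of the sub-adjacent Lie algebra.
variable {k A} in
theorem tri_subBracket (a b c : A) :
    PostLieAlgebra.tri (k := k) a (subBracket k A b c) =
      PostLieAlgebra.tri (k := k) (PostLieAlgebra.tri (k := k) a b) c -
        PostLieAlgebra.tri (k := k) (PostLieAlgebra.tri (k := k) a c) b := by
  rw [subBracket_apply, map_add, map_sub, PostLieAlgebra.tri_lie]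
  abel

/-- The sub-adjacent Lie algebra of a post-Lie algebra. -/
@[nolint unusedArguments]
def SubAdj (_ : Type*) (A : Type*) := A

instance : AddCommGroup (SubAdj k A) := inferInstanceAs (AddCommGroup A)

instance : Module k (SubAdj k A) := inferInstanceAs (Module k A)

/-- The identity map to the sub-adjacent Lie algebra. -/
def SubAdj.of : A ≃ₗ[k] SubAdj k A := LinearEquiv.refl k A

instance : LieRing (SubAdj k A) where
  bracket := fun a b : A => subBracket k A a b
  add_lie a b c := LinearMap.map_add₂ (subBracket k A) a b c
  lie_add a b c := map_add (subBracket k A a) b c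
  lie_self (a : A) := by
    change subBracket k A a a = 0
    rw [subBracket_apply]
    simp
  leibniz_lie (a b c : A) := by
    change subBracket k A a (subBracket k A b c) = subBracket k A (subBracket k A a b) c +
      subBracket k A b (subBracket k A a c)
    have h : ∀ x y z : A, ⁅subBracket k A x y, z⁆ = ⁅PostLieAlgebra.tri (k := k) x y, z⁆ -
      ⁅PostLieAlgebra.tri (k := k) y x, z⁆ + ⁅⁅x, y⁆, z⁆ := fun x y z => by
        rw [subBracket_apply, add_lie, sub_lie]
    have h' : ∀ x y z : A, ⁅z, subBracket k A x y⁆ = ⁅z, PostLieAlgebra.tri (k := k) x y⁆ -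
      ⁅z, PostLieAlgebra.tri (k := k) y x⁆ + ⁅z, ⁅x, y⁆⁆ := fun x y z => by
        rw [subBracket_apply, lie_add, lie_sub]
    have h'' : ∀ x y z : A, PostLieAlgebra.tri (k := k) (subBracket k A x y) z =
      PostLieAlgebra.tri (k := k) (PostLieAlgebra.tri (k := k) x y) z -
      PostLieAlgebra.tri (k := k) (PostLieAlgebra.tri (k := k) y x) z +
      (⁅PostLieAlgebra.tri (k := k) x z, y⁆ + ⁅x, PostLieAlgebra.tri (k := k) y z⁆) :=
      fun x y z => by
        rw [subBracket_apply, map_add, map_sub, LinearMap.add_apply, LinearMap.sub_apply,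
          PostLieAlgebra.lie_tri]
    rw [subBracket_apply a (subBracket k A b c), subBracket_apply (subBracket k A a b) c,
      subBracket_apply b (subBracket k A a c)]
    simp only [tri_subBracket, h, h', h'']
    rw [leibniz_lie a b c, ← lie_skew b (PostLieAlgebra.tri (k := k) a c)]
    abel

instance : LieAlgebra k (SubAdj k A) where
  lie_smul c a b := map_smul (subBracket k A a) c b

variable {k} in
/-- A homomorphism of post-Lie algebras induces a homomorphism of sub-adjacent Lie algebras. -/
def SubAdj.map {A B : Type*} [LieRing A] [LieAlgebra k A] [PostLieAlgebra k A] [LieRing B]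
    [LieAlgebra k B] [PostLieAlgebra k B] (f : A →ₗ⁅k⁆ B)
    (hf : ∀ a b, f (PostLieAlgebra.tri (k := k) a b) = PostLieAlgebra.tri (k := k) (f a) (f b)) :
    SubAdj k A →ₗ⁅k⁆ SubAdj k B where
  toLinearMap := (f : A →ₗ[k] B)
  map_lie' {a b} := by
    have h : ∀ a b : A, f (subBracket k A a b) = subBracket k B (f a) (f b) := fun a b => by
      rw [subBracket_apply, subBracket_apply, map_add, map_sub, hf, hf, LieHom.map_lie]
    exact h a b

/-- This is the Rota–Baxter identity itself, read as saying that R is a homomorphism from the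
sub-adjacent Lie algebra. -/
theorem RotaBaxterLie.R_subBracket {L : Type*} [LieRing L] [LieAlgebra k L] [RotaBaxterLie k L]
    (x y : L) : RotaBaxterLie.R (k := k) (subBracket k L x y) =
      ⁅RotaBaxterLie.R (k := k) x, RotaBaxterLie.R (k := k) y⁆ := by
  rw [RotaBaxterLie.lie_R, subBracket_apply, tri_apply, tri_apply,
    ← lie_skew y (RotaBaxterLie.R (k := k) x)]
  congr 1
  abel

end Basic

/-! ### The universal enveloping algebra by generators and relations -/

section Universal

variable (k : Type*) [Field k]

/-- Terms of the universal enveloping Rota-Baxter Lie algebra. -/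
inductive RBTerm (A : Type*) : Type _
  | of (a : A) : RBTerm A
  | zero : RBTerm A
  | add (x y : RBTerm A) : RBTerm A
  | smul (c : k) (x : RBTerm A) : RBTerm A
  | lie (x y : RBTerm A) : RBTerm A
  | R (x : RBTerm A) : RBTerm A

variable (A : Type*) [LieRing A] [LieAlgebra k A] [PostLieAlgebra k A]

/-- The relations of the universal enveloping Rota-Baxter Lie algebra. -/
inductive RBTerm.Rel : RBTerm k A → RBTerm k A → Prop
  | refl (x) : Rel x x
  | symm {x y} : Rel x y → Rel y x
  | trans {x y z} : Rel x y → Rel y z → Rel x z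
  | add_congr {x x' y y'} : Rel x x' → Rel y y' → Rel (.add x y) (.add x' y')
  | smul_congr (c) {x x'} : Rel x x' → Rel (.smul c x) (.smul c x')
  | lie_congr {x x' y y'} : Rel x x' → Rel y y' → Rel (.lie x y) (.lie x' y')
  | R_congr {x x'} : Rel x x' → Rel (.R x) (.R x')
  | add_assoc (x y z) : Rel (.add (.add x y) z) (.add x (.add y z))
  | add_comm (x y) : Rel (.add x y) (.add y x)
  | zero_add (x) : Rel (.add .zero x) x
  | zero_smul (x) : Rel (.smul 0 x) .zero
  | one_smul (x) : Rel (.smul 1 x) x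
  | mul_smul (c d x) : Rel (.smul (c * d) x) (.smul c (.smul d x))
  | smul_add (c x y) : Rel (.smul c (.add x y)) (.add (.smul c x) (.smul c y))
  | add_smul (c d x) : Rel (.smul (c + d) x) (.add (.smul c x) (.smul d x))
  | add_lie (x y z) : Rel (.lie (.add x y) z) (.add (.lie x z) (.lie y z))
  | lie_add (x y z) : Rel (.lie x (.add y z)) (.add (.lie x y) (.lie x z))
  | lie_self (x) : Rel (.lie x x) .zero
  | leibniz_lie (x y z) : Rel (.lie x (.lie y z)) (.add (.lie (.lie x y) z) (.lie y (.lie x z)))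
  | lie_smul (c x y) : Rel (.lie x (.smul c y)) (.smul c (.lie x y))
  | R_add (x y) : Rel (.R (.add x y)) (.add (.R x) (.R y))
  | R_smul (c x) : Rel (.R (.smul c x)) (.smul c (.R x))
  | lie_R (x y) : Rel (.lie (.R x) (.R y))
      (.R (.add (.add (.lie (.R x) y) (.lie x (.R y))) (.lie x y)))
  | of_add (a b) : Rel (.of (a + b)) (.add (.of a) (.of b))
  | of_smul (c : k) (a) : Rel (.of (c • a)) (.smul c (.of a))
  | of_lie (a b) : Rel (.of ⁅a, b⁆) (.lie (.of a) (.of b))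
  | of_tri (a b) : Rel (.of (PostLieAlgebra.tri (k := k) a b)) (.lie (.of a) (.R (.of b)))

/-- The equivalence relation generated by the relations. -/
def RBTerm.setoid : Setoid (RBTerm k A) := ⟨RBTerm.Rel k A, ⟨.refl, .symm, .trans⟩⟩

/-- The universal enveloping Rota-Baxter Lie algebra of a post-Lie algebra. -/
def EnvRB := Quotient (RBTerm.setoid k A)

namespace EnvRB

instance : Zero (EnvRB k A) := ⟨Quotient.mk _ .zero⟩

instance : Add (EnvRB k A) := ⟨Quotient.map₂ .add fun _ _ h _ _ h' => .add_congr h h'⟩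

instance : Neg (EnvRB k A) := ⟨Quotient.map (.smul (-1)) fun _ _ h => .smul_congr _ h⟩

instance : AddCommGroup (EnvRB k A) where
  add_assoc := by rintro ⟨x⟩ ⟨y⟩ ⟨z⟩; exact Quotient.sound (.add_assoc x y z)
  add_comm := by rintro ⟨x⟩ ⟨y⟩; exact Quotient.sound (.add_comm x y)
  zero_add := by rintro ⟨x⟩; exact Quotient.sound (.zero_add x)
  add_zero := by rintro ⟨x⟩; exact Quotient.sound (.trans (.add_comm _ _) (.zero_add x))
  neg_add_cancel := by
    rintro ⟨x⟩
    refine Quotient.sound (.trans (.add_congr (.refl _) (.symm (.one_smul x))) ?_)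
    refine .trans (.symm (.add_smul _ _ _)) ?_
    rw [neg_add_cancel]
    exact .zero_smul x
  nsmul := nsmulRec
  zsmul := zsmulRec

instance : Module k (EnvRB k A) where
  smul c := Quotient.map (.smul c) fun _ _ h => .smul_congr _ h
  one_smul := by rintro ⟨x⟩; exact Quotient.sound (.one_smul x)
  mul_smul := by rintro c d ⟨x⟩; exact Quotient.sound (.mul_smul c d x)
  smul_zero c := Quotient.sound (.trans (.smul_congr c (.symm (.zero_smul .zero)))
    (.trans (.symm (.mul_smul _ _ _)) (by rw [mul_zero]; exact .zero_smul _)))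
  smul_add := by rintro c ⟨x⟩ ⟨y⟩; exact Quotient.sound (.smul_add c x y)
  add_smul := by rintro c d ⟨x⟩; exact Quotient.sound (.add_smul c d x)
  zero_smul := by rintro ⟨x⟩; exact Quotient.sound (.zero_smul x)

instance : LieRing (EnvRB k A) where
  bracket := Quotient.map₂ .lie fun _ _ h _ _ h' => .lie_congr h h'
  add_lie := by rintro ⟨x⟩ ⟨y⟩ ⟨z⟩; exact Quotient.sound (.add_lie x y z)
  lie_add := by rintro ⟨x⟩ ⟨y⟩ ⟨z⟩; exact Quotient.sound (.lie_add x y z)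
  lie_self := by rintro ⟨x⟩; exact Quotient.sound (.lie_self x)
  leibniz_lie := by rintro ⟨x⟩ ⟨y⟩ ⟨z⟩; exact Quotient.sound (.leibniz_lie x y z)

instance : LieAlgebra k (EnvRB k A) where
  lie_smul := by rintro c ⟨x⟩ ⟨y⟩; exact Quotient.sound (.lie_smul c x y)

instance : RotaBaxterLie k (EnvRB k A) where
  R :=
    { toFun := Quotient.map .R fun _ _ h => .R_congr h
      map_add' := by rintro ⟨x⟩ ⟨y⟩; exact Quotient.sound (.R_add x y)
      map_smul' := by rintro c ⟨x⟩; exact Quotient.sound (.R_smul c x) }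
  lie_R := by rintro ⟨x⟩ ⟨y⟩; exact Quotient.sound (.lie_R x y)

/-- The homomorphism from a post-Lie algebra to its universal enveloping algebra. -/
def of : A →ₗ⁅k⁆ EnvRB k A where
  toFun a := Quotient.mk _ (.of a)
  map_add' a b := Quotient.sound (.of_add a b)
  map_smul' c a := Quotient.sound (.of_smul c a)
  map_lie' {a b} := Quotient.sound (.of_lie a b)

variable {k A}

theorem of_tri (a b : A) : of k A (PostLieAlgebra.tri (k := k) a b) =
    ⁅of k A a, RotaBaxterLie.R (k := k) (of k A b)⁆ := Quotient.sound (.of_tri a b)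

@[elab_as_elim]
theorem induction {p : EnvRB k A → Prop} (hof : ∀ a, p (of k A a)) (hzero : p 0)
    (hadd : ∀ x y, p x → p y → p (x + y)) (hsmul : ∀ (c : k) x, p x → p (c • x))
    (hlie : ∀ x y, p x → p y → p ⁅x, y⁆) (hR : ∀ x, p x → p (RotaBaxterLie.R (k := k) x))
    (x : EnvRB k A) : p x := by
  obtain ⟨x⟩ := x
  induction x with
  | of a => exact hof a
  | zero => exact hzero
  | add x y hx hy => exact hadd _ _ hx hy
  | smul c x hx => exact hsmul c _ hx
  | lie x y hx hy => exact hlie _ _ hx hy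
  | R x hx => exact hR _ hx

variable {M : Type*} [LieRing M] [LieAlgebra k M] [RotaBaxterLie k M]

/-- The value of a term in a Rota-Baxter Lie algebra. -/
def termValue (f : A → M) : RBTerm k A → M
  | .of a => f a
  | .zero => 0
  | .add x y => termValue f x + termValue f y
  | .smul c x => c • termValue f x
  | .lie x y => ⁅termValue f x, termValue f y⁆
  | .R x => RotaBaxterLie.R (k := k) (termValue f x)

theorem termValue_rel (f : A →ₗ⁅k⁆ M)
    (hf : ∀ a b, f (PostLieAlgebra.tri (k := k) a b) = ⁅f a, RotaBaxterLie.R (k := k) (f b)⁆)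
    {x y : RBTerm k A} (h : RBTerm.Rel k A x y) : termValue f x = termValue f y := by
  induction h with
  | refl => rfl
  | symm _ h => exact h.symm
  | trans _ _ h h' => exact h.trans h'
  | _ => simp_all [termValue, add_assoc, add_comm, mul_smul, add_smul, RotaBaxterLie.lie_R]

/-- The universal property of the universal enveloping Rota-Baxter Lie algebra. -/
def lift (f : A →ₗ⁅k⁆ M)
    (hf : ∀ a b, f (PostLieAlgebra.tri (k := k) a b) = ⁅f a, RotaBaxterLie.R (k := k) (f b)⁆) :
    EnvRB k A →ₗ⁅k⁆ M where
  toFun := Quotient.lift (termValue f) fun _ _ h => termValue_rel f hf h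
  map_add' := by rintro ⟨x⟩ ⟨y⟩; rfl
  map_smul' := by rintro c ⟨x⟩; rfl
  map_lie' {x y} := by obtain ⟨x⟩ := x; obtain ⟨y⟩ := y; rfl

@[simp] theorem lift_R (f : A →ₗ⁅k⁆ M)
    (hf : ∀ a b, f (PostLieAlgebra.tri (k := k) a b) = ⁅f a, RotaBaxterLie.R (k := k) (f b)⁆)
    (x : EnvRB k A) : lift f hf (RotaBaxterLie.R (k := k) x) =
      RotaBaxterLie.R (k := k) (lift f hf x) := by
  obtain ⟨x⟩ := x
  rfl

theorem hom_ext {F G : EnvRB k A →ₗ⁅k⁆ M} (hF : ∀ x, F (RotaBaxterLie.R (k := k) x) =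
    RotaBaxterLie.R (k := k) (F x)) (hG : ∀ x, G (RotaBaxterLie.R (k := k) x) =
    RotaBaxterLie.R (k := k) (G x)) (h : ∀ a, F (of k A a) = G (of k A a)) : F = G := by
  refine LieHom.ext fun x => ?_
  induction x using induction with
  | hof a => exact h a
  | hzero => simp
  | hadd x y hx hy => simp [hx, hy]
  | hsmul c x hx => simp [hx]
  | hlie x y hx hy => simp [hx, hy]
  | hR x hx => rw [hF, hG, hx]

end EnvRB

end Universal

/-! ### The structure of the universal enveloping Rota-Baxter Lie algebra -/

section Extension

variable {k : Type*} [Field k]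

/-- The Rota-Baxter operator on `L × E` given by a homomorphism from the sub-adjacent Lie algebra
of `L` to `E`. -/
abbrev RotaBaxterLie.prod {L E : Type*} [LieRing L] [LieAlgebra k L] [RotaBaxterLie k L]
    [LieRing E] [LieAlgebra k E] (ρ : SubAdj k L →ₗ⁅k⁆ E) : RotaBaxterLie k (L × E) where
  R := (RotaBaxterLie.R.prod ((ρ : SubAdj k L →ₗ[k] E) ∘ₗ (SubAdj.of k L).toLinearMap)) ∘ₗ
    LinearMap.fst k L E
  -- The second coordinate of the identity says precisely that `ρ` respects the sub-adjacent
  -- bracket.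
  lie_R x y := by
    have h1 := RotaBaxterLie.lie_R (k := k) x.1 y.1
    have h2 := ρ.map_lie (SubAdj.of k L x.1) (SubAdj.of k L y.1)
    refine Prod.ext h1 (h2.symm.trans ?_)
    change ρ (SubAdj.of k L (subBracket k L x.1 y.1)) = ρ (SubAdj.of k L _)
    rw [subBracket_apply, tri_apply, tri_apply, ← lie_skew y.1]
    congr 2
    change _ = ⁅RotaBaxterLie.R (k := k) x.1, y.1⁆ + ⁅x.1, RotaBaxterLie.R (k := k) y.1⁆ +
      ⁅x.1, y.1⁆
    abel

variable {A : Type*} [LieRing A] [LieAlgebra k A] [PostLieAlgebra k A]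

/-- The homomorphism Ω may be prescribed on A and, separately, on the image of R; the only
compatibility comes from a ◁ b = [a, R b]. The product of U with E carries the operator (x, e) ↦ (R
x, ρ x), and Ω is the second coordinate of the induced map, whose first coordinate is the identity
by uniqueness. -/
theorem EnvRB.exists_extension {E : Type*} [LieRing E] [LieAlgebra k E] (ρA : A →ₗ⁅k⁆ E)
    (ρ : SubAdj k (EnvRB k A) →ₗ⁅k⁆ E)
    (h : ∀ a b, ρA (PostLieAlgebra.tri (k := k) a b) =
      ⁅ρA a, ρ (SubAdj.of k (EnvRB k A) (of k A b))⁆) :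
    ∃ Ω : EnvRB k A →ₗ⁅k⁆ E, (∀ a, Ω (of k A a) = ρA a) ∧
      ∀ x, Ω (RotaBaxterLie.R (k := k) x) = ρ (SubAdj.of k (EnvRB k A) x) := by
  let _ := RotaBaxterLie.prod ρ
  set F : EnvRB k A →ₗ⁅k⁆ EnvRB k A × E := lift ((of k A).prod ρA)
    (fun a b => Prod.ext (of_tri a b) (h a b)) with hF
  have h1 : (LieHom.fst k (EnvRB k A) E).comp F = LieHom.id :=
    hom_ext (fun x => by
      rw [LieHom.comp_apply, hF, lift_R]
      rfl) (fun x => rfl) (fun a => rfl)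
  refine ⟨(LieHom.snd k (EnvRB k A) E).comp F, fun a => rfl, fun x => ?_⟩
  rw [LieHom.comp_apply, hF, lift_R, ← hF]
  change ρ (SubAdj.of k (EnvRB k A) ((LieHom.fst k (EnvRB k A) E).comp F x)) = _
  rw [h1, LieHom.id_apply]

end Extension

/-! ### The retraction onto the post-Lie algebra and its kernel -/

section Retraction

variable (k A : Type*) [Field k] [LieRing A] [LieAlgebra k A] [PostLieAlgebra k A]

/-- The extension of the sub-adjacent Lie algebra of a post-Lie algebra `A` by `A`. -/
@[nolint unusedArguments]
def PostLieExt (_ : Type*) (A : Type*) := A × A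

instance : AddCommGroup (PostLieExt k A) := inferInstanceAs (AddCommGroup (A × A))

instance : Module k (PostLieExt k A) := inferInstanceAs (Module k (A × A))

/-- A semidirect product: the second factor carries the sub-adjacent bracket and acts on the first
by the derivations a ↦ −(a ◁ a'). -/
instance : LieRing (PostLieExt k A) where
  bracket p q := ((⁅p.1, q.1⁆ + PostLieAlgebra.tri (k := k) p.1 q.2 -
    PostLieAlgebra.tri (k := k) q.1 p.2, subBracket k A p.2 q.2) : A × A)
  add_lie := by
    rintro ⟨a, a'⟩ ⟨b, b'⟩ ⟨c, c'⟩
    refine Prod.ext ?_ ?_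
    · change ⁅a + b, c⁆ + PostLieAlgebra.tri (k := k) (a + b) c' -
        PostLieAlgebra.tri (k := k) c (a' + b') = (_ + _ - _) + (_ + _ - _)
      simp only [add_lie, map_add, LinearMap.add_apply]
      abel
    · exact LinearMap.map_add₂ (subBracket k A) a' b' c'
  lie_add := by
    rintro ⟨a, a'⟩ ⟨b, b'⟩ ⟨c, c'⟩
    refine Prod.ext ?_ ?_
    · change ⁅a, b + c⁆ + PostLieAlgebra.tri (k := k) a (b' + c') -
        PostLieAlgebra.tri (k := k) (b + c) a' = (_ + _ - _) + (_ + _ - _)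
      simp only [lie_add, map_add, LinearMap.add_apply]
      abel
    · exact map_add (subBracket k A a') b' c'
  lie_self := by
    rintro ⟨a, a'⟩
    refine Prod.ext ?_ (lie_self (SubAdj.of k A a'))
    change ⁅a, a⁆ + PostLieAlgebra.tri (k := k) a a' - PostLieAlgebra.tri (k := k) a a' = 0
    simp
  leibniz_lie := by
    rintro ⟨a, a'⟩ ⟨b, b'⟩ ⟨c, c'⟩
    refine Prod.ext ?_ (leibniz_lie (SubAdj.of k A a') (SubAdj.of k A b') (SubAdj.of k A c'))
    change ⁅a, ⁅b, c⁆ + PostLieAlgebra.tri (k := k) b c' - PostLieAlgebra.tri (k := k) c b'⁆ +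
        PostLieAlgebra.tri (k := k) a (subBracket k A b' c') - PostLieAlgebra.tri (k := k)
          (⁅b, c⁆ + PostLieAlgebra.tri (k := k) b c' - PostLieAlgebra.tri (k := k) c b') a' =
      (⁅⁅a, b⁆ + PostLieAlgebra.tri (k := k) a b' - PostLieAlgebra.tri (k := k) b a', c⁆ +
        PostLieAlgebra.tri (k := k) (⁅a, b⁆ + PostLieAlgebra.tri (k := k) a b' -
          PostLieAlgebra.tri (k := k) b a') c' -
        PostLieAlgebra.tri (k := k) c (subBracket k A a' b')) +
      (⁅b, ⁅a, c⁆ + PostLieAlgebra.tri (k := k) a c' - PostLieAlgebra.tri (k := k) c a'⁆ +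
        PostLieAlgebra.tri (k := k) b (subBracket k A a' c') - PostLieAlgebra.tri (k := k)
          (⁅a, c⁆ + PostLieAlgebra.tri (k := k) a c' - PostLieAlgebra.tri (k := k) c a') b')
    simp only [tri_subBracket, map_add, map_sub, LinearMap.add_apply, LinearMap.sub_apply,
      PostLieAlgebra.lie_tri, lie_add, lie_sub, add_lie, sub_lie, leibniz_lie a b c]
    rw [← lie_skew b (PostLieAlgebra.tri (k := k) a c')]
    abel

instance : LieAlgebra k (PostLieExt k A) where
  lie_smul := by
    rintro c ⟨a, a'⟩ ⟨b, b'⟩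
    refine Prod.ext ?_ (map_smul (subBracket k A a') c b')
    change ⁅a, c • b⁆ + PostLieAlgebra.tri (k := k) a (c • b') -
        PostLieAlgebra.tri (k := k) (c • b) a' = c • (_ + _ - _)
    simp only [lie_smul, map_smul, LinearMap.smul_apply, smul_add, smul_sub]

/-- The second factor and the diagonal are complementary subalgebras, and −R is the projection onto
the former along the latter; such a splitting always gives an operator of weight one. Moreover R(a,
0) = (0, a), so that [(a, 0), R(b, 0)] is a ◁ b, as the universal property needs. -/
instance : RotaBaxterLie k (PostLieExt k A) where
  R := LinearMap.inr k A A ∘ₗ (LinearMap.fst k A A - LinearMap.snd k A A)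
  lie_R := by
    rintro ⟨a, a'⟩ ⟨b, b'⟩
    refine Prod.ext ?_ ?_
    · change ⁅(0 : A), (0 : A)⁆ + PostLieAlgebra.tri (k := k) (0 : A) (b - b') -
        PostLieAlgebra.tri (k := k) (0 : A) (a - a') = 0
      simp
    · change subBracket k A (a - a') (b - b') =
        ((⁅(0 : A), b⁆ + PostLieAlgebra.tri (k := k) (0 : A) b' -
          PostLieAlgebra.tri (k := k) b (a - a')) +
        (⁅a, (0 : A)⁆ + PostLieAlgebra.tri (k := k) a (b - b') -
          PostLieAlgebra.tri (k := k) (0 : A) a') +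
        (⁅a, b⁆ + PostLieAlgebra.tri (k := k) a b' - PostLieAlgebra.tri (k := k) b a')) -
        (subBracket k A (a - a') b' + subBracket k A a' (b - b') + subBracket k A a' b')
      have h := subBracket_apply (k := k) a b
      simp only [zero_lie, lie_zero, map_zero, LinearMap.zero_apply, map_sub,
        LinearMap.sub_apply, h]
      abel

namespace EnvRB

/-- The homomorphism defining the retraction onto the post-Lie algebra. -/
def toExt : EnvRB k A →ₗ⁅k⁆ PostLieExt k A :=
  lift
    { toLinearMap := LinearMap.inl k A A
      map_lie' := fun {a b} => by
        refine Prod.ext ?_ (map_zero (subBracket k A 0)).symm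
        change ⁅a, b⁆ = ⁅a, b⁆ + PostLieAlgebra.tri (k := k) a (0 : A) -
          PostLieAlgebra.tri (k := k) b (0 : A)
        simp }
    (fun a b => by
      refine Prod.ext ?_ (LinearMap.map_zero₂ (subBracket k A) _).symm
      change PostLieAlgebra.tri (k := k) a b = ⁅a, (0 : A)⁆ + PostLieAlgebra.tri (k := k) a (b - 0) -
          PostLieAlgebra.tri (k := k) (0 : A) (0 : A)
      simp)

/-- The retraction onto the post-Lie algebra. -/
def ret : EnvRB k A →ₗ[k] A := LinearMap.fst k A A ∘ₗ (toExt k A : EnvRB k A →ₗ[k] PostLieExt k A)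

variable {k A}

@[simp] theorem ret_of (a : A) : ret k A (of k A a) = a := rfl

/-- In the extension the first coordinate of the sub-adjacent bracket involves only the first
coordinates of the arguments: the other terms cancel. The original bracket does not have this
property, which is why the kernel is taken in the sub-adjacent Lie algebra. -/
theorem ret_subBracket (x y : EnvRB k A) : ret k A (subBracket k (EnvRB k A) x y) =
    subBracket k A (ret k A x) (ret k A y) := by
  have h1 : ∀ z, toExt k A (RotaBaxterLie.R (k := k) z) = RotaBaxterLie.R (k := k) (toExt k A z) :=
    lift_R _ _
  have h2 : toExt k A (subBracket k (EnvRB k A) x y) =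
      subBracket k (PostLieExt k A) (toExt k A x) (toExt k A y) := by
    simp only [subBracket_apply, RotaBaxterLie.tri_apply, map_add, map_sub, LieHom.map_lie, h1]
  refine (congrArg Prod.fst h2).trans ?_
  change _ = subBracket k A (toExt k A x).1 (toExt k A y).1
  generalize toExt k A x = p
  generalize toExt k A y = q
  obtain ⟨a, a'⟩ := p
  obtain ⟨b, b'⟩ := q
  change (⁅a, (0 : A)⁆ + PostLieAlgebra.tri (k := k) a (b - b') - PostLieAlgebra.tri (k := k) 0 a') -
    (⁅b, (0 : A)⁆ + PostLieAlgebra.tri (k := k) b (a - a') - PostLieAlgebra.tri (k := k) 0 b') +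
    (⁅a, b⁆ + PostLieAlgebra.tri (k := k) a b' - PostLieAlgebra.tri (k := k) b a') =
    subBracket k A a b
  simp only [subBracket_apply, lie_zero, map_zero, LinearMap.zero_apply, map_sub]
  abel

variable (k A) in
/-- The retraction as a homomorphism of sub-adjacent Lie algebras. -/
def retHom : SubAdj k (EnvRB k A) →ₗ⁅k⁆ SubAdj k A where
  toLinearMap := ret k A
  map_lie' {x y} := ret_subBracket (k := k) (A := A) x y

variable (k A) in
/-- The kernel of the retraction. -/
def augIdeal : LieIdeal k (SubAdj k (EnvRB k A)) := (retHom k A).ker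

variable (k A) in
/-- The kernel of the retraction, as a Lie algebra. -/
def Aug := augIdeal k A

instance : LieRing (Aug k A) := inferInstanceAs (LieRing (augIdeal k A))

instance : LieAlgebra k (Aug k A) := inferInstanceAs (LieAlgebra k (augIdeal k A))

variable (k A) in
/-- The inclusion of the kernel of the retraction. -/
def augIncl : Aug k A →ₗ[k] EnvRB k A :=
  (SubAdj.of k (EnvRB k A)).symm.toLinearMap ∘ₗ (augIdeal k A).incl.toLinearMap

theorem augIncl_injective : Function.Injective (augIncl k A) := fun _ _ h => Subtype.ext h

theorem augIncl_lie (c c' : Aug k A) : augIncl k A ⁅c, c'⁆ =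
    subBracket k (EnvRB k A) (augIncl k A c) (augIncl k A c') := rfl

@[simp] theorem ret_augIncl (c : Aug k A) : ret k A (augIncl k A c) = 0 :=
  LieHom.mem_ker.1 c.2

variable (k A) in
/-- The projection to the kernel of the retraction. -/
def augProj : EnvRB k A →ₗ[k] Aug k A :=
  LinearMap.codRestrict (augIdeal k A).toSubmodule
    ((SubAdj.of k (EnvRB k A)).toLinearMap ∘ₗ
      (LinearMap.id - (of k A : A →ₗ[k] EnvRB k A) ∘ₗ ret k A)) (fun x => LieHom.mem_ker.2 <| by
        change ret k A (x - of k A (ret k A x)) = 0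
        rw [map_sub, ret_of, sub_self])

theorem augIncl_augProj (x : EnvRB k A) :
    augIncl k A (augProj k A x) = x - of k A (ret k A x) := rfl

@[simp] theorem augProj_augIncl (c : Aug k A) : augProj k A (augIncl k A c) = c := by
  refine augIncl_injective ?_
  rw [augIncl_augProj, ret_augIncl, map_zero, sub_zero]

@[simp] theorem augProj_of (a : A) : augProj k A (of k A a) = 0 := by
  refine augIncl_injective ?_
  rw [augIncl_augProj, ret_of, sub_self, map_zero]

variable (k A) in
/-- The Rota-Baxter operator on the kernel of the retraction. -/
def augR : Aug k A →ₗ[k] EnvRB k A := RotaBaxterLie.R ∘ₗ augIncl k A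

theorem augR_apply (c : Aug k A) : augR k A c = RotaBaxterLie.R (k := k) (augIncl k A c) := rfl

theorem augR_lie (c c' : Aug k A) : augR k A ⁅c, c'⁆ = ⁅augR k A c, augR k A c'⁆ := by
  rw [augR_apply, augIncl_lie, RotaBaxterLie.R_subBracket]
  rfl

variable (k A) in
/-- The values of mixed commutators. -/
def mixedValue : TensorAlgebra k (TensorAlgebra k A ⊗[k] TensorAlgebra k (Aug k A)) →ₗ[k]
    EnvRB k A :=
  lieValue (theta (of k A : A →ₗ[k] EnvRB k A) (augR k A))

variable (k A) in
/-- The parametrization of the kernel of the retraction. -/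
def augParam : (A × Aug k A × mixedLie k A (Aug k A)) →ₗ[k] Aug k A :=
  augProj k A ∘ₗ LinearMap.coprod (RotaBaxterLie.R ∘ₗ (of k A : A →ₗ[k] EnvRB k A))
    (LinearMap.coprod (augR k A)
      (mixedValue k A ∘ₗ (mixedLie k A (Aug k A)).toSubmodule.subtype))

theorem augParam_apply (b : A) (c : Aug k A) (x : mixedLie k A (Aug k A)) :
    augParam k A (b, c, x) = augProj k A (RotaBaxterLie.R (k := k) (of k A b) +
      (augR k A c + mixedValue k A x)) := rfl

end EnvRB

end Retraction

/-! ### Detecting the Rota–Baxter summand -/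

section Injectivity

variable {k A : Type*} [Field k] [LieRing A] [LieAlgebra k A] [PostLieAlgebra k A]

namespace EnvRB

theorem lieValue_theta_zero [CharZero k] {V Z J : Type*} [AddCommGroup V] [Module k V]
    [AddCommGroup Z] [Module k Z] [LieRing J] [LieAlgebra k J] (h : Z →ₗ[k] J)
    (x : TensorAlgebra k (TensorAlgebra k V ⊗[k] TensorAlgebra k Z)) :
    lieValue (theta (0 : V →ₗ[k] J) h) x = 0 := by
  have : theta (0 : V →ₗ[k] J) h = 0 := by
    refine TensorProduct.ext' fun s t => ?_
    rw [theta_tmul, LinearMap.comp_zero, map_zero, LinearMap.zero_apply, LinearMap.zero_apply]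
  rw [this, lieValue, LinearMap.comp_apply, map_zero, LinearMap.zero_apply]

theorem map_mixedValue [CharZero k] {E : Type*} [LieRing E] [LieAlgebra k E]
    (Ω : EnvRB k A →ₗ⁅k⁆ E) (x : mixedLie k A (Aug k A)) : Ω (mixedValue k A x) =
      lieValue (theta ((Ω : EnvRB k A →ₗ[k] E) ∘ₗ (of k A : A →ₗ[k] EnvRB k A))
        ((Ω : EnvRB k A →ₗ[k] E) ∘ₗ augR k A)) x := by
  refine (lieValue_comp _ Ω (mixedLie_le x.2)).trans ?_
  congr 2
  exact LinearMap.ext fun w => theta_comp _ _ Ω w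

/-- Let Ω kill A and send R(y) to y in the sub-adjacent Lie algebra; the compatibility reads 0 = 0.
A mixed commutator has an entry from A, so it dies, and y remains. -/
theorem eq_zero_of_R_mem [CharZero k] {y : EnvRB k A} {x : mixedLie k A (Aug k A)} {a : A}
    (h : RotaBaxterLie.R (k := k) y + mixedValue k A x = of k A a) : y = 0 := by
  obtain ⟨Ω, hA, hR⟩ := exists_extension (k := k) (A := A) (E := SubAdj k (EnvRB k A)) 0 LieHom.id
    (fun a b => by simp)
  have h1 := congrArg Ω h
  rw [map_add, hA, hR, map_mixedValue] at h1
  have h2 : (Ω : EnvRB k A →ₗ[k] SubAdj k (EnvRB k A)) ∘ₗ (of k A : A →ₗ[k] EnvRB k A) = 0 :=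
    LinearMap.ext hA
  rw [h2, lieValue_theta_zero, add_zero] at h1
  exact h1

end EnvRB

end Injectivity

/-! ### Injectivity of the parametrization -/

section CoprodAction

variable {k : Type*} [Field k] {g h b : Type*} [LieRing g] [LieAlgebra k g] [LieRing h]
  [LieAlgebra k h] [LieRing b] [LieAlgebra k b]

/-- An action of a Lie algebra by derivations of two Lie algebras extends to the coproduct of the
enveloping algebras. -/
theorem EnvCoprod.exists_derivation_action (d : b →ₗ⁅k⁆ Module.End k g)
    (d' : b →ₗ⁅k⁆ Module.End k h) (hd : ∀ z x y, d z ⁅x, y⁆ = ⁅d z x, y⁆ + ⁅x, d z y⁆)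
    (hd' : ∀ z x y, d' z ⁅x, y⁆ = ⁅d' z x, y⁆ + ⁅x, d' z y⁆) :
    ∃ D : b →ₗ⁅k⁆ Module.End k (EnvCoprod k g h),
      (∀ z x y, D z (x * y) = D z x * y + x * D z y) ∧
      (∀ z x, D z (inl k g h x) = inl k g h (d z x)) ∧
      ∀ z x, D z (inr k g h x) = inr k g h (d' z x) := by
  choose D h1 h2 h3 using fun z => exists_derivation (k := k) (d z) (d' z) (hd z) (hd' z)
  have ext : ∀ {F F' : EnvCoprod k g h →ₗ[k] EnvCoprod k g h},
      (∀ x y, F (x * y) = F x * y + x * F y) → (∀ x y, F' (x * y) = F' x * y + x * F' y) →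
      (∀ x, F (inl k g h x) = F' (inl k g h x)) → (∀ x, F (inr k g h x) = F' (inr k g h x)) →
      F = F' := fun hF hF' => derivation_ext (φ := AlgHom.id k _) hF hF'
  have hadd : ∀ z z', D (z + z') = D z + D z' := fun z z' => by
    refine ext (h1 _) (fun x y => ?_) (fun x => ?_) (fun x => ?_)
    · simp only [LinearMap.add_apply, h1, add_mul, mul_add]
      abel
    · simp [h2]
    · simp [h3]
  have hsmul : ∀ (c : k) z, D (c • z) = c • D z := fun c z => by
    refine ext (h1 _) (fun x y => ?_) (fun x => ?_) (fun x => ?_)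
    · simp [h1]
    · simp [h2]
    · simp [h3]
  have hlie : ∀ z z', D ⁅z, z'⁆ = ⁅D z, D z'⁆ := fun z z' => by
    refine ext (h1 _) (fun x y => ?_) (fun x => ?_) (fun x => ?_)
    · change D z (D z' (x * y)) - D z' (D z (x * y)) = (D z (D z' x) - D z' (D z x)) * y +
        x * (D z (D z' y) - D z' (D z y))
      simp only [h1, map_add, sub_mul, mul_sub]
      abel
    · change _ = (D z (D z' _) - D z' (D z _))
      simp [LieRing.of_associative_ring_bracket, h2]
    · change _ = (D z (D z' _) - D z' (D z _))
      simp [LieRing.of_associative_ring_bracket, h3]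
  exact ⟨{ toFun := D, map_add' := hadd, map_smul' := hsmul, map_lie' := hlie _ _ }, h1, h2, h3⟩

/-- The section `s` splits `S` as the kernel of `r` extended by `b`. The kernel acts by left
multiplication through `inr`, and `b` by the derivations extending `d` on `g` and the adjoint action
on the kernel. -/
theorem EnvCoprod.exists_semidirect_action {S : Type*} [LieRing S] [LieAlgebra k S]
    (r : S →ₗ⁅k⁆ b) (s : b →ₗ⁅k⁆ S) (hrs : ∀ z, r (s z) = z) (d : b →ₗ⁅k⁆ Module.End k g)
    (hd : ∀ z x y, d z ⁅x, y⁆ = ⁅d z x, y⁆ + ⁅x, d z y⁆) :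
    ∃ ρ : S →ₗ⁅k⁆ Module.End k (EnvCoprod k g r.ker),
      (∀ x z, ⁅Algebra.lmul k (EnvCoprod k g r.ker) (inl k g r.ker x), ρ (s z)⁆ =
        -Algebra.lmul k (EnvCoprod k g r.ker) (inl k g r.ker (d z x))) ∧
      ∀ c : r.ker, ρ c = Algebra.lmul k (EnvCoprod k g r.ker) (inr k g r.ker c) := by
  set d' : b →ₗ⁅k⁆ Module.End k r.ker := (LieModule.toEnd k S r.ker).comp s with hd'
  obtain ⟨D, h1, h2, h3⟩ := EnvCoprod.exists_derivation_action (k := k) d d' hd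
    (fun z x y => Subtype.ext (leibniz_lie (s z) x.1 y.1))
  set L : EnvCoprod k g r.ker →ₗ⁅k⁆ Module.End k (EnvCoprod k g r.ker) :=
    AlgHom.toLieHom (Algebra.lmul k _) with hL
  have hDL : ∀ z p, ⁅D z, L p⁆ = L (D z p) := fun z p => by
    refine LinearMap.ext fun y => ?_
    change D z (p * y) - p * D z y = D z p * y
    rw [h1, add_sub_cancel_right]
  let pr : S →ₗ[k] r.ker := LinearMap.codRestrict r.ker.toSubmodule
    (LinearMap.id - (s : b →ₗ[k] S) ∘ₗ (r : S →ₗ[k] b)) (fun x => LieHom.mem_ker.2 <| by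
      change r (x - s (r x)) = 0
      rw [map_sub, hrs, sub_self])
  have hpr : ∀ x, (pr x : S) = x - s (r x) := fun x => rfl
  have hprlie : ∀ x y, pr ⁅x, y⁆ = d' (r x) (pr y) - d' (r y) (pr x) + ⁅pr x, pr y⁆ :=
    fun x y => Subtype.ext <| by
      change (pr ⁅x, y⁆ : S) = ⁅s (r x), (pr y : S)⁆ - ⁅s (r y), (pr x : S)⁆ +
        ⁅(pr x : S), (pr y : S)⁆
      simp only [hpr, LieHom.map_lie, lie_sub, sub_lie]
      rw [← lie_skew (s (r y)) x, ← lie_skew (s (r y)) (s (r x))]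
      abel
  let ρ : S →ₗ⁅k⁆ Module.End k (EnvCoprod k g r.ker) :=
    { toLinearMap := L.toLinearMap ∘ₗ (inr k g r.ker).toLinearMap ∘ₗ pr +
        D.toLinearMap ∘ₗ r.toLinearMap
      map_lie' := fun {x y} => by
        change L (inr k g r.ker (pr ⁅x, y⁆)) + D (r ⁅x, y⁆) =
          ⁅L (inr k g r.ker (pr x)) + D (r x), L (inr k g r.ker (pr y)) + D (r y)⁆
        rw [hprlie, add_lie, lie_add, lie_add, hDL, h3, ← lie_skew _ (D (r y)), hDL, h3,
          ← LieHom.map_lie L, ← LieHom.map_lie (inr k g r.ker), ← LieHom.map_lie D,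
          ← LieHom.map_lie r, map_add, map_add, map_sub, map_sub]
        abel }
  have hρ : ∀ x, ρ x = L (inr k g r.ker (pr x)) + D (r x) := fun x => rfl
  refine ⟨ρ, fun x z => ?_, fun c => ?_⟩
  · have h4 : pr (s z) = 0 := Subtype.ext (by rw [hpr, hrs, sub_self]; rfl)
    rw [hρ, h4, map_zero, map_zero, zero_add, hrs, ← lie_skew]
    refine (congrArg Neg.neg (hDL _ _)).trans ?_
    rw [h2]
    rfl
  · have h4 : r (c : S) = 0 := LieHom.mem_ker.1 c.2
    have h5 : pr (c : S) = c := Subtype.ext (by rw [hpr, h4, map_zero, sub_zero])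
    rw [hρ, h4, h5, map_zero, add_zero]
    rfl

/-- An algebra embeds in its endomorphisms by left multiplication, so an identity between
commutators observed on operators already holds in the algebra. -/
theorem lieValue_eq_of_lmul [CharZero k] {V Z J P : Type*} [AddCommGroup V] [Module k V]
    [AddCommGroup Z] [Module k Z] [LieRing J] [LieAlgebra k J] [Ring P] [Algebra k P]
    {f : V →ₗ[k] J} {h : Z →ₗ[k] J} (i : V →ₗ[k] P) (j : Z →ₗ[k] P)
    (Ω : J →ₗ⁅k⁆ Module.End k P) (hf : ∀ v, Ω (f v) = LinearMap.mul k P (i v))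
    (hh : ∀ z, Ω (h z) = LinearMap.mul k P (j z))
    {x : TensorAlgebra k (TensorAlgebra k V ⊗[k] TensorAlgebra k Z)} (hx : x ∈ mixedLie k V Z)
    {a : V} (hxa : lieValue (theta f h) x = f a) : lieValue (theta i j) x = i a := by
  refine Algebra.lmul_injective (R := k) (Eq.trans ?_ ((congrArg Ω hxa).trans (hf a)))
  refine (lieValue_comp _ (AlgHom.toLieHom (Algebra.lmul k P)) (mixedLie_le hx)).trans
    (Eq.trans ?_ (lieValue_comp _ Ω (mixedLie_le hx)).symm)
  congr 2
  refine LinearMap.ext fun w => (theta_comp _ _ (AlgHom.toLieHom (Algebra.lmul k P)) w).trans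
    (Eq.trans ?_ (theta_comp _ _ Ω w).symm)
  congr 2
  · exact LinearMap.ext fun v => (hf v).symm
  · exact LinearMap.ext fun z => (hh z).symm

end CoprodAction

/-! ### Detecting mixed commutators -/

section Injectivity

variable {k A : Type*} [Field k] [LieRing A] [LieAlgebra k A] [PostLieAlgebra k A]

variable (k A) in
/-- The action of the sub-adjacent Lie algebra of a post-Lie algebra by derivations. -/
def triAction : SubAdj k A →ₗ⁅k⁆ Module.End k A where
  toLinearMap := -(PostLieAlgebra.tri (k := k) (A := A)).flip
  map_lie' {a b} := by
    have h : ∀ a b : A, -(PostLieAlgebra.tri (k := k) (A := A)).flip (subBracket k A a b) =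
        ⁅-(PostLieAlgebra.tri (k := k) (A := A)).flip a,
          -(PostLieAlgebra.tri (k := k) (A := A)).flip b⁆ := fun a b => by
      refine LinearMap.ext fun x => ?_
      simp only [LieRing.of_associative_ring_bracket, LinearMap.sub_apply, Module.End.mul_apply,
        LinearMap.neg_apply, LinearMap.flip_apply, tri_subBracket, map_neg]
      abel
    exact h a b

theorem triAction_apply (a x : A) : triAction k A (SubAdj.of k A a) x =
    -PostLieAlgebra.tri (k := k) x a := rfl

theorem triAction_lie (z : SubAdj k A) (x y : A) :
    triAction k A z ⁅x, y⁆ = ⁅triAction k A z x, y⁆ + ⁅x, triAction k A z y⁆ := by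
  obtain ⟨a, rfl⟩ := (SubAdj.of k A).surjective z
  rw [triAction_apply, triAction_apply, triAction_apply, PostLieAlgebra.lie_tri, neg_lie, lie_neg,
    neg_add]

namespace EnvRB

variable (k A) in
/-- The inclusion of a post-Lie algebra as a homomorphism of sub-adjacent Lie algebras. -/
def subOf : SubAdj k A →ₗ⁅k⁆ SubAdj k (EnvRB k A) := SubAdj.map (of k A) of_tri

theorem exists_augAction : ∃ ρ : SubAdj k (EnvRB k A) →ₗ⁅k⁆
      Module.End k (EnvCoprod k A (Aug k A)),
    (∀ a b, LinearMap.mul k (EnvCoprod k A (Aug k A))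
        (EnvCoprod.inl k A (Aug k A) (PostLieAlgebra.tri (k := k) a b)) =
      ⁅LinearMap.mul k (EnvCoprod k A (Aug k A)) (EnvCoprod.inl k A (Aug k A) a),
        ρ (SubAdj.of k (EnvRB k A) (of k A b))⁆) ∧
    ∀ c, ρ (SubAdj.of k (EnvRB k A) (augIncl k A c)) =
      LinearMap.mul k (EnvCoprod k A (Aug k A)) (EnvCoprod.inr k A (Aug k A) c) := by
  obtain ⟨ρ, h1, h2⟩ := EnvCoprod.exists_semidirect_action (k := k) (retHom k A) (subOf k A)
    (fun z => ret_of (k := k) (A := A) z) (triAction k A) (triAction_lie (k := k) (A := A))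
  refine ⟨ρ, fun a b => Eq.symm ((h1 a (SubAdj.of k A b)).trans ?_), h2⟩
  rw [triAction_apply, map_neg, map_neg, neg_neg]
  rfl

/-- Here Ω sends a to left multiplication by `inl a` and R(c) to left multiplication by `inr c`; the
operators of the remaining part R(A) are derivations chosen to respect ◁. The equation becomes one
in the coproduct of the enveloping algebras, settled by `lieValue_inl_inr_injective`. -/
theorem mixedValue_injective [CharZero k] {x : mixedLie k A (Aug k A)} {a : A}
    (h : mixedValue k A x = of k A a) : x = 0 := by
  obtain ⟨ρ, h1, h2⟩ := exists_augAction (k := k) (A := A)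
  obtain ⟨Ω, hA, hR⟩ := exists_extension (k := k) (A := A)
    ((AlgHom.toLieHom (Algebra.lmul k (EnvCoprod k A (Aug k A)))).comp
      (EnvCoprod.inl k A (Aug k A))) ρ h1
  have h3 := lieValue_eq_of_lmul (EnvCoprod.inl k A (Aug k A)).toLinearMap
    (EnvCoprod.inr k A (Aug k A)).toLinearMap Ω hA
    (fun c => (hR (augIncl k A c)).trans (h2 c)) x.2 h
  exact Subtype.ext (lieValue_inl_inr_injective x.2 a h3)

theorem eq_of_augProj_eq_zero {y : EnvRB k A} (hy : augProj k A y = 0) :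
    y = of k A (ret k A y) :=
  sub_eq_zero.1 ((augIncl_augProj y).symm.trans ((congrArg (augIncl k A) hy).trans
    (augIncl k A).map_zero))

/-- The kernel of the projection is A, so vanishing means R(b + c) + (mixed) = a. First the argument
b + c must vanish, and it has components b and c; then so does the mixed part. -/
theorem eq_zero_of_augParam_eq_zero [CharZero k] {b : A} {c : Aug k A}
    {x : mixedLie k A (Aug k A)} (h : augParam k A (b, c, x) = 0) :
    b = 0 ∧ c = 0 ∧ x = 0 := by
  obtain ⟨a, h1⟩ : ∃ a, RotaBaxterLie.R (k := k) (of k A b + augIncl k A c) + mixedValue k A x =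
      of k A a := by
    rw [(RotaBaxterLie.R (k := k) (L := EnvRB k A)).map_add, add_assoc]
    exact ⟨_, eq_of_augProj_eq_zero h⟩
  have h2 := eq_zero_of_R_mem h1
  rw [h2, (RotaBaxterLie.R (k := k) (L := EnvRB k A)).map_zero, zero_add] at h1
  have h3 : ret k A (of k A b + augIncl k A c) = b := by
    rw [(ret k A).map_add, ret_of, ret_augIncl, add_zero]
  have h4 : augProj k A (of k A b + augIncl k A c) = c := by
    rw [(augProj k A).map_add, augProj_of, augProj_augIncl, zero_add]
  rw [h2] at h3 h4
  exact ⟨h3.symm.trans (ret k A).map_zero, h4.symm.trans (augProj k A).map_zero,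
    mixedValue_injective h1⟩

theorem augParam_injective [CharZero k] : Function.Injective (augParam k A) :=
  LinearMap.ker_eq_bot.1 ((Submodule.eq_bot_iff _).2 fun p h => by
    obtain ⟨h1, h2, h3⟩ := eq_zero_of_augParam_eq_zero (LinearMap.mem_ker.1 h)
    exact Prod.ext h1 (Prod.ext h2 h3))

end EnvRB

end Injectivity

/-! ### Symmetrization of mixed commutators -/

section Symmetrization

variable {k : Type*} [Field k] {V Z J : Type*} [LieRing V] [LieAlgebra k V] [LieRing Z]
  [LieAlgebra k Z] [LieRing J] [LieAlgebra k J] (f : V →ₗ⁅k⁆ J) (h : Z →ₗ⁅k⁆ J)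

theorem algebraMapInv_word_of_ne_nil {W : Type*} [AddCommGroup W] [Module k W] {l : List W}
    (hl : l ≠ []) : TensorAlgebra.algebraMapInv (word (k := k) l) = 0 := by
  cases l with
  | nil => exact absurd rfl hl
  | cons w l => simp [TensorAlgebra.algebraMapInv]

theorem theta_word_append (l : List V) (v : V) (t : TensorAlgebra k Z) :
    theta (f : V →ₗ[k] J) (h : Z →ₗ[k] J) (word (l ++ [v]) ⊗ₜ t) =
      adAction (f : V →ₗ[k] J) (word l) (adAction (h : Z →ₗ[k] J) t (f v)) := by
  induction l with
  | nil =>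
    rw [List.nil_append, word_cons, word_nil, theta_ι_mul, theta_one]
    simp
  | cons w l ih =>
    rw [List.cons_append, word_cons, theta_ι_mul, ih, algebraMapInv_word_of_ne_nil (by simp),
      zero_smul, add_zero, word_cons, map_mul, Module.End.mul_apply, adAction_ι]

theorem adAction_word_swap (l₁ : List V) (x y : V) (l₂ : List V) (m : J) :
    adAction (f : V →ₗ[k] J) (word (l₁ ++ x :: y :: l₂)) m -
      adAction (f : V →ₗ[k] J) (word (l₁ ++ y :: x :: l₂)) m =
      adAction (f : V →ₗ[k] J) (word (l₁ ++ ⁅x, y⁆ :: l₂)) m := by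
  simp only [word_append, word_cons, map_mul, Module.End.mul_apply, adAction_ι,
    LieHom.coe_toLinearMap]
  rw [← map_sub, LieHom.map_lie, lie_lie]

/-- The Leibniz rule distributes the letters over the two factors, peeling them off from the right.
Arbitrary subwords arise, so the hypotheses cover all words of at most the given length. -/
theorem adAction_word_lie_mem (N : LieSubalgebra k J) (l : List V) (u w : J)
    (hu : ∀ l' : List V, l'.length ≤ l.length → adAction (f : V →ₗ[k] J) (word l') u ∈ N)
    (hw : ∀ l' : List V, l'.length ≤ l.length → adAction (f : V →ₗ[k] J) (word l') w ∈ N) :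
    adAction (f : V →ₗ[k] J) (word l) ⁅u, w⁆ ∈ N := by
  induction l using List.reverseRecOn generalizing u w with
  | nil => simpa using N.lie_mem (by simpa using hu []) (by simpa using hw [])
  | append_singleton l v ih =>
    have hstep : ∀ u : J, (∀ l' : List V, l'.length ≤ (l ++ [v]).length →
        adAction (f : V →ₗ[k] J) (word l') u ∈ N) → ∀ l' : List V, l'.length ≤ l.length →
        adAction (f : V →ₗ[k] J) (word l') ⁅f v, u⁆ ∈ N := fun u hu l' hl' => by
      have := hu (l' ++ [v]) (by simpa using hl')
      rw [word_append, map_mul, Module.End.mul_apply, word_cons, word_nil, mul_one,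
        adAction_ι] at this
      exact this
    have hres : ∀ u : J, (∀ l' : List V, l'.length ≤ (l ++ [v]).length →
        adAction (f : V →ₗ[k] J) (word l') u ∈ N) → ∀ l' : List V, l'.length ≤ l.length →
        adAction (f : V →ₗ[k] J) (word l') u ∈ N :=
      fun u hu l' hl' => hu l' (hl'.trans (by simp))
    rw [word_append, map_mul, Module.End.mul_apply, word_cons, word_nil, mul_one, adAction_ι,
      LieHom.coe_toLinearMap, leibniz_lie, map_add]
    exact N.add_mem (ih _ _ (hstep u hu) (hres w hw)) (ih _ _ (hres u hu) (hstep w hw))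

theorem adAction_pow_lie (z : Z) (q : ℕ) (u w : J) :
    adAction (h : Z →ₗ[k] J) (TensorAlgebra.ι k z ^ q) ⁅u, w⁆ =
      ∑ ij ∈ Finset.HasAntidiagonal.antidiagonal q, q.choose ij.1 •
        ⁅adAction (h : Z →ₗ[k] J) (TensorAlgebra.ι k z ^ ij.1) u,
          adAction (h : Z →ₗ[k] J) (TensorAlgebra.ι k z ^ ij.2) w⁆ := by
  have key : ∀ (n : ℕ) (m : J), adAction (h : Z →ₗ[k] J) (TensorAlgebra.ι k z ^ n) m =
      (LieDerivation.ad k J (h z))^[n] m := fun n m => by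
    rw [map_pow, Module.End.pow_apply]
    congr 1
    exact funext fun m => (adAction_ι (h : Z →ₗ[k] J) z m).trans
      (LieDerivation.ad_apply_apply k J (h z) m).symm
  simp only [key]
  exact LieDerivation.iterate_apply_lie _ q u w

/-- Symmetrization in the letters from `V`, by induction on the length. Modulo `N`, a swap that
avoids the innermost letter changes the value by a shorter word; the innermost letter needs the
binomial Leibniz rule for powers of ad z. -/
theorem theta_word_pow_mem [CharZero k] (N : LieSubalgebra k J) (z : Z)
    (hN : ∀ (v : V) (p q : ℕ), theta (f : V →ₗ[k] J) (h : Z →ₗ[k] J)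
      ((TensorAlgebra.ι k v ^ (p + 1)) ⊗ₜ[k] (TensorAlgebra.ι k z ^ (q + 1))) ∈ N)
    (l : List V) (hl : l ≠ []) (q : ℕ) : theta (f : V →ₗ[k] J) (h : Z →ₗ[k] J)
      (word l ⊗ₜ[k] (TensorAlgebra.ι k z ^ (q + 1))) ∈ N := by
  induction hn : l.length using Nat.strong_induction_on generalizing l q with
  | _ n ih =>
  obtain ⟨F, hF⟩ : ∃ F : TensorAlgebra k V →ₗ[k] J ⧸ N.toSubmodule, ∀ s, F s =
      N.toSubmodule.mkQ (theta (f : V →ₗ[k] J) (h : Z →ₗ[k] J)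
        (s ⊗ₜ[k] (TensorAlgebra.ι k z ^ (q + 1)))) :=
    ⟨N.toSubmodule.mkQ ∘ₗ theta (f : V →ₗ[k] J) (h : Z →ₗ[k] J) ∘ₗ
      (TensorProduct.mk k _ _).flip (TensorAlgebra.ι k z ^ (q + 1)), fun s => rfl⟩
  refine (Submodule.Quotient.mk_eq_zero N.toSubmodule).1 ?_
  refine (hF _).symm.trans (map_word_eq_zero F ⊤ l (fun x _ => ?_) (fun _ _ => trivial)
    (fun l' hl' => eq_of_perm_of_swap (fun l => F (word l)) l (fun l₁ x y l₂ hp => ?_) hl'))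
  · obtain ⟨p, hp⟩ := Nat.exists_eq_succ_of_ne_zero (List.length_pos_iff.2 hl).ne'
    rw [hF, hp]
    exact (Submodule.Quotient.mk_eq_zero N.toSubmodule).2 (hN x p q)
  · rw [hF, hF]
    refine (Submodule.Quotient.eq N.toSubmodule).2 ?_
    have hlen := hp.length_eq
    rcases List.eq_nil_or_concat' l₂ with rfl | ⟨l₃, v, rfl⟩
    -- The difference of the two orders consists of the two extreme terms in the expansion of
    -- ad(z)^(q+1) applied to ⁅x, y⁆. The whole expansion is a shorter word, in `N` by induction.
    · have e : ∀ x y : V, l₁ ++ [x, y] = (l₁ ++ [x]) ++ [y] := fun x y => by simp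
      rw [e x y, e y x, theta_word_append, theta_word_append, word_append, word_append, map_mul,
        map_mul, Module.End.mul_apply, Module.End.mul_apply, word_cons, word_cons, word_nil,
        mul_one, mul_one, adAction_ι, adAction_ι, ← map_sub, LieHom.coe_toLinearMap]
      have h1 := ih (l₁.length + 1) (by rw [← hn, ← hlen]; simp) (l₁ ++ [⁅x, y⁆]) (by simp) q
        (by simp)
      rw [theta_word_append, LieHom.map_lie] at h1
      refine (Submodule.Quotient.mk_eq_zero N.toSubmodule).1 ?_
      refine Eq.trans ?_ ((Submodule.Quotient.mk_eq_zero N.toSubmodule).2 h1)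
      refine congrArg _ ?_ |>.trans (?_ : N.toSubmodule.mkQ (adAction (f : V →ₗ[k] J) (word l₁)
        (⁅adAction (h : Z →ₗ[k] J) (TensorAlgebra.ι k z ^ 0) (f x),
          adAction (h : Z →ₗ[k] J) (TensorAlgebra.ι k z ^ (q + 1)) (f y)⁆ +
        ⁅adAction (h : Z →ₗ[k] J) (TensorAlgebra.ι k z ^ (q + 1)) (f x),
          adAction (h : Z →ₗ[k] J) (TensorAlgebra.ι k z ^ 0) (f y)⁆)) = _)
      · congr 1
        simp only [pow_zero, map_one, Module.End.one_apply]
        rw [← lie_skew (f y), sub_eq_add_neg, neg_neg]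
      · refine Eq.trans ?_ (congrArg (fun m => N.toSubmodule.mkQ (adAction (f : V →ₗ[k] J)
          (word l₁) m)) (adAction_pow_lie h z (q + 1) (f x) (f y)).symm)
        simp only [map_sum, map_nsmul, map_add]
        refine Eq.symm ((Finset.sum_eq_add (0, q + 1) (q + 1, 0) (by simp) ?_ (by simp)
          (by simp)).trans (by simp))
        -- In the middle terms both exponents are positive, so both factors are mixed commutators
        -- and only shorter words occur in them.
        rintro ⟨i, j⟩ hij hne
        rw [Finset.HasAntidiagonal.mem_antidiagonal] at hij
        obtain ⟨i, rfl⟩ := Nat.exists_eq_succ_of_ne_zero (n := i) (by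
          rintro rfl
          exact hne.1 (by simpa using hij))
        obtain ⟨j, rfl⟩ := Nat.exists_eq_succ_of_ne_zero (n := j) (by
          rintro rfl
          exact hne.2 (by simpa using hij))
        refine (congrArg _ ((Submodule.Quotient.mk_eq_zero N.toSubmodule).2
          (adAction_word_lie_mem f N l₁ _ _ (fun l' hl' => ?_) (fun l' hl' => ?_)))).trans
          (smul_zero _)
        · rw [← theta_word_append]
          exact ih (l'.length + 1) (by rw [← hn, ← hlen]; simp; omega) _ (by simp) i (by simp)
        · rw [← theta_word_append]
          exact ih (l'.length + 1) (by rw [← hn, ← hlen]; simp; omega) _ (by simp) j (by simp)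
    · have e : ∀ x y : V, l₁ ++ x :: y :: (l₃ ++ [v]) = (l₁ ++ x :: y :: l₃) ++ [v] :=
        fun x y => by simp
      rw [e x y, e y x, theta_word_append, theta_word_append, adAction_word_swap,
        ← theta_word_append]
      exact ih _ (by rw [← hn, ← hlen]; simp) _ (by simp) q rfl

/-- The weight of an element with respect to a filtration. -/
def filWeight (G : ℕ → Submodule k Z) (z : Z) : ℕ := sInf {m | z ∈ G m}

/-- Symmetrization in the letters from `Z`. A swap replaces two letters by their bracket; since each
letter counts one more than its filtration degree, `hG` ensures that the total weight does not grow.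
The bound n + 1 forces every letter into `G n`. The hypothesis `htG` excludes letters whose
`filWeight` is the infimum of the empty set. -/
theorem theta_word_mem [CharZero k] {G : ℕ → Submodule k Z} (hmono : Monotone G)
    (hG : ∀ m n x y, x ∈ G m → y ∈ G n → ⁅x, y⁆ ∈ G (m + n + 1)) {n : ℕ} (N : LieSubalgebra k J)
    (hN : ∀ (v : V), ∀ z ∈ G n, ∀ (p q : ℕ), theta (f : V →ₗ[k] J) (h : Z →ₗ[k] J)
      ((TensorAlgebra.ι k v ^ (p + 1)) ⊗ₜ[k] (TensorAlgebra.ι k z ^ (q + 1))) ∈ N)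
    {l : List V} (hl : l ≠ []) {t : List Z} (ht : t ≠ []) (htG : ∀ z ∈ t, ∃ m, z ∈ G m)
    (hwt : (t.map fun z => filWeight G z + 1).sum ≤ n + 1) :
    theta (f : V →ₗ[k] J) (h : Z →ₗ[k] J) (word l ⊗ₜ[k] word t) ∈ N := by
  induction hn : t.length using Nat.strong_induction_on generalizing t with
  | _ r ih =>
  obtain ⟨F, hF⟩ : ∃ F : TensorAlgebra k Z →ₗ[k] J ⧸ N.toSubmodule, ∀ s, F s =
      N.toSubmodule.mkQ (theta (f : V →ₗ[k] J) (h : Z →ₗ[k] J) (word l ⊗ₜ[k] s)) :=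
    ⟨N.toSubmodule.mkQ ∘ₗ theta (f : V →ₗ[k] J) (h : Z →ₗ[k] J) ∘ₗ
      TensorProduct.mk k _ _ (word l), fun s => rfl⟩
  have hmem : ∀ z, (∃ m, z ∈ G m) → z ∈ G (filWeight G z) := fun z hz => Nat.sInf_mem hz
  refine (Submodule.Quotient.mk_eq_zero N.toSubmodule).1 ?_
  refine (hF _).symm.trans (map_word_eq_zero F (G n) t (fun x hx => ?_) (fun z hz => ?_)
    (fun l' hl' => eq_of_perm_of_swap (fun l => F (word l)) t (fun l₁ x y l₂ hp => ?_) hl'))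
  · obtain ⟨p, hp⟩ := Nat.exists_eq_succ_of_ne_zero (List.length_pos_iff.2 ht).ne'
    rw [hF, hp]
    exact (Submodule.Quotient.mk_eq_zero N.toSubmodule).2
      (theta_word_pow_mem f h N x (fun v p q => hN v x hx p q) l hl p)
  · refine hmono ?_ (hmem z (htG z hz))
    have := List.le_sum_of_mem (List.mem_map_of_mem (f := fun z => filWeight G z + 1) hz)
    omega
  · rw [hF, hF]
    refine (Submodule.Quotient.eq N.toSubmodule).2 ?_
    have hlen := hp.length_eq
    obtain ⟨l₀, v, rfl⟩ := (List.eq_nil_or_concat' l).resolve_left hl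
    rw [theta_word_append, theta_word_append, ← map_sub, adAction_word_swap, ← theta_word_append]
    have hsum := (hp.map fun z => filWeight G z + 1).sum_eq
    have hx := hmem x (htG x (hp.mem_iff.1 (by simp)))
    have hy := hmem y (htG y (hp.mem_iff.1 (by simp)))
    have hxy := hG _ _ _ _ hx hy
    have hle : filWeight G ⁅x, y⁆ ≤ filWeight G x + filWeight G y + 1 := Nat.sInf_le hxy
    refine ih _ (by rw [← hn, ← hlen]; simp) (by simp) (fun z hz => ?_) ?_ rfl
    · simp only [List.mem_append, List.mem_cons] at hz
      rcases hz with hz | rfl | hz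
      · exact htG z (hp.mem_iff.1 (by simp [hz]))
      · exact ⟨_, hxy⟩
      · exact htG z (hp.mem_iff.1 (by simp [hz]))
    · simp only [List.map_append, List.map_cons, List.sum_append, List.sum_cons] at hsum ⊢
      omega

/-- The values of mixed commutators of bounded weight. -/
inductive MixedWord (G : ℕ → Submodule k Z) : ℕ → J → Prop
  | word {n : ℕ} {l : List V} {t : List Z} (hl : l ≠ []) (ht : t ≠ []) (htG : ∀ z ∈ t, ∃ m, z ∈ G m)
      (hwt : (t.map fun z => filWeight G z + 1).sum ≤ n) :
      MixedWord G n (theta (f : V →ₗ[k] J) (h : Z →ₗ[k] J) (word l ⊗ₜ[k] word t))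
  | lie {m n : ℕ} {x y : J} : MixedWord G m x → MixedWord G n y → MixedWord G (m + n) ⁅x, y⁆
  | zero {n : ℕ} : MixedWord G n 0
  | add {n : ℕ} {x y : J} : MixedWord G n x → MixedWord G n y → MixedWord G n (x + y)
  | smul {n : ℕ} (c : k) {x : J} : MixedWord G n x → MixedWord G n (c • x)
  | mono {m n : ℕ} {x : J} : m ≤ n → MixedWord G m x → MixedWord G n x

/-- The values of iterated mixed commutators of bounded weight. -/
inductive MixedFil (G : ℕ → Submodule k Z) : ℕ → J → Prop
  | base {m : ℕ} (v : V) {z : Z} (hz : z ∈ G m) : MixedFil G (m + 1) ⁅h z, f v⁆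
  | left {n : ℕ} (v : V) {x : J} : MixedFil G n x → MixedFil G n ⁅f v, x⁆
  | right {m n : ℕ} {z : Z} (hz : z ∈ G m) {x : J} : MixedFil G n x →
      MixedFil G (m + 1 + n) ⁅h z, x⁆
  | lie {m n : ℕ} {x y : J} : MixedFil G m x → MixedFil G n y → MixedFil G (m + n) ⁅x, y⁆
  | zero {n : ℕ} : MixedFil G n 0
  | add {n : ℕ} {x y : J} : MixedFil G n x → MixedFil G n y → MixedFil G n (x + y)
  | smul {n : ℕ} (c : k) {x : J} : MixedFil G n x → MixedFil G n (c • x)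
  | mono {m n : ℕ} {x : J} : m ≤ n → MixedFil G m x → MixedFil G n x

variable {f h} {G : ℕ → Submodule k Z}

theorem MixedFil.neg {n : ℕ} {x : J} (hx : MixedFil f h G n x) : MixedFil f h G n (-x) := by
  simpa using hx.smul (-1 : k)

theorem MixedWord.left {n : ℕ} (v : V) {x : J} (hx : MixedWord f h G n x) :
    MixedWord f h G n ⁅f v, x⁆ := by
  induction hx with
  | @word n l t hl ht htG hwt =>
    have h1 := theta_ι_mul (f : V →ₗ[k] J) (h : Z →ₗ[k] J) v (RotaBaxterPBW.word l)
      (RotaBaxterPBW.word t)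
    rw [algebraMapInv_word_of_ne_nil hl, zero_smul, add_zero, ← word_cons] at h1
    have h2 : MixedWord f h G n _ := .word (l := v :: l) (by simp) ht htG hwt
    rw [h1] at h2
    exact h2
  | @lie m n x y hx hy ihx ihy =>
    rw [leibniz_lie]
    exact .add (.lie ihx hy) (.lie hx ihy)
  | zero => rw [lie_zero]; exact .zero
  | add _ _ ihx ihy => rw [lie_add]; exact .add ihx ihy
  | smul c _ ih => rw [lie_smul]; exact .smul c ih
  | mono hle _ ih => exact .mono hle ih

theorem MixedWord.base {m : ℕ} (v : V) {z : Z} (hz : z ∈ G m) :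
    MixedWord f h G (m + 1) ⁅h z, f v⁆ := by
  have hz' : filWeight G z ≤ m := Nat.sInf_le hz
  have h1 : MixedWord f h G (m + 1) _ := .word (l := [v]) (t := [z]) (by simp) (by simp)
    (by simpa using ⟨m, hz⟩) (by simpa using hz')
  rw [← List.nil_append [v], theta_word_append, word_nil, map_one, Module.End.one_apply, word_cons,
    word_nil, mul_one, adAction_ι] at h1
  exact h1

/-- The new entry from `Z` is moved inwards past the letters from `V` until it can be prepended to
`t`. Each passage leaves a bracket with a single letter of `V`, which is itself a mixed word. -/
theorem MixedWord.right {m n : ℕ} {z : Z} (hz : z ∈ G m) {x : J} (hx : MixedWord f h G n x) :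
    MixedWord f h G (m + 1 + n) ⁅h z, x⁆ := by
  induction hx with
  | @word n l t hl ht htG hwt =>
    induction l with
    | nil => exact absurd rfl hl
    | cons v l ih =>
      rcases List.eq_nil_or_concat' l with rfl | ⟨l', v', rfl⟩
      · have hz' : filWeight G z ≤ m := Nat.sInf_le hz
        have h2 : MixedWord f h G (m + 1 + n) _ := .word (l := [v]) (t := z :: t) (by simp)
          (by simp) (by
            intro z' hz'
            rcases List.mem_cons.1 hz' with rfl | hz'
            exacts [⟨m, hz⟩, htG z' hz']) (by simp only [List.map_cons, List.sum_cons]; omega)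
        rw [← List.nil_append [v], theta_word_append, word_nil, map_one, Module.End.one_apply]
          at h2 ⊢
        rw [word_cons, map_mul, Module.End.mul_apply, adAction_ι] at h2
        exact h2
      · have h1 := theta_ι_mul (f : V →ₗ[k] J) (h : Z →ₗ[k] J) v
          (RotaBaxterPBW.word (l' ++ [v'])) (RotaBaxterPBW.word t)
        rw [algebraMapInv_word_of_ne_nil (by simp), zero_smul, add_zero, ← word_cons] at h1
        rw [h1, LieHom.coe_toLinearMap, leibniz_lie]
        exact .add (.lie (.base v hz) (.word (by simp) ht htG hwt)) (.left v (ih (by simp)))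
  | @lie a b x y hx hy ihx ihy =>
    rw [leibniz_lie]
    exact .add (.mono (by omega) (.lie ihx hy)) (.mono (by omega) (.lie hx ihy))
  | zero => rw [lie_zero]; exact .zero
  | add _ _ ihx ihy => rw [lie_add]; exact .add ihx ihy
  | smul c _ ih => rw [lie_smul]; exact .smul c ih
  | mono hle _ ih => exact .mono (by omega) ih

theorem MixedFil.mixedWord {n : ℕ} {x : J} (hx : MixedFil f h G n x) : MixedWord f h G n x := by
  induction hx with
  | base v hz => exact .base v hz
  | left v _ ih => exact .left v ih
  | right hz _ ih => exact .right hz ih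
  | lie _ _ ihx ihy => exact .lie ihx ihy
  | zero => exact .zero
  | add _ _ ihx ihy => exact .add ihx ihy
  | smul c _ ih => exact .smul c ih
  | mono hle _ ih => exact .mono hle ih

/-- Commutators nested in any order are first rewritten as brackets of words, then each word is
symmetrized. The bound is n + 1 because a letter from `G n` has weight n + 1. -/
theorem MixedFil.mem [CharZero k] (hmono : Monotone G)
    (hG : ∀ m n x y, x ∈ G m → y ∈ G n → ⁅x, y⁆ ∈ G (m + n + 1)) {n r : ℕ} (N : LieSubalgebra k J)
    (hN : ∀ (v : V), ∀ z ∈ G n, ∀ (p q : ℕ), theta (f : V →ₗ[k] J) (h : Z →ₗ[k] J)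
      ((TensorAlgebra.ι k v ^ (p + 1)) ⊗ₜ[k] (TensorAlgebra.ι k z ^ (q + 1))) ∈ N)
    {x : J} (hx : MixedFil f h G r x) (hr : r ≤ n + 1) : x ∈ N := by
  have hx' := hx.mixedWord
  clear hx
  induction hx' with
  | word hl ht htG hwt => exact theta_word_mem f h hmono hG N hN hl ht htG (hwt.trans hr)
  | lie _ _ ihx ihy => exact N.lie_mem (ihx (by omega)) (ihy (by omega))
  | zero => exact N.zero_mem
  | add _ _ ihx ihy => exact N.add_mem (ihx hr) (ihy hr)
  | smul c _ ih => exact N.smul_mem c (ih hr)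
  | mono hle _ ih => exact ih (hle.trans hr)

end Symmetrization

/-! ### Surjectivity of the parametrization -/

section MixedValues

variable {k : Type*} [Field k] {V Z J : Type*} [AddCommGroup V] [Module k V] [AddCommGroup Z]
  [Module k Z] [LieRing J] [LieAlgebra k J]

variable (V) in
/-- The Lie algebra generated by the tensors `vᵖ ⊗ z^q` with `p, q ≥ 1` and `z` in a subspace. -/
def mixedLieOn (S : Submodule k Z) :
    LieSubalgebra k (TensorAlgebra k (TensorAlgebra k V ⊗[k] TensorAlgebra k Z)) :=
  LieSubalgebra.lieSpan k _ {x | ∃ (v : V) (z : Z) (p q : ℕ), z ∈ S ∧ x = TensorAlgebra.ι k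
    ((TensorAlgebra.ι k v ^ (p + 1)) ⊗ₜ[k] (TensorAlgebra.ι k z ^ (q + 1)))}

theorem mixedLieOn_le (S : Submodule k Z) : mixedLieOn V S ≤ mixedLie k V Z :=
  LieSubalgebra.lieSpan_mono fun _ ⟨v, z, p, q, _, h⟩ => ⟨v, z, p, q, h⟩

/-- The values of the mixed commutators in a subspace. -/
def mixedValues [CharZero k] (f : V →ₗ[k] J) (h : Z →ₗ[k] J) (S : Submodule k Z) :
    LieSubalgebra k J where
  toSubmodule := (mixedLieOn V S).toSubmodule.map (lieValue (theta f h))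
  lie_mem' := by
    rintro _ _ ⟨x, hx, rfl⟩ ⟨y, hy, rfl⟩
    exact ⟨⁅x, y⁆, LieSubalgebra.lie_mem _ hx hy,
      lieValue_lie _ (mixedLie_le (mixedLieOn_le S hx)) (mixedLie_le (mixedLieOn_le S hy))⟩

theorem mixedValues_theta_mem [CharZero k] (f : V →ₗ[k] J) (h : Z →ₗ[k] J) (S : Submodule k Z)
    (v : V) {z : Z} (hz : z ∈ S) (p q : ℕ) :
    theta f h ((TensorAlgebra.ι k v ^ (p + 1)) ⊗ₜ[k] (TensorAlgebra.ι k z ^ (q + 1))) ∈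
      mixedValues f h S :=
  ⟨_, LieSubalgebra.subset_lieSpan ⟨v, z, p, q, hz, rfl⟩, lieValue_ι _ _⟩

end MixedValues

/-! ### The filtration by the number of Rota–Baxter operators, and normal forms -/

section Filtration

variable {k A : Type*} [Field k] [LieRing A] [LieAlgebra k A] [PostLieAlgebra k A]

namespace EnvRB

variable (k A) in
/-- The elements that can be written with a bounded number of Rota-Baxter operators. -/
inductive IsFil : ℕ → EnvRB k A → Prop
  | of (a : A) : IsFil 0 (of k A a)
  | zero {n : ℕ} : IsFil n 0
  | add {n : ℕ} {x y : EnvRB k A} : IsFil n x → IsFil n y → IsFil n (x + y)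
  | smul {n : ℕ} (c : k) {x : EnvRB k A} : IsFil n x → IsFil n (c • x)
  | succ {n : ℕ} {x : EnvRB k A} : IsFil n x → IsFil (n + 1) x
  | lie {m n : ℕ} {x y : EnvRB k A} : IsFil m x → IsFil n y → IsFil (m + n) ⁅x, y⁆
  | R {n : ℕ} {x : EnvRB k A} : IsFil n x → IsFil (n + 1) (RotaBaxterLie.R (k := k) x)

theorem IsFil.mono {m n : ℕ} (h : m ≤ n) {x : EnvRB k A} (hx : IsFil k A m x) : IsFil k A n x :=
  Nat.le_induction hx (fun _ _ => .succ) n h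

theorem IsFil.neg {n : ℕ} {x : EnvRB k A} (hx : IsFil k A n x) : IsFil k A n (-x) := by
  simpa using hx.smul (-1 : k)

theorem IsFil.sub {n : ℕ} {x y : EnvRB k A} (hx : IsFil k A n x) (hy : IsFil k A n y) :
    IsFil k A n (x - y) := by
  rw [sub_eq_add_neg]
  exact hx.add hy.neg

theorem IsFil.subBracket {m n : ℕ} {x y : EnvRB k A} (hx : IsFil k A m x) (hy : IsFil k A n y) :
    IsFil k A (m + n + 1) (subBracket k (EnvRB k A) x y) := by
  rw [subBracket_apply, RotaBaxterLie.tri_apply, RotaBaxterLie.tri_apply]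
  exact ((hx.lie hy.R).sub ((hy.lie hx.R).mono (by omega))).add (hx.lie hy).succ

theorem IsFil.of_zero {n : ℕ} (hn : n = 0) {x : EnvRB k A} (hx : IsFil k A n x) :
    ∃ a, x = EnvRB.of k A a := by
  induction hx with
  | of a => exact ⟨a, rfl⟩
  | zero => exact ⟨0, (map_zero _).symm⟩
  | add _ _ ihx ihy =>
    obtain ⟨a, rfl⟩ := ihx hn
    obtain ⟨b, rfl⟩ := ihy hn
    exact ⟨a + b, (map_add _ _ _).symm⟩
  | smul c _ ih =>
    obtain ⟨a, rfl⟩ := ih hn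
    exact ⟨c • a, (map_smul _ _ _).symm⟩
  | succ => omega
  | lie _ _ ihx ihy =>
    obtain ⟨a, rfl⟩ := ihx (by omega)
    obtain ⟨b, rfl⟩ := ihy (by omega)
    exact ⟨⁅a, b⁆, (LieHom.map_lie _ _ _).symm⟩
  | R => omega

theorem exists_isFil (x : EnvRB k A) : ∃ n, IsFil k A n x := by
  refine EnvRB.induction (fun a => ⟨0, .of a⟩) ⟨0, .zero⟩ ?_ ?_ ?_ ?_ x
  · rintro x y ⟨m, hx⟩ ⟨n, hy⟩
    exact ⟨m + n, (hx.mono (by omega)).add (hy.mono (by omega))⟩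
  · rintro c x ⟨m, hx⟩
    exact ⟨m, hx.smul c⟩
  · rintro x y ⟨m, hx⟩ ⟨n, hy⟩
    exact ⟨m + n, hx.lie hy⟩
  · rintro x ⟨m, hx⟩
    exact ⟨m + 1, hx.R⟩

variable (k A) in
/-- The filtration of the kernel of the retraction by the number of Rota-Baxter operators. -/
def augFil (n : ℕ) : Submodule k (Aug k A) where
  carrier := {c | IsFil k A n (augIncl k A c)}
  zero_mem' := IsFil.zero
  add_mem' := IsFil.add
  smul_mem' c _ h := h.smul c

theorem mem_augFil {n : ℕ} {c : Aug k A} : c ∈ augFil k A n ↔ IsFil k A n (augIncl k A c) :=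
  Iff.rfl

theorem augFil_mono : Monotone (augFil k A) := fun _ _ h _ hc => IsFil.mono h hc

theorem augFil_lie (m n : ℕ) (c c' : Aug k A) (hc : c ∈ augFil k A m)
    (hc' : c' ∈ augFil k A n) : ⁅c, c'⁆ ∈ augFil k A (m + n + 1) :=
  mem_augFil.2 (IsFil.subBracket hc hc')

theorem augFil_zero {c : Aug k A} (hc : c ∈ augFil k A 0) : c = 0 := by
  obtain ⟨a, ha⟩ := IsFil.of_zero rfl hc
  have h := congrArg (ret k A) ha
  rw [ret_augIncl, ret_of] at h
  refine augIncl_injective ?_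
  rw [ha, ← h, map_zero (of k A), (augIncl k A).map_zero]

theorem exists_mem_augFil (c : Aug k A) : ∃ n, c ∈ augFil k A n := exists_isFil _

theorem augProj_mem {n : ℕ} {x : EnvRB k A} (hx : IsFil k A n x) : augProj k A x ∈ augFil k A n := by
  rw [mem_augFil, augIncl_augProj]
  exact hx.sub (.mono (Nat.zero_le n) (.of _))

variable (k A) in
/-- The Rota-Baxter operator as a homomorphism on the kernel of the retraction. -/
def augRHom : Aug k A →ₗ⁅k⁆ EnvRB k A where
  toLinearMap := augR k A
  map_lie' {c c'} := augR_lie c c'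

theorem augRHom_apply (c : Aug k A) :
    augRHom k A c = RotaBaxterLie.R (k := k) (augIncl k A c) := rfl

theorem R_eq (y : EnvRB k A) : RotaBaxterLie.R (k := k) y =
    RotaBaxterLie.R (k := k) (of k A (ret k A y)) + augRHom k A (augProj k A y) := by
  rw [augRHom_apply, augIncl_augProj, ← (RotaBaxterLie.R (k := k) (L := EnvRB k A)).map_add,
    add_sub_cancel]

theorem lie_R_of (a b : A) : ⁅RotaBaxterLie.R (k := k) (of k A b), of k A a⁆ =
    of k A (-PostLieAlgebra.tri (k := k) a b) := by
  rw [map_neg (of k A), of_tri, lie_skew]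

/-- R is a homomorphism on the sub-adjacent Lie algebra and the kernel of the retraction is an ideal
there. The sub-adjacent bracket uses one more Rota–Baxter operator. -/
theorem exists_lie_augRHom (b : A) {n : ℕ} {c : Aug k A} (hc : c ∈ augFil k A n) :
    ∃ c' ∈ augFil k A (n + 1),
      ⁅RotaBaxterLie.R (k := k) (of k A b), augRHom k A c⁆ = augRHom k A c' := by
  have h : IsFil k A (n + 1) (subBracket k (EnvRB k A) (of k A b) (augIncl k A c)) := by
    simpa using IsFil.subBracket (.of b) hc
  refine ⟨_, augProj_mem h, ?_⟩
  rw [augRHom_apply, augRHom_apply, augIncl_augProj, ret_subBracket, ret_augIncl,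
    (subBracket k A _).map_zero, map_zero (of k A), sub_zero, RotaBaxterLie.R_subBracket]

/-- The mixed commutators in the universal enveloping Rota-Baxter Lie algebra. -/
abbrev IsMixed (n : ℕ) (x : EnvRB k A) : Prop := MixedFil (of k A) (augRHom k A) (augFil k A) n x

/-- Bracketing with R(b) maps A to itself through ◁ and the image of the kernel under R to itself,
so by the Leibniz rule it preserves mixed commutators, at the cost of one level. -/
theorem IsMixed.lie_R_of (b : A) {n : ℕ} {x : EnvRB k A} (hx : IsMixed n x) :
    IsMixed (n + 1) ⁅RotaBaxterLie.R (k := k) (of k A b), x⁆ := by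
  induction hx with
  | base v hz =>
    obtain ⟨c, hc, h⟩ := exists_lie_augRHom b hz
    rw [leibniz_lie, h, EnvRB.lie_R_of]
    exact .add (.base _ hc) (.mono (Nat.le_succ _) (.base _ hz))
  | left v hx ih =>
    rw [leibniz_lie, EnvRB.lie_R_of]
    exact .add (.mono (Nat.le_succ _) (.left _ hx)) (.left _ ih)
  | right hz hx ih =>
    obtain ⟨c, hc, h⟩ := exists_lie_augRHom b hz
    rw [leibniz_lie, h]
    exact .add (.mono (by omega) (.right hc hx)) (.mono (by omega) (.right hz ih))
  | lie hx hy ihx ihy =>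
    rw [leibniz_lie]
    exact .add (.mono (by omega) (.lie ihx hy)) (.mono (by omega) (.lie hx ihy))
  | zero => rw [lie_zero]; exact .zero
  | add _ _ ihx ihy => rw [lie_add]; exact .add ihx ihy
  | smul c _ ih => rw [lie_smul]; exact .smul c ih
  | mono hle _ ih => exact .mono (by omega) ih

variable (k A) in
/-- The normal form of filtered elements. -/
inductive IsNormal : ℕ → EnvRB k A → Prop
  | of {n : ℕ} (a : A) : IsNormal n (of k A a)
  | R {m n : ℕ} {y : EnvRB k A} : m < n → IsFil k A m y →
      IsNormal n (RotaBaxterLie.R (k := k) y)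
  | mixed {n : ℕ} {x : EnvRB k A} : IsMixed n x → IsNormal n x
  | add {n : ℕ} {x y : EnvRB k A} : IsNormal n x → IsNormal n y → IsNormal n (x + y)

namespace IsNormal

theorem smul {n : ℕ} (c : k) {x : EnvRB k A} (hx : IsNormal k A n x) : IsNormal k A n (c • x) := by
  induction hx with
  | of a =>
    rw [← map_smul (EnvRB.of k A)]
    exact .of _
  | R h hy =>
    rw [← (RotaBaxterLie.R (k := k) (L := EnvRB k A)).map_smul]
    exact .R h (hy.smul c)
  | mixed hx => exact .mixed (.smul c hx)
  | add _ _ ihx ihy => rw [smul_add]; exact .add ihx ihy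

theorem neg {n : ℕ} {x : EnvRB k A} (hx : IsNormal k A n x) : IsNormal k A n (-x) := by
  simpa using hx.smul (-1 : k)

theorem mono {m n : ℕ} (h : m ≤ n) {x : EnvRB k A} (hx : IsNormal k A m x) :
    IsNormal k A n x := by
  induction hx with
  | of a => exact .of _
  | R h' hy => exact .R (h'.trans_le h) hy
  | mixed hx => exact .mixed (.mono h hx)
  | add _ _ ihx ihy => exact .add (ihx h) (ihy h)

theorem lie_R_of {m n : ℕ} (h : m < n) {y : EnvRB k A} (hy : IsFil k A m y) (a : A) :
    IsNormal k A n ⁅RotaBaxterLie.R (k := k) y, EnvRB.of k A a⁆ := by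
  rw [R_eq, add_lie, EnvRB.lie_R_of]
  exact .add (.of _) (.mixed (.mono (by omega) (.base _ (augProj_mem hy))))

theorem lie_R_mixed {m n r : ℕ} (h : m < r) {x y : EnvRB k A} (hy : IsFil k A m y)
    (hx : IsMixed n x) : IsNormal k A (r + n) ⁅RotaBaxterLie.R (k := k) y, x⁆ := by
  rw [R_eq, add_lie]
  exact .mixed (.add (.mono (by omega) (hx.lie_R_of _))
    (.mono (by omega) (.right (augProj_mem hy) hx)))

/-- Case by case: A is closed under the bracket; two values of R give R of a sub-adjacent bracket;
R(y) is split into its A-part and its kernel part, the first acting on A through ◁ and the second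
producing mixed commutators; mixed commutators absorb everything. The argument of R stays strictly
below the level, which is what makes the later recursion well-founded. -/
theorem lie {m n : ℕ} {x y : EnvRB k A} (hx : IsNormal k A m x) (hy : IsNormal k A n y) :
    IsNormal k A (m + n) ⁅x, y⁆ := by
  induction hx with
  | of a =>
    induction hy with
    | of b => rw [← LieHom.map_lie]; exact .of _
    | R h hy =>
      rw [← lie_skew]
      exact (lie_R_of (h.trans_le (by omega)) hy a).neg
    | mixed hx => exact .mixed (.mono (by omega) (.left a hx))
    | add _ _ ihx ihy => rw [lie_add]; exact .add ihx ihy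
  | R h hx =>
    induction hy with
    | of b => exact lie_R_of (h.trans_le (by omega)) hx b
    | R h' hy =>
      rw [← RotaBaxterLie.R_subBracket]
      exact .R (by omega) (hx.subBracket hy)
    | mixed hy => exact lie_R_mixed h hx hy
    | add _ _ ihx ihy => rw [lie_add]; exact .add ihx ihy
  | mixed hx =>
    induction hy with
    | of b =>
      rw [← lie_skew]
      exact .mixed (.neg (.mono (by omega) (.left b hx)))
    | R h hy =>
      rw [← lie_skew]
      exact ((lie_R_mixed h hy hx).mono (by omega)).neg
    | mixed hy => exact .mixed (.lie hx hy)
    | add _ _ ihx ihy => rw [lie_add]; exact .add ihx ihy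
  | add _ _ ihx ihy => rw [add_lie]; exact .add ihx ihy

theorem exists_eq {n : ℕ} {x : EnvRB k A} (hx : IsNormal k A (n + 1) x) :
    ∃ a y z, IsFil k A n y ∧ IsMixed (n + 1) z ∧
      x = EnvRB.of k A a + (RotaBaxterLie.R (k := k) y + z) := by
  generalize hr : n + 1 = r at hx
  have e0 := (RotaBaxterLie.R (k := k) (L := EnvRB k A)).map_zero
  have e1 := map_zero (EnvRB.of k A)
  induction hx with
  | of a => exact ⟨a, 0, 0, .zero, .zero, by rw [e0, add_zero, add_zero]⟩
  | R h hy => exact ⟨0, _, 0, hy.mono (by omega), .zero, by rw [e1, zero_add, add_zero]⟩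
  | mixed hz =>
    subst hr
    exact ⟨0, 0, _, .zero, hz, by rw [e0, e1, zero_add, zero_add]⟩
  | add _ _ ihx ihy =>
    obtain ⟨a, y, z, hy, hz, rfl⟩ := ihx hr
    obtain ⟨a', y', z', hy', hz', rfl⟩ := ihy hr
    refine ⟨a + a', y + y', z + z', hy.add hy', .add hz hz', ?_⟩
    rw [map_add (EnvRB.of k A), (RotaBaxterLie.R (k := k) (L := EnvRB k A)).map_add]
    abel

end IsNormal

theorem IsFil.isNormal {n : ℕ} {x : EnvRB k A} (hx : IsFil k A n x) : IsNormal k A n x := by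
  induction hx with
  | of a => exact .of a
  | zero => exact .mixed .zero
  | add _ _ ihx ihy => exact .add ihx ihy
  | smul c _ ih => exact .smul c ih
  | succ _ ih => exact .mono (Nat.le_succ _) ih
  | lie _ _ ihx ihy => exact .lie ihx ihy
  | R hx _ => exact .R (Nat.lt_succ_self _) hx

theorem augParam_ret_augProj (y : EnvRB k A) (x : mixedLie k A (Aug k A)) :
    augParam k A (ret k A y, augProj k A y, x) =
      augProj k A (RotaBaxterLie.R (k := k) y + mixedValue k A x) := by
  refine (augParam_apply _ _ _).trans (congrArg (augProj k A) ?_)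
  rw [R_eq y, add_assoc]
  rfl

theorem IsMixed.exists_eq [CharZero k] {n : ℕ} {z : EnvRB k A} (hz : IsMixed (n + 1) z) :
    ∃ x ∈ mixedLieOn A (augFil k A n),
      lieValue (theta (of k A : A →ₗ[k] EnvRB k A) (augR k A)) x = z :=
  MixedFil.mem (f := of k A) (h := augRHom k A) augFil_mono augFil_lie
    (mixedValues (of k A : A →ₗ[k] EnvRB k A) (augR k A) (augFil k A n))
    (fun v _ hc' p q => mixedValues_theta_mem _ _ _ v hc' p q) hz le_rfl

theorem IsNormal.augProj_eq {n : ℕ} {x : EnvRB k A} (hx : IsNormal k A (n + 1) x) :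
    ∃ y z, IsFil k A n y ∧ IsMixed (n + 1) z ∧
      augProj k A (RotaBaxterLie.R (k := k) y + z) = augProj k A x := by
  obtain ⟨a, y, z, hy, hz, h⟩ := hx.exists_eq
  refine ⟨y, z, hy, hz, ?_⟩
  rw [h, (augProj k A).map_add (EnvRB.of k A a), augProj_of, zero_add]

theorem augParam_eq [CharZero k] {y z : EnvRB k A} {x : mixedLie k A (Aug k A)} {c : Aug k A}
    (hx : mixedValue k A x = z)
    (h : augProj k A (RotaBaxterLie.R (k := k) y + z) = augProj k A (augIncl k A c)) :
    augParam k A (ret k A y, augProj k A y, x) = c := by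
  rw [augParam_ret_augProj, hx, h, augProj_augIncl]

/-- Take the normal form: the projection discards the A-part, y provides the first two parameters,
and symmetrization provides the third. Every parameter sits one level below `c`. -/
theorem exists_augParam_eq [CharZero k] {n : ℕ} {c : Aug k A} (hc : c ∈ augFil k A (n + 1)) :
    ∃ (b : A) (c' : Aug k A) (x : mixedLie k A (Aug k A)), c' ∈ augFil k A n ∧
      x.1 ∈ mixedLieOn A (augFil k A n) ∧ augParam k A (b, c', x) = c :=
  (mem_augFil.1 hc).isNormal.augProj_eq.elim fun y h => h.elim fun _ h =>
    h.2.1.exists_eq.elim fun x hx => ⟨ret k A y, augProj k A y, ⟨x, mixedLieOn_le _ hx.1⟩,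
      augProj_mem h.1, hx.1, augParam_eq hx.2 h.2.2⟩

end EnvRB

end Filtration

/-! ### Functoriality of mixed commutators -/

section TensorMap

variable {k : Type*} [Field k] {V V' V'' : Type*} [AddCommGroup V] [Module k V] [AddCommGroup V']
  [Module k V'] [AddCommGroup V''] [Module k V'']

/-- The algebra homomorphism of tensor algebras induced by a linear map. -/
def tensorMap (a : V →ₗ[k] V') : TensorAlgebra k V →ₐ[k] TensorAlgebra k V' :=
  TensorAlgebra.lift k (TensorAlgebra.ι k ∘ₗ a)

@[simp] theorem tensorMap_ι (a : V →ₗ[k] V') (v : V) :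
    tensorMap a (TensorAlgebra.ι k v) = TensorAlgebra.ι k (a v) := by
  simp [tensorMap]

theorem tensorMap_id : tensorMap (LinearMap.id : V →ₗ[k] V) = AlgHom.id k _ :=
  TensorAlgebra.hom_ext (LinearMap.ext fun v => tensorMap_ι _ v)

theorem tensorMap_comp (a : V →ₗ[k] V') (a' : V' →ₗ[k] V'') :
    tensorMap (a' ∘ₗ a) = (tensorMap a').comp (tensorMap a) :=
  TensorAlgebra.hom_ext (LinearMap.ext fun v => by simp)

theorem algebraMapInv_tensorMap (a : V →ₗ[k] V') (s : TensorAlgebra k V) :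
    TensorAlgebra.algebraMapInv (tensorMap a s) = TensorAlgebra.algebraMapInv s := by
  have h : (TensorAlgebra.algebraMapInv (M := V')).comp (tensorMap a) =
      TensorAlgebra.algebraMapInv (R := k) := TensorAlgebra.hom_ext (LinearMap.ext fun v => by
    simp [TensorAlgebra.algebraMapInv])
  exact DFunLike.congr_fun h s

theorem adAction_tensorMap {J : Type*} [LieRing J] [LieAlgebra k J] (f : V' →ₗ[k] J)
    (a : V →ₗ[k] V') (s : TensorAlgebra k V) :
    adAction f (tensorMap a s) = adAction (f ∘ₗ a) s := by
  have h : (adAction f).comp (tensorMap a) = adAction (f ∘ₗ a) :=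
    TensorAlgebra.hom_ext (LinearMap.ext fun v => by
      simp [adAction])
  exact DFunLike.congr_fun h s

end TensorMap

section MixedMap

variable {k : Type*} [Field k] {V V' V'' Z Z' Z'' : Type*} [AddCommGroup V] [Module k V]
  [AddCommGroup V'] [Module k V'] [AddCommGroup V''] [Module k V''] [AddCommGroup Z] [Module k Z]
  [AddCommGroup Z'] [Module k Z'] [AddCommGroup Z''] [Module k Z'']

/-- The linear map on the generators of mixed commutators induced by a pair of linear maps. -/
def genMap (a : V →ₗ[k] V') (u : Z →ₗ[k] Z') : TensorAlgebra k V ⊗[k] TensorAlgebra k Z →ₗ[k]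
    TensorAlgebra k V' ⊗[k] TensorAlgebra k Z' :=
  TensorProduct.map (tensorMap a).toLinearMap (tensorMap u).toLinearMap

theorem genMap_tmul (a : V →ₗ[k] V') (u : Z →ₗ[k] Z') (s : TensorAlgebra k V)
    (t : TensorAlgebra k Z) : genMap a u (s ⊗ₜ[k] t) = tensorMap a s ⊗ₜ[k] tensorMap u t := rfl

theorem theta_genMap {J : Type*} [LieRing J] [LieAlgebra k J] (f : V' →ₗ[k] J) (h : Z' →ₗ[k] J)
    (a : V →ₗ[k] V') (u : Z →ₗ[k] Z') (x : TensorAlgebra k V ⊗[k] TensorAlgebra k Z) :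
    theta f h (genMap a u x) = theta (f ∘ₗ a) (h ∘ₗ u) x := by
  induction x using TensorProduct.induction_on with
  | zero => simp
  | add x y hx hy => rw [map_add, map_add, map_add, hx, hy]
  | tmul s t =>
    rw [genMap_tmul]
    induction s using word_induction with
    | hzero => simp
    | hadd x y hx hy => simp only [map_add, TensorProduct.add_tmul, hx, hy]
    | hsmul c x hx => simp only [map_smul, ← TensorProduct.smul_tmul', hx]
    | hword l =>
      induction l with
      | nil => rw [word_nil, map_one, theta_one, theta_one]
      | cons v l ih =>
        rw [word_cons, map_mul, tensorMap_ι, theta_ι_mul, theta_ι_mul, ih, algebraMapInv_tensorMap,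
          adAction_tensorMap]
        rfl

theorem tensorMap_genMap_mem (a : V →ₗ[k] V') (u : Z →ₗ[k] Z')
    {x : TensorAlgebra k (TensorAlgebra k V ⊗[k] TensorAlgebra k Z)} (hx : x ∈ mixedLie k V Z) :
    tensorMap (genMap a u) x ∈ mixedLie k V' Z' := by
  induction hx using LieSubalgebra.lieSpan_induction with
  | mem x hx =>
    obtain ⟨v, z, p, q, rfl⟩ := hx
    rw [tensorMap_ι, genMap_tmul, map_pow, map_pow, tensorMap_ι, tensorMap_ι]
    exact LieSubalgebra.subset_lieSpan ⟨a v, u z, p, q, rfl⟩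
  | zero => rw [map_zero]; exact zero_mem _
  | add x y _ _ hx hy => rw [map_add]; exact add_mem hx hy
  | smul c x _ hx => rw [map_smul]; exact Submodule.smul_mem (mixedLie k V' Z').toSubmodule c hx
  | lie x y _ _ hx hy =>
    rw [LieRing.of_associative_ring_bracket, map_sub, map_mul, map_mul]
    exact LieSubalgebra.lie_mem _ hx hy

/-- The linear map of mixed commutators induced by a pair of linear maps. -/
def mixedMap (a : V →ₗ[k] V') (u : Z →ₗ[k] Z') : mixedLie k V Z →ₗ[k] mixedLie k V' Z' :=
  (tensorMap (genMap a u)).toLinearMap.restrict fun _ hx => tensorMap_genMap_mem a u hx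

theorem coe_mixedMap (a : V →ₗ[k] V') (u : Z →ₗ[k] Z') (x : mixedLie k V Z) :
    (mixedMap a u x).1 = tensorMap (genMap a u) x.1 := rfl

theorem mixedMap_id (x : mixedLie k V Z) : mixedMap LinearMap.id LinearMap.id x = x := by
  refine Subtype.ext ?_
  have h : genMap (LinearMap.id : V →ₗ[k] V) (LinearMap.id : Z →ₗ[k] Z) = LinearMap.id := by
    rw [genMap, tensorMap_id, tensorMap_id]
    exact TensorProduct.map_id
  rw [coe_mixedMap, h, tensorMap_id]
  rfl

theorem genMap_comp (a : V →ₗ[k] V') (u : Z →ₗ[k] Z') (a' : V' →ₗ[k] V'') (u' : Z' →ₗ[k] Z'') :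
    genMap (a' ∘ₗ a) (u' ∘ₗ u) = genMap a' u' ∘ₗ genMap a u :=
  TensorProduct.ext' fun s t => by
    rw [LinearMap.comp_apply, genMap_tmul, genMap_tmul, genMap_tmul, tensorMap_comp,
      tensorMap_comp, AlgHom.comp_apply, AlgHom.comp_apply]

theorem tensorMap_genMap_comp (a : V →ₗ[k] V') (u : Z →ₗ[k] Z') (a' : V' →ₗ[k] V'')
    (u' : Z' →ₗ[k] Z'') (x : TensorAlgebra k (TensorAlgebra k V ⊗[k] TensorAlgebra k Z)) :
    tensorMap (genMap (a' ∘ₗ a) (u' ∘ₗ u)) x =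
      tensorMap (genMap a' u') (tensorMap (genMap a u) x) := by
  rw [genMap_comp, tensorMap_comp, AlgHom.comp_apply]

theorem mixedMap_comp (a : V →ₗ[k] V') (u : Z →ₗ[k] Z') (a' : V' →ₗ[k] V'') (u' : Z' →ₗ[k] Z'')
    (x : mixedLie k V Z) : mixedMap (a' ∘ₗ a) (u' ∘ₗ u) x = mixedMap a' u' (mixedMap a u x) :=
  Subtype.ext (tensorMap_genMap_comp a u a' u' x.1)

/-- Locality: a recursive definition at level n + 1 consults the map at level n only. -/
theorem mixedMap_congr (a : V →ₗ[k] V') {u u' : Z →ₗ[k] Z'} {S : Submodule k Z}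
    (h : ∀ z ∈ S, u z = u' z) {x : mixedLie k V Z} (hx : x.1 ∈ mixedLieOn V S) :
    mixedMap a u x = mixedMap a u' x := by
  refine Subtype.ext ?_
  rw [coe_mixedMap, coe_mixedMap]
  obtain ⟨x, hx'⟩ := x
  dsimp only at hx ⊢
  clear hx'
  induction hx using LieSubalgebra.lieSpan_induction with
  | mem x hx =>
    obtain ⟨v, z, p, q, hz, rfl⟩ := hx
    simp only [tensorMap_ι, genMap_tmul, map_pow, h z hz]
  | zero => rw [map_zero, map_zero]
  | add x y _ _ hx hy => rw [map_add, map_add, hx, hy]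
  | smul c x _ hx => rw [map_smul, map_smul, hx]
  | lie x y _ _ hx hy =>
    rw [LieRing.of_associative_ring_bracket, map_sub, map_sub, map_mul, map_mul, map_mul, map_mul,
      hx, hy]

theorem lieValue_mixedMap [CharZero k] {J J' : Type*} [LieRing J] [LieAlgebra k J] [LieRing J']
    [LieAlgebra k J'] {f : V →ₗ[k] J} {h : Z →ₗ[k] J} {f' : V' →ₗ[k] J'} {h' : Z' →ₗ[k] J'}
    {a : V →ₗ[k] V'} {u : Z →ₗ[k] Z'} (φ : J →ₗ⁅k⁆ J') (hf : ∀ v, φ (f v) = f' (a v))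
    (hh : ∀ z, φ (h z) = h' (u z)) (x : mixedLie k V Z) :
    φ (lieValue (theta f h) x.1) = lieValue (theta f' h') (mixedMap a u x).1 := by
  have hgen : ∀ w, φ (theta f h w) = theta f' h' (genMap a u w) := fun w => by
    rw [theta_genMap, theta_comp]
    congr 2
    · exact LinearMap.ext hf
    · exact LinearMap.ext hh
  rw [coe_mixedMap]
  obtain ⟨x, hx⟩ := x
  dsimp only
  induction hx using LieSubalgebra.lieSpan_induction with
  | mem x hx =>
    obtain ⟨v, z, p, q, rfl⟩ := hx
    rw [tensorMap_ι, lieValue_ι, lieValue_ι, hgen]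
  | zero => rw [map_zero, map_zero, map_zero, map_zero]
  | add x y _ _ hx hy => rw [map_add, map_add, map_add, map_add, hx, hy]
  | smul c x _ hx => rw [map_smul, map_smul, map_smul, map_smul, hx]
  | lie x y hx' hy' hx hy =>
    have e : tensorMap (genMap a u) ⁅x, y⁆ =
        ⁅tensorMap (genMap a u) x, tensorMap (genMap a u) y⁆ := by
      rw [LieRing.of_associative_ring_bracket, map_sub, map_mul, map_mul]
      rfl
    rw [e, lieValue_lie _ (mixedLie_le hx') (mixedLie_le hy'),
      lieValue_lie _ (mixedLie_le (tensorMap_genMap_mem a u hx'))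
        (mixedLie_le (tensorMap_genMap_mem a u hy')), LieHom.map_lie, hx, hy]

/-- The linear map of parameter spaces induced by a pair of linear maps. -/
def paramMap (a : V →ₗ[k] V') (u : Z →ₗ[k] Z') :
    (V × Z × mixedLie k V Z) →ₗ[k] (V' × Z' × mixedLie k V' Z') :=
  a.prodMap (u.prodMap (mixedMap a u))

theorem paramMap_apply (a : V →ₗ[k] V') (u : Z →ₗ[k] Z') (b : V) (c : Z) (x : mixedLie k V Z) :
    paramMap a u (b, c, x) = (a b, u c, mixedMap a u x) := rfl

theorem paramMap_id (p : V × Z × mixedLie k V Z) :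
    paramMap LinearMap.id LinearMap.id p = p := by
  obtain ⟨b, c, x⟩ := p
  rw [paramMap_apply, mixedMap_id]
  rfl

theorem paramMap_comp (a : V →ₗ[k] V') (u : Z →ₗ[k] Z') (a' : V' →ₗ[k] V'') (u' : Z' →ₗ[k] Z'')
    (p : V × Z × mixedLie k V Z) :
    paramMap (a' ∘ₗ a) (u' ∘ₗ u) p = paramMap a' u' (paramMap a u p) := by
  obtain ⟨b, c, x⟩ := p
  rw [paramMap_apply, mixedMap_comp]
  rfl

end MixedMap

/-! ### Linear maps defined by recursion -/

section Recursion

variable {k : Type*} [Field k] {V V' Z Z' : Type*} [AddCommGroup V] [Module k V]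
  [AddCommGroup V'] [Module k V'] [AddCommGroup Z] [Module k Z] [AddCommGroup Z'] [Module k Z']

/-- A bijective parametrization of a vector space by mixed commutators, compatible with a
filtration. -/
structure ParamSystem (k V Z : Type*) [Field k] [AddCommGroup V] [Module k V] [AddCommGroup Z]
    [Module k Z] where
  param : (V × Z × mixedLie k V Z) →ₗ[k] Z
  injective : Function.Injective param
  fil : ℕ → Submodule k Z
  fil_mono : Monotone fil
  eq_zero : ∀ c ∈ fil 0, c = 0
  exists_mem : ∀ c, ∃ n, c ∈ fil n
  exists_eq : ∀ n, ∀ c ∈ fil (n + 1), ∃ b c' x, c' ∈ fil n ∧ x.1 ∈ mixedLieOn V (fil n) ∧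
    param (b, c', x) = c

namespace ParamSystem

variable (S : ParamSystem k V Z) (φ : (V' × Z' × mixedLie k V' Z') →ₗ[k] Z') (a : V →ₗ[k] V')

theorem bijective : Function.Bijective S.param :=
  ⟨S.injective, fun c => by
    obtain ⟨n, hn⟩ := S.exists_mem c
    obtain ⟨b, c', x, -, -, h⟩ := S.exists_eq n c (S.fil_mono (Nat.le_succ n) hn)
    exact ⟨_, h⟩⟩

theorem paramMap_congr {n : ℕ} {H H' : Z →ₗ[k] Z'} (h : ∀ c ∈ S.fil n, H c = H' c)
    {p : V × Z × mixedLie k V Z} (hp : S.param p ∈ S.fil (n + 1)) :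
    paramMap a H p = paramMap a H' p := by
  obtain ⟨b, c', x, hc', hx, he⟩ := S.exists_eq n _ hp
  obtain rfl := S.injective he
  rw [paramMap_apply, paramMap_apply, h c' hc', mixedMap_congr a h hx]

-- Uniqueness by induction on the level: level 0 is zero, and the values at level n + 1 are computed
-- from those at level n.
variable {φ a} in
theorem hom_ext {H H' : Z →ₗ[k] Z'} (h : ∀ p, H (S.param p) = φ (paramMap a H p))
    (h' : ∀ p, H' (S.param p) = φ (paramMap a H' p)) : H = H' := by
  have key : ∀ n, ∀ c ∈ S.fil n, H c = H' c := by
    intro n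
    induction n with
    | zero =>
      intro c hc
      rw [S.eq_zero c hc, map_zero, map_zero]
    | succ n ih =>
      intro c hc
      obtain ⟨p, rfl⟩ := S.bijective.2 c
      rw [h, h', S.paramMap_congr a ih hc]
  exact LinearMap.ext fun c => (S.exists_mem c).elim fun n hn => key n c hn

/-- The approximations of the map defined by recursion. -/
def approx : ℕ → (Z →ₗ[k] Z')
  | 0 => 0
  | n + 1 => φ ∘ₗ paramMap a (approx n) ∘ₗ
      (LinearEquiv.ofBijective S.param S.bijective).symm.toLinearMap

theorem approx_succ_param (n : ℕ) (p : V × Z × mixedLie k V Z) :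
    S.approx φ a (n + 1) (S.param p) = φ (paramMap a (S.approx φ a n) p) := by
  have h : (LinearEquiv.ofBijective S.param S.bijective).symm (S.param p) = p :=
    (LinearEquiv.ofBijective S.param S.bijective).symm_apply_apply p
  exact congrArg (fun p => φ (paramMap a (S.approx φ a n) p)) h

theorem approx_succ (n : ℕ) : ∀ c ∈ S.fil n, S.approx φ a (n + 1) c = S.approx φ a n c := by
  induction n with
  | zero =>
    intro c hc
    rw [S.eq_zero c hc, map_zero, map_zero]
  | succ n ih =>
    intro c hc
    obtain ⟨p, rfl⟩ := S.bijective.2 c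
    rw [approx_succ_param, approx_succ_param, S.paramMap_congr a ih hc]

theorem approx_eq {m n : ℕ} (h : m ≤ n) {c : Z} (hc : c ∈ S.fil m) :
    S.approx φ a n c = S.approx φ a m c := by
  induction n, h using Nat.le_induction with
  | base => rfl
  | succ n hmn ih => rw [approx_succ _ _ _ _ _ (S.fil_mono hmn hc), ih]

/-- The approximations are stationary on each level, so their stable values glue to a linear map. -/
theorem exists_recursion : ∃ H : Z →ₗ[k] Z', ∀ p, H (S.param p) = φ (paramMap a H p) := by
  choose N hN using S.exists_mem
  -- The stable value does not depend on the chosen level; this is what makes it additive and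
  -- homogeneous.
  have key : ∀ n, ∀ c ∈ S.fil n, S.approx φ a (N c) c = S.approx φ a n c := fun n c hc => by
    rw [← S.approx_eq φ a (le_max_left (N c) n) (hN c), S.approx_eq φ a (le_max_right _ _) hc]
  let H : Z →ₗ[k] Z' :=
    { toFun := fun c => S.approx φ a (N c) c
      map_add' := fun c c' => by
        have h := S.fil_mono (le_max_left (N c) (N c')) (hN c)
        have h' := S.fil_mono (le_max_right (N c) (N c')) (hN c')
        rw [key _ _ h, key _ _ h', key _ _ (add_mem h h'), map_add]
      map_smul' := fun r c => by
        rw [key _ _ (Submodule.smul_mem _ r (hN c)), map_smul]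
        rfl }
  refine ⟨H, fun p => ?_⟩
  have hp := S.fil_mono (Nat.le_succ (N (S.param p))) (hN (S.param p))
  rw [S.paramMap_congr a (fun c hc => (key _ c hc : H c = _)) hp]
  exact (key _ _ hp).trans (S.approx_succ_param φ a _ p)

/-- The linear map defined by recursion. -/
def recursion : Z →ₗ[k] Z' := (S.exists_recursion φ a).choose

theorem recursion_param (p : V × Z × mixedLie k V Z) :
    S.recursion φ a (S.param p) = φ (paramMap a (S.recursion φ a) p) :=
  (S.exists_recursion φ a).choose_spec p

/-- The composite and the identity solve the same recursion over the identity of `V`, so they agree.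
-/
theorem recursion_recursion (S' : ParamSystem k V' Z') (e : V ≃ₗ[k] V') (c : Z) :
    S'.recursion S.param e.symm.toLinearMap (S.recursion S'.param e.toLinearMap c) = c := by
  have he : e.symm.toLinearMap ∘ₗ e.toLinearMap = LinearMap.id :=
    LinearMap.ext e.symm_apply_apply
  refine LinearMap.congr_fun (S.hom_ext (φ := S.param) (a := LinearMap.id)
    (H := S'.recursion S.param e.symm.toLinearMap ∘ₗ S.recursion S'.param e.toLinearMap)
    (H' := LinearMap.id) (fun p => ?_) (fun p => ?_)) c
  · rw [LinearMap.comp_apply, recursion_param, recursion_param, ← paramMap_comp, he]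
  · rw [paramMap_id]
    rfl

/-- The bijection of parametrized vector spaces defined by recursion. -/
def equiv (S' : ParamSystem k V' Z') (e : V ≃ₗ[k] V') : Z ≃ₗ[k] Z' :=
  LinearEquiv.ofLinearMap (S.recursion S'.param e.toLinearMap)
    (S'.recursion S.param e.symm.toLinearMap)
    (LinearMap.ext fun c => S'.recursion_recursion S e.symm c)
    (LinearMap.ext fun c => S.recursion_recursion S' e c)

/-- Both composites satisfy the recursion over the common map f' ∘ e = d ∘ f, hence coincide by
uniqueness. -/
theorem equiv_natural {W W' Y Y' : Type*} [AddCommGroup W] [Module k W] [AddCommGroup W']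
    [Module k W'] [AddCommGroup Y] [Module k Y] [AddCommGroup Y'] [Module k Y']
    (S' : ParamSystem k V' Z') (T : ParamSystem k W Y) (T' : ParamSystem k W' Y') (e : V ≃ₗ[k] V')
    (d : W ≃ₗ[k] W') {f : V →ₗ[k] W} {f' : V' →ₗ[k] W'} {C : Z →ₗ[k] Y} {C' : Z' →ₗ[k] Y'}
    (hf : ∀ v, d (f v) = f' (e v)) (hC : ∀ p, C (S.param p) = T.param (paramMap f C p))
    (hC' : ∀ p, C' (S'.param p) = T'.param (paramMap f' C' p)) (c : Z) :
    T.equiv T' d (C c) = C' (S.equiv S' e c) := by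
  refine LinearMap.congr_fun (S.hom_ext (φ := T'.param) (a := f' ∘ₗ e.toLinearMap)
    (H := T.recursion T'.param d.toLinearMap ∘ₗ C)
    (H' := C' ∘ₗ S.recursion S'.param e.toLinearMap) (fun p => ?_) (fun p => ?_)) c
  · have h : f' ∘ₗ e.toLinearMap = d.toLinearMap ∘ₗ f := LinearMap.ext fun v => (hf v).symm
    rw [LinearMap.comp_apply, hC, recursion_param, ← paramMap_comp, h]
  · rw [LinearMap.comp_apply, recursion_param, hC', ← paramMap_comp]

end ParamSystem

end Recursion

/-! ### Functoriality of the universal enveloping Rota-Baxter Lie algebra -/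

section Natural

variable {k : Type*} [Field k] [CharZero k] {V V' Z Z' J J' : Type*} [AddCommGroup V] [Module k V]
  [AddCommGroup V'] [Module k V'] [AddCommGroup Z] [Module k Z] [AddCommGroup Z'] [Module k Z']
  [LieRing J] [LieAlgebra k J] [LieRing J'] [LieAlgebra k J']

theorem param_natural {a : V →ₗ[k] V'} {C : Z →ₗ[k] Z'} {f r : V →ₗ[k] J} {h : Z →ₗ[k] J}
    {f' r' : V' →ₗ[k] J'} {h' : Z' →ₗ[k] J'} {P : J →ₗ[k] Z} {P' : J' →ₗ[k] Z'} (φ : J →ₗ⁅k⁆ J')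
    (hf : ∀ v, φ (f v) = f' (a v)) (hh : ∀ z, φ (h z) = h' (C z)) (hr : ∀ v, φ (r v) = r' (a v))
    (hP : ∀ y, C (P y) = P' (φ y)) (b : V) (c : Z) (x : mixedLie k V Z) :
    C (P (r b + (h c + lieValue (theta f h) x.1))) =
      P' (r' (a b) + (h' (C c) + lieValue (theta f' h') (mixedMap a C x).1)) := by
  rw [hP, map_add φ, map_add φ, hr, hh, lieValue_mixedMap φ hf hh]

end Natural

section Functoriality

variable {k : Type*} [Field k] {A B : Type*} [LieRing A] [LieAlgebra k A] [PostLieAlgebra k A]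
  [LieRing B] [LieAlgebra k B] [PostLieAlgebra k B]

namespace EnvRB

/-- The homomorphism induced by a homomorphism of post-Lie algebras. -/
def map (f : A →ₗ⁅k⁆ B) (hf : ∀ a b, f (PostLieAlgebra.tri (k := k) a b) =
    PostLieAlgebra.tri (k := k) (f a) (f b)) : EnvRB k A →ₗ⁅k⁆ EnvRB k B :=
  lift ((of k B).comp f) fun a b => by
    rw [LieHom.comp_apply, LieHom.comp_apply, LieHom.comp_apply, hf, of_tri]

variable (f : A →ₗ⁅k⁆ B) (hf : ∀ a b, f (PostLieAlgebra.tri (k := k) a b) =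
    PostLieAlgebra.tri (k := k) (f a) (f b))

@[simp] theorem map_of (a : A) : map f hf (of k A a) = of k B (f a) := rfl

@[simp] theorem map_R (x : EnvRB k A) : map f hf (RotaBaxterLie.R (k := k) x) =
    RotaBaxterLie.R (k := k) (map f hf x) := lift_R _ _ x

/-- The homomorphism of extensions induced by a homomorphism of post-Lie algebras. -/
def extMap : PostLieExt k A →ₗ⁅k⁆ PostLieExt k B where
  toLinearMap := (f : A →ₗ[k] B).prodMap (f : A →ₗ[k] B)
  map_lie' := by
    rintro ⟨a, a'⟩ ⟨b, b'⟩
    refine Prod.ext ?_ ?_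
    · change f (⁅a, b⁆ + PostLieAlgebra.tri (k := k) a b' - PostLieAlgebra.tri (k := k) b a') =
        ⁅f a, f b⁆ + PostLieAlgebra.tri (k := k) (f a) (f b') -
          PostLieAlgebra.tri (k := k) (f b) (f a')
      rw [map_sub, map_add, hf, hf, LieHom.map_lie]
    · change f (subBracket k A a' b') = subBracket k B (f a') (f b')
      rw [subBracket_apply, subBracket_apply, map_add, map_sub, hf, hf, LieHom.map_lie]

theorem toExt_map (x : EnvRB k A) : toExt k B (map f hf x) = extMap f hf (toExt k A x) := by
  have h1 : ∀ z, toExt k A (RotaBaxterLie.R (k := k) z) = RotaBaxterLie.R (k := k) (toExt k A z) :=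
    lift_R _ _
  have h2 : ∀ z, toExt k B (RotaBaxterLie.R (k := k) z) = RotaBaxterLie.R (k := k) (toExt k B z) :=
    lift_R _ _
  have h3 : ∀ p : PostLieExt k A, extMap f hf (RotaBaxterLie.R (k := k) p) =
      RotaBaxterLie.R (k := k) (extMap f hf p) := by
    rintro ⟨a, a'⟩
    refine Prod.ext (map_zero f) ?_
    change f (a - a') = f a - f a'
    exact map_sub f a a'
  refine DFunLike.congr_fun (hom_ext (F := (toExt k B).comp (map f hf))
    (G := (extMap f hf).comp (toExt k A)) (fun x => ?_) (fun x => ?_) (fun a => ?_)) x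
  · rw [LieHom.comp_apply, map_R, h2]
    rfl
  · rw [LieHom.comp_apply, h1, h3]
    rfl
  · refine Prod.ext rfl ?_
    change (0 : B) = f 0
    rw [map_zero]

@[simp] theorem ret_map (x : EnvRB k A) : ret k B (map f hf x) = f (ret k A x) :=
  congrArg Prod.fst (toExt_map f hf x)

/-- The induced map of the kernels of the retractions. -/
def augMap : Aug k A →ₗ[k] Aug k B :=
  augProj k B ∘ₗ (map f hf : EnvRB k A →ₗ[k] EnvRB k B) ∘ₗ augIncl k A

theorem augMap_apply (c : Aug k A) : augMap f hf c = augProj k B (map f hf (augIncl k A c)) := rfl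

theorem augIncl_augMap (c : Aug k A) : augIncl k B (augMap f hf c) = map f hf (augIncl k A c) := by
  rw [augMap_apply, augIncl_augProj, ret_map, ret_augIncl, map_zero f, map_zero (of k B), sub_zero]

theorem augProj_map (x : EnvRB k A) : augProj k B (map f hf x) = augMap f hf (augProj k A x) := by
  refine augIncl_injective ?_
  rw [augIncl_augMap, augIncl_augProj, augIncl_augProj, ret_map, map_sub (map f hf), map_of]

theorem augMap_augParam_mk [CharZero k] (b : A) (c : Aug k A) (x : mixedLie k A (Aug k A)) :
    augMap f hf (augParam k A (b, c, x)) =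
      augParam k B (f b, augMap f hf c, mixedMap (f : A →ₗ[k] B) (augMap f hf) x) :=
  param_natural (a := (f : A →ₗ[k] B)) (C := augMap f hf) (f := (of k A : A →ₗ[k] EnvRB k A))
    (f' := (of k B : B →ₗ[k] EnvRB k B)) (h := augR k A) (h' := augR k B)
    (r := RotaBaxterLie.R ∘ₗ (of k A : A →ₗ[k] EnvRB k A))
    (r' := RotaBaxterLie.R ∘ₗ (of k B : B →ₗ[k] EnvRB k B)) (P := augProj k A) (P' := augProj k B)
    (map f hf) (fun _ => rfl)
    (fun c => (map_R f hf (augIncl k A c)).trans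
      (congrArg (RotaBaxterLie.R (k := k)) (augIncl_augMap f hf c).symm))
    (fun a => map_R f hf (of k A a)) (fun y => (augProj_map f hf y).symm) b c x

theorem augMap_augParam [CharZero k] (p : A × Aug k A × mixedLie k A (Aug k A)) :
    augMap f hf (augParam k A p) =
      augParam k B (paramMap (f : A →ₗ[k] B) (augMap f hf) p) :=
  augMap_augParam_mk f hf p.1 p.2.1 p.2.2

variable (k A) in
/-- The parametrization of the kernel of the retraction. -/
def paramSystem [CharZero k] : ParamSystem k A (Aug k A) where
  param := augParam k A
  injective := augParam_injective
  fil := augFil k A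
  fil_mono := augFil_mono
  eq_zero _ hc := augFil_zero hc
  exists_mem := exists_mem_augFil
  exists_eq _ _ hc := exists_augParam_eq hc

end EnvRB

/-! ### Comparison with zero operations -/

/-- A vector space regarded as a post-Lie algebra with zero operations. -/
@[nolint unusedArguments]
def TrivialPostLie (_ : Type*) (A : Type*) := A

instance (A : Type*) [AddCommGroup A] : AddCommGroup (TrivialPostLie k A) :=
  inferInstanceAs (AddCommGroup A)

instance (A : Type*) [AddCommGroup A] [Module k A] : Module k (TrivialPostLie k A) :=
  inferInstanceAs (Module k A)

instance (A : Type*) [AddCommGroup A] : LieRing (TrivialPostLie k A) where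
  bracket _ _ := 0
  add_lie _ _ _ := (add_zero 0).symm
  lie_add _ _ _ := (add_zero 0).symm
  lie_self _ := rfl
  leibniz_lie _ _ _ := (add_zero 0).symm

instance (A : Type*) [AddCommGroup A] [Module k A] : LieAlgebra k (TrivialPostLie k A) where
  lie_smul c _ _ := (smul_zero c).symm

instance (A : Type*) [AddCommGroup A] [Module k A] : PostLieAlgebra k (TrivialPostLie k A) where
  tri := 0
  lie_tri _ _ _ := (add_zero 0).symm
  tri_lie _ _ _ := by simp

section TrivialMap

variable {A B C : Type*} [AddCommGroup A] [Module k A] [AddCommGroup B] [Module k B]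
  [AddCommGroup C] [Module k C]

variable (k A) in
/-- The identity map to the post-Lie algebra with zero operations. -/
def TrivialPostLie.of : A ≃ₗ[k] TrivialPostLie k A := LinearEquiv.refl k A

/-- A linear map as a homomorphism of post-Lie algebras with zero operations. -/
def TrivialPostLie.map (f : A →ₗ[k] B) : TrivialPostLie k A →ₗ⁅k⁆ TrivialPostLie k B where
  toLinearMap := (TrivialPostLie.of k B).toLinearMap ∘ₗ f ∘ₗ (TrivialPostLie.of k A).symm.toLinearMap
  map_lie' := f.map_zero

theorem TrivialPostLie.map_tri (f : A →ₗ[k] B) (a b : TrivialPostLie k A) :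
    TrivialPostLie.map f (PostLieAlgebra.tri (k := k) a b) =
      PostLieAlgebra.tri (k := k) (TrivialPostLie.map f a) (TrivialPostLie.map f b) := f.map_zero

end TrivialMap

namespace EnvRB

variable (k A) in
/-- The decomposition of the universal enveloping Rota-Baxter Lie algebra given by the
retraction. -/
def splitEquiv : EnvRB k A ≃ₗ[k] A × Aug k A :=
  LinearEquiv.ofLinearMap ((ret k A).prod (augProj k A))
    (LinearMap.coprod (of k A : A →ₗ[k] EnvRB k A) (augIncl k A))
    (LinearMap.ext fun p => by
      change (ret k A (of k A p.1 + augIncl k A p.2), augProj k A (of k A p.1 + augIncl k A p.2)) = p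
      rw [(ret k A).map_add, (augProj k A).map_add, ret_of, ret_augIncl, augProj_of,
        augProj_augIncl, add_zero, zero_add])
    (LinearMap.ext fun x => by
      change of k A (ret k A x) + augIncl k A (augProj k A x) = x
      rw [augIncl_augProj, add_sub_cancel])

variable (k A) in
/-- The universal enveloping Rota-Baxter Lie algebra depends, as a vector space, on the underlying
vector space only. -/
def trivialEquiv [CharZero k] : EnvRB k A ≃ₗ[k] EnvRB k (TrivialPostLie k A) :=
  (splitEquiv k A).trans (((TrivialPostLie.of k A).prodCongr
    ((paramSystem k A).equiv (paramSystem k (TrivialPostLie k A)) (TrivialPostLie.of k A))).trans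
      (splitEquiv k (TrivialPostLie k A)).symm)

theorem splitEquiv_map (f : A →ₗ⁅k⁆ B) (hf : ∀ a b, f (PostLieAlgebra.tri (k := k) a b) =
    PostLieAlgebra.tri (k := k) (f a) (f b)) (x : EnvRB k A) :
    splitEquiv k B (map f hf x) = (f (splitEquiv k A x).1, augMap f hf (splitEquiv k A x).2) :=
  Prod.ext (ret_map f hf x) (augProj_map f hf x)

theorem trivialEquiv_map [CharZero k] (f : A →ₗ⁅k⁆ B)
    (hf : ∀ a b, f (PostLieAlgebra.tri (k := k) a b) = PostLieAlgebra.tri (k := k) (f a) (f b))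
    (x : EnvRB k A) : trivialEquiv k B (map f hf x) =
      map (TrivialPostLie.map (f : A →ₗ[k] B)) (TrivialPostLie.map_tri (f : A →ₗ[k] B))
        (trivialEquiv k A x) := by
  refine (splitEquiv k (TrivialPostLie k B)).injective ?_
  rw [splitEquiv_map]
  change splitEquiv k _ ((splitEquiv k _).symm _) = (TrivialPostLie.map (f : A →ₗ[k] B)
    (splitEquiv k _ ((splitEquiv k _).symm _)).1, augMap _ _
      (splitEquiv k _ ((splitEquiv k _).symm _)).2)
  rw [LinearEquiv.apply_symm_apply, LinearEquiv.apply_symm_apply]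
  have h := splitEquiv_map f hf x
  exact Prod.ext (congrArg (fun p : B × Aug k B => TrivialPostLie.of k B p.1) h) ((congrArg (fun p : B × Aug k B =>
    (paramSystem k B).equiv (paramSystem k (TrivialPostLie k B)) (TrivialPostLie.of k B) p.2)
      h).trans ((paramSystem k A).equiv_natural (paramSystem k (TrivialPostLie k A))
    (paramSystem k B) (paramSystem k (TrivialPostLie k B)) (TrivialPostLie.of k A)
    (TrivialPostLie.of k B) (f := (f : A →ₗ[k] B))
    (f' := (TrivialPostLie.map (f : A →ₗ[k] B) : TrivialPostLie k A →ₗ[k] TrivialPostLie k B))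
    (fun _ => rfl) (augMap_augParam f hf) (augMap_augParam _ _) _))

end EnvRB

end Functoriality

end RotaBaxterPBW

namespace RotaBaxterPBW

open OperadPBW

/-! ### Algebras over an operad given by a presentation -/

section Monomials

variable {U B I J : Type}

/-- The renaming of the variables of a monomial. -/
def renameMon (σ : I → J) : Mon U B I → Mon U B J
  | .var i => .var (σ i)
  | .un f t => .un f (renameMon σ t)
  | .bin b s t => .bin b (renameMon σ s) (renameMon σ t)

theorem eval_renameMon {k : Type u} [CommRing k] {A : Type v} [AddCommGroup A] [Module k A]
    (o : Ops k U B A) (σ : I → J) (a : J → A) (t : Mon U B I) :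
    o.eval a (renameMon σ t) = o.eval (fun i => a (σ i)) t := by
  induction t with
  | var i => rfl
  | un f t ih => simp [renameMon, Ops.eval, ih]
  | bin b s t ihs iht => simp [renameMon, Ops.eval, ihs, iht]

theorem occ_renameMon_of_injective {σ : I → J} (hσ : Function.Injective σ) (t : Mon U B I) (i : I) :
    (renameMon σ t).occ (σ i) = t.occ i := by
  classical
  induction t with
  | var j => simp [renameMon, Mon.occ, Pi.single_apply, hσ.eq_iff]
  | un f t ih => simp [renameMon, Mon.occ, ih]
  | bin b s t ihs iht => simp [renameMon, Mon.occ, ihs, iht]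

theorem occ_renameMon_of_notMem {σ : I → J} (t : Mon U B I) {j : J} (hj : j ∉ Set.range σ) :
    (renameMon σ t).occ j = 0 := by
  classical
  induction t with
  | var i =>
    have : j ≠ σ i := fun e => hj ⟨i, e.symm⟩
    simp [renameMon, Mon.occ, this]
  | un f t ih => simp [renameMon, Mon.occ, ih]
  | bin b s t ihs iht => simp [renameMon, Mon.occ, ihs, iht]

theorem occ_add_occ_le (σ : I → J) (t : Mon U B I) {i i' : I} (h : σ i = σ i') (hne : i ≠ i') :
    t.occ i + t.occ i' ≤ (renameMon σ t).occ (σ i) := by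
  classical
  induction t with
  | var j =>
    simp only [renameMon, Mon.occ, Pi.single_apply]
    by_cases h1 : i = j
    · subst h1
      simp [hne.symm]
    · by_cases h2 : i' = j
      · subst h2
        simp [h, hne]
      · simp [h1, h2]
  | un f t ih => simpa [renameMon, Mon.occ] using ih
  | bin b s t ihs iht =>
    simp only [renameMon, Mon.occ, Pi.add_apply]
    omega

/-- Identified variables would occur at least twice after renaming, and a missed variable would not
occur. -/
theorem bijective_of_occ {σ : I → J} {t : Mon U B I} (ht : t.occ = 1)
    (h : (renameMon σ t).occ = 1) : Function.Bijective σ := by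
  refine ⟨fun i i' hi => ?_, fun j => ?_⟩
  · by_contra hne
    have := occ_add_occ_le σ t hi hne
    simp [ht, h] at this
  · by_contra hj
    have := occ_renameMon_of_notMem t hj
    simp [h] at this

end Monomials

/-! ### Generating operations determine the action of a presented operad -/

section OperadAlgebra

variable {k : Type u} [CommRing k] (T : Presentation k)

theorem mono_renameMon {I J : Type} (σ : I → J) (t : Mon T.U T.B I) :
    T.mono (renameMon σ t) = T.freeMap σ (T.mono t) := by
  rw [Presentation.lift_mono]
  exact eval_renameMon _ _ _ _

/-- An element of the multilinear part as an operation. -/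
def toOp {I : Type} [Finite I] (p : T.multilinearPart I) : T.operad.obj I := p

/-- A monomial in which each variable occurs once as an operation. -/
def monOp {I : Type} [Finite I] (t : Mon T.U T.B I) (ht : t.occ = 1) : T.operad.obj I :=
  toOp T ⟨T.mono t, by
    have h := T.mono_mem t
    rwa [ht] at h⟩

theorem occ_var_unit : (Mon.var () : Mon T.U T.B Unit).occ = 1 := by
  funext i
  simp [Mon.occ]

theorem occ_bin_bool (b : T.B) :
    (Mon.bin b (.var false) (.var true) : Mon T.U T.B Bool).occ = 1 := by
  funext i
  cases i <;> simp [Mon.occ]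

/-- The operation given by a unary generating operation. -/
def unOp (f : T.U) : T.operad.obj Unit := monOp T (.un f (.var ())) (occ_var_unit T)

/-- The operation given by a binary generating operation. -/
def binOp (b : T.B) : T.operad.obj Bool :=
  monOp T (.bin b (.var false) (.var true)) (occ_bin_bool T b)

variable {T}

theorem bool_update_false {M : Type*} (x x' y : M) :
    Function.update (fun i : Bool => cond i y x') false x = fun i => cond i y x := by
  funext i
  cases i <;> simp

theorem bool_update_true {M : Type*} (x y y' : M) :
    Function.update (fun i : Bool => cond i y' x) true y = fun i => cond i y x := by
  funext i
  cases i <;> simp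

/-- The generating operations of an algebra over the operad of a presentation. -/
def algOps (A : OperadAlg.{u, v} T.operad) : Ops k T.U T.B A.carrier where
  un f := (MultilinearMap.ofSubsingleton k A.carrier A.carrier ()).symm (A.act (unOp T f))
  bin b := LinearMap.mk₂ k (fun x y => A.act (binOp T b) (fun i => cond i y x))
    (fun x x' y => by
      have h := (A.act (binOp T b)).map_update_add (fun i => cond i y 0) false x x'
      simpa only [bool_update_false] using h)
    (fun c x y => by
      have h := (A.act (binOp T b)).map_update_smul (fun i => cond i y 0) false c x
      simpa only [bool_update_false] using h)
    (fun x y y' => by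
      have h := (A.act (binOp T b)).map_update_add (fun i => cond i 0 x) true y y'
      simpa only [bool_update_true] using h)
    (fun c x y => by
      have h := (A.act (binOp T b)).map_update_smul (fun i => cond i 0 x) true c y
      simpa only [bool_update_true] using h)

theorem algOps_un (A : OperadAlg.{u, v} T.operad) (f : T.U) (x : A.carrier) :
    (algOps A).un f x = A.act (unOp T f) (fun _ => x) := rfl

theorem algOps_bin (A : OperadAlg.{u, v} T.operad) (b : T.B) (x y : A.carrier) :
    (algOps A).bin b x y = A.act (binOp T b) (fun i => cond i y x) := rfl

/-- A subterm of a multilinear monomial does not use all variables, so a direct induction on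
multilinear monomials is not available. Instead every monomial is presented as a renaming of one
whose variables are its own occurrences; this form is stable under forming larger terms. -/
theorem exists_linearization (A : OperadAlg.{u, v} T.operad) {I : Type} (t : Mon T.U T.B I) :
    ∃ (L : Type) (_ : Finite L) (s : Mon T.U T.B L) (hs : s.occ = 1) (σ : L → I),
      renameMon σ s = t ∧ ∀ a : L → A.carrier, A.act (monOp T s hs) a = (algOps A).eval a s := by
  induction t with
  | var i =>
    exact ⟨Unit, inferInstance, .var (), occ_var_unit T, fun _ => i, rfl, fun a => A.act_one a⟩
  | un f t ih =>
    obtain ⟨L, hL, s, hs, σ, rfl, h⟩ := ih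
    refine ⟨Σ _ : Unit, L, inferInstance, .un f (renameMon (Sigma.mk ()) s), ?_, fun x => σ x.2,
      ?_, fun a => ?_⟩
    · funext x
      obtain ⟨⟨⟩, l⟩ := x
      have h1 := occ_renameMon_of_injective
        (sigma_mk_injective : Function.Injective (Sigma.mk (β := fun _ : Unit => L) ())) s l
      rw [hs] at h1
      exact h1
    · have h1 : ∀ s : Mon T.U T.B L, renameMon (fun x : (Σ _ : Unit, L) => σ x.2)
          (renameMon (Sigma.mk ()) s) = renameMon σ s := fun s => by
        induction s <;> simp_all [renameMon]
      exact congrArg (Mon.un f) (h1 s)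
    -- The linearized monomial is the operadic composite of the generating operation with the
    -- linearized subterm, so compatibility of the action with composition computes it.
    · have h1 := A.act_comp (J := fun _ : Unit => L) (unOp T f) (fun _ => monOp T s hs) a
      refine Eq.trans ?_ (h1.trans ?_)
      · congr 2
        refine Subtype.ext ?_
        change T.mono _ = T.subst (fun _ => T.mono s) (T.mono (.un f (.var ())))
        rw [Presentation.subst, Presentation.lift_mono]
        change (T.freeOps _).un f (T.mono _) = (T.freeOps _).un f _
        rw [mono_renameMon]
        rfl
      · simp only [h]
        refine Eq.trans (congrArg (A.act (unOp T f)) (funext fun i => ?_)) (algOps_un A f _).symm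
        exact (eval_renameMon _ _ _ _).symm
  | bin b t₁ t₂ ih₁ ih₂ =>
    have ih : ∀ i : Bool, ∃ (L : Type) (_ : Finite L) (s : Mon T.U T.B L) (hs : s.occ = 1)
      (σ : L → I), renameMon σ s = cond i t₂ t₁ ∧
        ∀ a : L → A.carrier, A.act (monOp T s hs) a = (algOps A).eval a s := by
      rintro ⟨⟩
      exacts [ih₁, ih₂]
    choose L hL s hs σ hσ h using ih
    refine ⟨Σ i, L i, inferInstance, .bin b (renameMon (Sigma.mk false) (s false))
      (renameMon (Sigma.mk true) (s true)), ?_, fun x => σ x.1 x.2, ?_, fun a => ?_⟩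
    · funext x
      have h0 : ∀ i j (l : L i), i ≠ j → (renameMon (Sigma.mk j) (s j)).occ ⟨i, l⟩ = 0 :=
        fun i j l hij => occ_renameMon_of_notMem _ (by
          rintro ⟨l', hl⟩
          exact hij (congrArg Sigma.fst hl).symm)
      have h1 : ∀ i (l : L i), (renameMon (Sigma.mk i) (s i)).occ ⟨i, l⟩ = 1 := fun i l => by
        have h1 := occ_renameMon_of_injective
          (sigma_mk_injective : Function.Injective (Sigma.mk (β := L) i)) (s i) l
        rw [hs] at h1
        exact h1
      obtain ⟨⟨⟩, l⟩ := x
      · simp only [Mon.occ, Pi.add_apply, h1, h0 false true l (by simp), Pi.one_apply, add_zero]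
      · simp only [Mon.occ, Pi.add_apply, h1, h0 true false l (by simp), Pi.one_apply, zero_add]
    · have h1 : ∀ i (s : Mon T.U T.B (L i)), renameMon (fun x : (Σ i, L i) => σ x.1 x.2)
          (renameMon (Sigma.mk i) s) = renameMon (σ i) s := fun i s => by
        induction s <;> simp_all [renameMon]
      exact congrArg₂ (Mon.bin b) ((h1 _ _).trans (hσ false)) ((h1 _ _).trans (hσ true))
    · have h1 := A.act_comp (binOp T b) (fun i => monOp T (s i) (hs i)) a
      refine Eq.trans ?_ (h1.trans ?_)
      · congr 2
        refine Subtype.ext ?_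
        change T.mono _ = T.subst (fun i => T.mono (s i)) (T.mono (.bin b (.var false) (.var true)))
        rw [Presentation.subst, Presentation.lift_mono]
        change (T.freeOps _).bin b (T.mono _) (T.mono _) = (T.freeOps _).bin b _ _
        rw [mono_renameMon, mono_renameMon]
        rfl
      · simp only [h]
        refine Eq.trans (congrArg (A.act (binOp T b)) (funext fun i => ?_))
          (algOps_bin A b _ _).symm
        cases i
        exacts [(eval_renameMon _ _ _ _).symm, (eval_renameMon _ _ _ _).symm]

/-- For a multilinear monomial, the renaming from its linearization is a bijection, and equivariance
of the action removes it. -/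
theorem act_monOp (A : OperadAlg.{u, v} T.operad) {I : Type} [Finite I] (t : Mon T.U T.B I)
    (ht : t.occ = 1) (a : I → A.carrier) : A.act (monOp T t ht) a = (algOps A).eval a t := by
  obtain ⟨L, hL, s, hs, σ, rfl, h⟩ := exists_linearization A t
  have e : monOp T (renameMon σ s) ht =
      T.operad.map (Equiv.ofBijective σ (bijective_of_occ hs ht)) (monOp T s hs) :=
    Subtype.ext (mono_renameMon T σ s)
  rw [e, A.act_map, h, eval_renameMon]
  rfl

theorem act_induction {I : Type} [Finite I] {P : T.operad.obj I → Prop}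
    (hmon : ∀ t ht, P (monOp T t ht)) (hzero : P 0) (hadd : ∀ p q, P p → P q → P (p + q))
    (hsmul : ∀ (c : k) p, P p → P (c • p)) (p : T.operad.obj I) : P p := by
  obtain ⟨x, hx⟩ := (p : T.multilinearPart I)
  replace hx' : x ∈ Submodule.span k _ := hx
  change P (toOp T ⟨x, hx⟩)
  induction hx' using Submodule.span_induction with
  | mem x h =>
    obtain ⟨t, ht, rfl⟩ := h
    exact hmon t ht
  | zero => exact hzero
  | add x y hx' hy' ihx ihy => exact hadd _ _ (ihx hx') (ihy hy')
  | smul c x hx' ihx => exact hsmul c _ (ihx hx')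

theorem isHom_of_hom {A B : OperadAlg.{u, v} T.operad} (f : A ⟶ B) :
    (algOps A).IsHom (algOps B) f.hom.hom := by
  refine ⟨fun g x => f.hom_act (unOp T g) _, fun b x y => (f.hom_act (binOp T b) _).trans ?_⟩
  rw [algOps_bin]
  congr 1
  funext i
  cases i <;> rfl

/-- A linear map commuting with the generating operations as a homomorphism of algebras. -/
def homOfIsHom {A B : OperadAlg.{u, v} T.operad} (f : A.carrier →ₗ[k] B.carrier)
    (hf : (algOps A).IsHom (algOps B) f) : A ⟶ B where
  hom := ModuleCat.ofHom f
  hom_act {I} _ p a := by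
    change f (A.act p a) = B.act p (fun i => f (a i))
    induction p using act_induction with
    | hmon t ht => rw [act_monOp, act_monOp, hf.eval]
    | hzero => simp
    | hadd p q hp hq => simp only [map_add, add_apply, hp, hq]
    | hsmul c p hp => simp only [map_smul, smul_apply, hp]

/-- The operad retains only multilinear elements, so identities are inherited because they are
multilinear (`hT`): each is then an element of the operad, equal to zero there, and its action is
its evaluation. -/
theorem algOps_isModel (A : OperadAlg.{u, v} T.operad) (hfin : ∀ r, Finite (T.vars r))
    (hT : ∀ r, T.ident r ∈ Submodule.span k {x | ∃ t : Mon T.U T.B (T.vars r), t.occ = 1 ∧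
      x = Finsupp.single t 1}) : T.IsModel (algOps A) := by
  intro r a
  have key : ∀ x ∈ Submodule.span k {x | ∃ t : Mon T.U T.B (T.vars r), t.occ = 1 ∧
      x = Finsupp.single t (1 : k)}, ∃ p : T.multilinearPart (T.vars r),
        p.1 = (T.ideal _).mkQ x ∧ A.act (toOp T p) a = (algOps A).evalLin a x := by
    intro x hx
    induction hx using Submodule.span_induction with
    | mem x h =>
      obtain ⟨t, ht, rfl⟩ := h
      refine ⟨monOp T t ht, ?_, ?_⟩
      · rw [T.mkQ_single, one_smul]
        rfl
      · rw [Ops.evalLin_single, one_smul]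
        exact act_monOp A t ht a
    | zero => exact ⟨0, by simp, by
        rw [map_zero]
        exact congrArg (fun f => f a) (map_zero A.act)⟩
    | add x y _ _ hx hy =>
      obtain ⟨p, hp, hp'⟩ := hx
      obtain ⟨q, hq, hq'⟩ := hy
      refine ⟨p + q, by rw [map_add, ← hp, ← hq]; rfl, ?_⟩
      rw [map_add, ← hp', ← hq']
      exact congrArg (fun f => f a) (map_add A.act (toOp T p) (toOp T q))
    | smul c x _ hx =>
      obtain ⟨p, hp, hp'⟩ := hx
      refine ⟨c • p, by rw [map_smul, ← hp]; rfl, ?_⟩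
      rw [map_smul, ← hp']
      exact congrArg (fun f => f a) (map_smul A.act c (toOp T p))
  obtain ⟨p, hp, hp'⟩ := key _ (hT r)
  have h0 : (T.ideal _).mkQ (T.ident r) = 0 := by
    refine (Submodule.Quotient.mk_eq_zero _).2 ?_
    have h := Presentation.InIdeal.rel (T := T) (I := T.vars r) r
      (fun i => Finsupp.single (Mon.var i) 1)
    have e : (T.monOps (T.vars r)).evalLin (fun i => Finsupp.single (Mon.var i) 1) (T.ident r) =
        T.ident r := by
      simp [Ops.evalLin, Finsupp.linearCombination_apply, Presentation.monOps_eval]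
    rw [e] at h
    exact h
  have hp0 : p = 0 := Subtype.ext (hp.trans h0)
  rw [← hp', hp0]
  exact congrArg (fun f => f a) (map_zero A.act)

/-- The algebra over the operad of a presentation given by operations that satisfy the
identities. -/
def algOfModel {M : Type v} [AddCommGroup M] [Module k M] {o : Ops k T.U T.B M}
    (ho : T.IsModel o) : OperadAlg.{u, v} T.operad where
  carrier := ModuleCat.of k M
  act {I} _ :=
    { toFun := fun p => T.multilinearLift ho p
      map_add' := fun p q => MultilinearMap.ext fun a => map_add (Presentation.lift ho a) p.1 q.1
      map_smul' := fun c p => MultilinearMap.ext fun a =>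
        map_smul (Presentation.lift ho a) c p.1 }
  act_map σ p a := by
    change Presentation.lift ho a (T.freeMap σ p.1) = _
    rw [Presentation.lift_lift]
    simp only [Presentation.lift_gen]
    rfl
  act_one a := Presentation.lift_gen ho a ()
  act_comp p q a := by
    change Presentation.lift ho a (T.subst (fun i => (q i).1) p.1) = _
    rw [Presentation.subst, Presentation.lift_lift]
    simp only [Presentation.lift_lift, Presentation.lift_gen]
    rfl

theorem algOps_algOfModel_un {M : Type v} [AddCommGroup M] [Module k M] {o : Ops k T.U T.B M}
    (ho : T.IsModel o) (f : T.U) (x : M) : (algOps (algOfModel ho)).un f x = o.un f x :=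
  Presentation.lift_mono ho (fun _ => x) (.un f (.var ()))

theorem algOps_algOfModel_bin {M : Type v} [AddCommGroup M] [Module k M] {o : Ops k T.U T.B M}
    (ho : T.IsModel o) (b : T.B) (x y : M) :
    (algOps (algOfModel ho)).bin b x y = o.bin b x y :=
  Presentation.lift_mono ho (fun i : Bool => cond i y x) (.bin b (.var false) (.var true))

end OperadAlgebra

/-! ### Post-Lie and Rota-Baxter Lie algebras as algebras over operads -/

section Models

variable {k : Type u} [Field k]

theorem single_mem_span_multilinear {U B I : Type} {t : Mon U B I} (ht : t.occ = 1) :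
    mon k t ∈ Submodule.span k {x | ∃ t : Mon U B I, t.occ = 1 ∧ x = Finsupp.single t (1 : k)} :=
  Submodule.subset_span ⟨t, ht, rfl⟩

theorem postLie_isModel (A : OperadAlg.{u, v} (PostLie k)) :
    (postLiePresentation k).IsModel (algOps (T := postLiePresentation k) A) := by
  refine algOps_isModel (T := postLiePresentation k) A (fun r => ?_) (fun r => ?_)
  · cases r
    exacts [inferInstanceAs (Finite (Fin 2)), inferInstanceAs (Finite (Fin 3)),
      inferInstanceAs (Finite (Fin 3)), inferInstanceAs (Finite (Fin 3))]
  · cases r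
    · refine add_mem ?_ ?_ <;> refine single_mem_span_multilinear (I := Fin 2) (funext fun i => ?_) <;>
        fin_cases i <;> simp [Mon.occ]
    · refine sub_mem (sub_mem ?_ ?_) ?_ <;>
        refine single_mem_span_multilinear (I := Fin 3) (funext fun i => ?_) <;>
        fin_cases i <;> simp [Mon.occ]
    · refine sub_mem ?_ (add_mem ?_ ?_) <;>
        refine single_mem_span_multilinear (I := Fin 3) (funext fun i => ?_) <;>
        fin_cases i <;> simp [Mon.occ]
    · refine sub_mem (sub_mem (sub_mem ?_ ?_) (sub_mem ?_ ?_)) ?_ <;>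
        refine single_mem_span_multilinear (I := Fin 3) (funext fun i => ?_) <;>
        fin_cases i <;> simp [Mon.occ]

theorem rbLie_isModel (A : OperadAlg.{u, v} (RBLie k)) :
    (rbLiePresentation k).IsModel (algOps (T := rbLiePresentation k) A) := by
  refine algOps_isModel (T := rbLiePresentation k) A (fun r => ?_) (fun r => ?_)
  · cases r
    exacts [inferInstanceAs (Finite (Fin 2)), inferInstanceAs (Finite (Fin 3)),
      inferInstanceAs (Finite (Fin 2))]
  · cases r
    · refine add_mem ?_ ?_ <;> refine single_mem_span_multilinear (I := Fin 2) (funext fun i => ?_) <;>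
        fin_cases i <;> simp [Mon.occ]
    · refine sub_mem (sub_mem ?_ ?_) ?_ <;>
        refine single_mem_span_multilinear (I := Fin 3) (funext fun i => ?_) <;>
        fin_cases i <;> simp [Mon.occ]
    · refine sub_mem ?_ (add_mem (add_mem ?_ ?_) ?_) <;>
        refine single_mem_span_multilinear (I := Fin 2) (funext fun i => ?_) <;>
        fin_cases i <;> simp [Mon.occ]

end Models

section LieOfBilinear

variable {k M : Type*} [Field k] [AddCommGroup M] [Module k M]

/-- The Lie ring given by an anti-commutative operation that satisfies the Jacobi identity. -/
abbrev lieRingOfBilinear [CharZero k] (br : M →ₗ[k] M →ₗ[k] M) (anti : ∀ x y, br x y + br y x = 0)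
    (jac : ∀ x y z, br (br x y) z - br (br x z) y - br x (br y z) = 0) : LieRing M where
  bracket x y := br x y
  add_lie x y z := LinearMap.map_add₂ br x y z
  lie_add x y z := map_add (br x) y z
  lie_self x := by
    have h := anti x x
    -- Anti-commutativity gives only twice the bracket of x with itself; the characteristic allows
    -- division by 2.
    rw [← two_smul k] at h
    exact (smul_eq_zero.1 h).resolve_left two_ne_zero
  leibniz_lie x y z := by
    change br x (br y z) = br (br x y) z + br y (br x z)
    rw [← sub_eq_zero.1 (jac x y z), eq_neg_of_add_eq_zero_left (anti y (br x z)), sub_eq_add_neg]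

end LieOfBilinear

/-! ### Lie structures on the algebras over the two operads -/

section Carriers

variable {k : Type u} [Field k]

/-- The underlying space of an algebra over the operad of post-Lie algebras. -/
def PostLieCar (A : OperadAlg.{u, v} (PostLie k)) : Type v := A.carrier

namespace PostLieCar

variable (A : OperadAlg.{u, v} (PostLie k))

instance : AddCommGroup (PostLieCar A) := inferInstanceAs (AddCommGroup A.carrier)

instance : Module k (PostLieCar A) := inferInstanceAs (Module k A.carrier)

/-- The operations on the underlying space. -/
def ops : Ops k Empty PostLieOp (PostLieCar A) := algOps (T := postLiePresentation k) A

theorem isModel : (postLiePresentation k).IsModel (ops A) := postLie_isModel A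

variable [CharZero k]

instance : LieRing (PostLieCar A) :=
  lieRingOfBilinear ((ops A).bin .bracket)
    (fun x y => by
      have h : (ops A).evalLin (I := Fin 2) ![x, y] _ = 0 := isModel A .anticomm ![x, y]
      simpa [Ops.eval] using h)
    (fun x y z => by
      have h : (ops A).evalLin (I := Fin 3) ![x, y, z] _ = 0 := isModel A .jacobi ![x, y, z]
      simpa [Ops.eval] using h)

theorem lie_eq (x y : PostLieCar A) : ⁅x, y⁆ = (ops A).bin .bracket x y := rfl

instance : LieAlgebra k (PostLieCar A) where
  lie_smul c x y := map_smul ((ops A).bin .bracket x) c y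

instance : PostLieAlgebra k (PostLieCar A) where
  tri := (ops A).bin .tri
  lie_tri x y z := by
    have h : (ops A).evalLin (I := Fin 3) ![x, y, z] _ = 0 := isModel A .deriv ![x, y, z]
    simpa [Ops.eval, sub_eq_zero, lie_eq] using h
  tri_lie x y z := by
    have h : (ops A).evalLin (I := Fin 3) ![x, y, z] _ = 0 := isModel A .assoc ![x, y, z]
    rw [lie_eq]
    refine (sub_eq_zero.1 ?_).symm
    simpa [Ops.eval] using h

end PostLieCar

/-- The underlying space of an algebra over the operad of Rota-Baxter Lie algebras. -/
def RBLieCar (A : OperadAlg.{u, v} (RBLie k)) : Type v := A.carrier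

namespace RBLieCar

variable (A : OperadAlg.{u, v} (RBLie k))

instance : AddCommGroup (RBLieCar A) := inferInstanceAs (AddCommGroup A.carrier)

instance : Module k (RBLieCar A) := inferInstanceAs (Module k A.carrier)

/-- The operations on the underlying space. -/
def ops : Ops k RBLieUnOp RBLieOp (RBLieCar A) := algOps (T := rbLiePresentation k) A

theorem isModel : (rbLiePresentation k).IsModel (ops A) := rbLie_isModel A

variable [CharZero k]

instance : LieRing (RBLieCar A) :=
  lieRingOfBilinear ((ops A).bin .bracket)
    (fun x y => by
      have h : (ops A).evalLin (I := Fin 2) ![x, y] _ = 0 := isModel A .anticomm ![x, y]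
      simpa [Ops.eval] using h)
    (fun x y z => by
      have h : (ops A).evalLin (I := Fin 3) ![x, y, z] _ = 0 := isModel A .jacobi ![x, y, z]
      simpa [Ops.eval] using h)

theorem lie_eq (x y : RBLieCar A) : ⁅x, y⁆ = (ops A).bin .bracket x y := rfl

instance : LieAlgebra k (RBLieCar A) where
  lie_smul c x y := map_smul ((ops A).bin .bracket x) c y

instance : RotaBaxterLie k (RBLieCar A) where
  R := (ops A).un .R
  lie_R x y := by
    have h : (ops A).evalLin (I := Fin 2) ![x, y] _ = 0 := isModel A .rotaBaxter ![x, y]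
    simpa [Ops.eval, sub_eq_zero, lie_eq] using h

end RBLieCar

end Carriers

section OfInstances

variable {k : Type u} [Field k] (L : Type v) [LieRing L] [LieAlgebra k L] [RotaBaxterLie k L]

/-- The operations of a Rota-Baxter Lie algebra. -/
def rbOps : Ops k RBLieUnOp RBLieOp L where
  un _ := RotaBaxterLie.R
  bin _ := (LieModule.toEnd k L L : L →ₗ[k] Module.End k L)

theorem rbOps_un (x : L) : (rbOps (k := k) L).un .R x = RotaBaxterLie.R (k := k) x := rfl

theorem rbOps_bin (x y : L) : (rbOps (k := k) L).bin .bracket x y = ⁅x, y⁆ := rfl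

theorem rbOps_isModel : (rbLiePresentation k).IsModel (rbOps (k := k) L) := by
  intro r
  cases r with
  | anticomm =>
    intro (a : Fin 2 → L)
    change (rbOps L).evalLin (I := Fin 2) a _ = 0
    simp only [Ops.eval, map_add, Ops.evalLin_single, one_smul, rbOps_bin]
    rw [← lie_skew (a 0), neg_add_cancel]
  | jacobi =>
    intro (a : Fin 3 → L)
    change (rbOps L).evalLin (I := Fin 3) a _ = 0
    simp only [Ops.eval, map_sub, Ops.evalLin_single, one_smul, rbOps_bin]
    rw [leibniz_lie (a 0), ← lie_skew (a 1)]
    abel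
  | rotaBaxter =>
    intro (a : Fin 2 → L)
    change (rbOps L).evalLin (I := Fin 2) a _ = 0
    simp only [Ops.eval, map_sub, map_add, Ops.evalLin_single, one_smul, rbOps_bin, rbOps_un,
      RotaBaxterLie.lie_R, sub_self]

end OfInstances

/-! ### The enveloping algebra functor, its adjunction and its underlying space -/

section EnvelopingAlgebra

variable {k : Type u} [Field k]

theorem algOps_pullback_bracket (B : OperadAlg.{u, v} (RBLie k)) (x y : B.carrier) :
    (algOps (T := postLiePresentation k) ((OperadAlg.pullback (alpha k)).obj B)).bin .bracket x y =
      (algOps (T := rbLiePresentation k) B).bin .bracket x y := by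
  refine congrArg (fun p : (RBLie k).obj Bool => B.act p (fun i => cond i y x)) (Subtype.ext ?_)
  exact Presentation.lift_mono (T := postLiePresentation k)
    (postLieOps_isModel ((rbLiePresentation k).free_isModel Bool)) _
      (.bin .bracket (.var false) (.var true))

/-- The image of ◁ under `alpha` is the multilinear monomial [x, R(y)], whose action is its
evaluation by `act_monOp`. -/
theorem algOps_pullback_tri (B : OperadAlg.{u, v} (RBLie k)) (x y : B.carrier) :
    (algOps (T := postLiePresentation k) ((OperadAlg.pullback (alpha k)).obj B)).bin .tri x y =
      (algOps (T := rbLiePresentation k) B).bin .bracket x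
        ((algOps (T := rbLiePresentation k) B).un .R y) := by
  have ht : (Mon.bin .bracket (.var false) (.un .R (.var true)) :
      Mon RBLieUnOp RBLieOp Bool).occ = 1 := occ_bin_bool (rbLiePresentation k) .bracket
  refine Eq.trans ?_ (act_monOp (T := rbLiePresentation k) B _ ht (fun i => cond i y x))
  refine congrArg (fun p : (RBLie k).obj Bool => B.act p (fun i => cond i y x)) (Subtype.ext ?_)
  exact Presentation.lift_mono (T := postLiePresentation k)
    (postLieOps_isModel ((rbLiePresentation k).free_isModel Bool)) _
      (.bin .tri (.var false) (.var true))

theorem opHom_ext {P : SymOperad k} {C D : OperadAlg.{u, v} P} {f g : C ⟶ D}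
    (h : ∀ x, f.hom.hom x = g.hom.hom x) : f = g :=
  OperadAlg.Hom.ext (ModuleCat.hom_ext (LinearMap.ext h))

variable [CharZero k]

/-- A homomorphism of algebras over the operad of post-Lie algebras as a homomorphism of Lie
algebras. -/
def PostLieCar.mapHom {A B : OperadAlg.{u, v} (PostLie k)} (f : A ⟶ B) :
    PostLieCar A →ₗ⁅k⁆ PostLieCar B where
  toLinearMap := f.hom.hom
  map_lie' {x y} := (isHom_of_hom (T := postLiePresentation k) f).bin .bracket x y

theorem PostLieCar.mapHom_tri {A B : OperadAlg.{u, v} (PostLie k)} (f : A ⟶ B)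
    (x y : PostLieCar A) : PostLieCar.mapHom f (PostLieAlgebra.tri (k := k) x y) =
      PostLieAlgebra.tri (k := k) (PostLieCar.mapHom f x) (PostLieCar.mapHom f y) :=
  (isHom_of_hom (T := postLiePresentation k) f).bin .tri x y

/-- A homomorphism to the post-Lie algebra of a Rota-Baxter Lie algebra as a homomorphism of Lie
algebras. -/
def toRBLieCar {A : OperadAlg.{u, v} (PostLie k)} {B : OperadAlg.{u, v} (RBLie k)}
    (f : A ⟶ (OperadAlg.pullback (alpha k)).obj B) : PostLieCar A →ₗ⁅k⁆ RBLieCar B where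
  toLinearMap := f.hom.hom
  map_lie' {x y} := ((isHom_of_hom (T := postLiePresentation k) f).bin .bracket x y).trans
    (algOps_pullback_bracket B _ _)

theorem toRBLieCar_tri {A : OperadAlg.{u, v} (PostLie k)} {B : OperadAlg.{u, v} (RBLie k)}
    (f : A ⟶ (OperadAlg.pullback (alpha k)).obj B) (x y : PostLieCar A) :
    toRBLieCar f (PostLieAlgebra.tri (k := k) x y) =
      ⁅toRBLieCar f x, RotaBaxterLie.R (k := k) (toRBLieCar f y)⁆ :=
  ((isHom_of_hom (T := postLiePresentation k) f).bin .tri x y).trans (algOps_pullback_tri B _ _)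

/-- The universal enveloping Rota-Baxter Lie algebra as an algebra over an operad. -/
def envAlg (A : OperadAlg.{u, max u w} (PostLie k)) : OperadAlg.{u, max u w} (RBLie k) :=
  algOfModel (T := rbLiePresentation k) (rbOps_isModel (k := k) (EnvRB k (PostLieCar A)))

section HomEquiv

variable {A : OperadAlg.{u, max u w} (PostLie k)} {B : OperadAlg.{u, max u w} (RBLie k)}

/-- A homomorphism from the universal enveloping Rota-Baxter Lie algebra as a homomorphism of Lie
algebras. -/
def ofEnvAlg (g : envAlg A ⟶ B) : EnvRB k (PostLieCar A) →ₗ⁅k⁆ RBLieCar B where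
  toLinearMap := g.hom.hom
  map_lie' {x y} := (congrArg g.hom.hom (algOps_algOfModel_bin (T := rbLiePresentation k)
    (rbOps_isModel (k := k) (EnvRB k (PostLieCar A))) .bracket x y).symm).trans
      ((isHom_of_hom (T := rbLiePresentation k) g).bin .bracket x y)

theorem ofEnvAlg_R (g : envAlg A ⟶ B) (x : EnvRB k (PostLieCar A)) :
    ofEnvAlg g (RotaBaxterLie.R (k := k) x) = RotaBaxterLie.R (k := k) (ofEnvAlg g x) :=
  (congrArg g.hom.hom (algOps_algOfModel_un (T := rbLiePresentation k)
    (rbOps_isModel (k := k) (EnvRB k (PostLieCar A))) .R x).symm).trans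
      ((isHom_of_hom (T := rbLiePresentation k) g).un .R x)

/-- A homomorphism of Rota-Baxter Lie algebras from the universal enveloping algebra as a
homomorphism of algebras over an operad. -/
def homEnvAlg (F : EnvRB k (PostLieCar A) →ₗ⁅k⁆ RBLieCar B)
    (hF : ∀ x, F (RotaBaxterLie.R (k := k) x) = RotaBaxterLie.R (k := k) (F x)) : envAlg A ⟶ B :=
  homOfIsHom (T := rbLiePresentation k) (A := envAlg A) (B := B)
    (F : EnvRB k (PostLieCar A) →ₗ[k] RBLieCar B)
    ⟨fun f x => by
      cases f
      exact (congrArg F (algOps_algOfModel_un (T := rbLiePresentation k)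
        (rbOps_isModel (k := k) (EnvRB k (PostLieCar A))) .R x)).trans (hF x),
      fun b x y => by
        cases b
        exact (congrArg F (algOps_algOfModel_bin (T := rbLiePresentation k)
          (rbOps_isModel (k := k) (EnvRB k (PostLieCar A))) .bracket x y)).trans (F.map_lie x y)⟩

/-- The homomorphism of post-Lie algebras given by a homomorphism of Rota-Baxter Lie algebras from
the universal enveloping algebra. -/
def restrictEnvAlg (g : envAlg A ⟶ B) : A ⟶ (OperadAlg.pullback (alpha k)).obj B :=
  homOfIsHom (T := postLiePresentation k) (A := A) (B := (OperadAlg.pullback (alpha k)).obj B)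
    ((ofEnvAlg g : EnvRB k (PostLieCar A) →ₗ[k] RBLieCar B) ∘ₗ
      (EnvRB.of k (PostLieCar A) : PostLieCar A →ₗ[k] EnvRB k (PostLieCar A)))
    ⟨fun f => f.elim, fun b x y => by
      cases b
      · refine Eq.trans ?_ (algOps_pullback_bracket B _ _).symm
        exact ((ofEnvAlg g).comp (EnvRB.of k (PostLieCar A))).map_lie x y
      · refine Eq.trans ?_ (algOps_pullback_tri B _ _).symm
        refine (congrArg (ofEnvAlg g) (EnvRB.of_tri (k := k) (A := PostLieCar A) x y)).trans ?_
        refine ((ofEnvAlg g).map_lie _ _).trans ?_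
        exact congrArg (fun z => ⁅ofEnvAlg g (EnvRB.of k (PostLieCar A) x), z⁆) (ofEnvAlg_R g _)⟩

variable (A B) in
/-- The universal property of the universal enveloping Rota-Baxter Lie algebra. -/
def envHomEquiv : (envAlg A ⟶ B) ≃ (A ⟶ (OperadAlg.pullback (alpha k)).obj B) where
  toFun := restrictEnvAlg
  invFun f := homEnvAlg (EnvRB.lift (toRBLieCar f) (toRBLieCar_tri f)) (EnvRB.lift_R _ _)
  left_inv g := opHom_ext fun x => DFunLike.congr_fun (EnvRB.hom_ext
    (F := EnvRB.lift (toRBLieCar (restrictEnvAlg g)) (toRBLieCar_tri _)) (G := ofEnvAlg g)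
    (EnvRB.lift_R _ _) (ofEnvAlg_R g) (fun _ => rfl)) x
  right_inv _ := opHom_ext fun _ => rfl

end HomEquiv

/-- The universal enveloping Rota-Baxter Lie algebra functor. -/
def envFunctor (k : Type u) [Field k] [CharZero k] :
    OperadAlg.{u, max u w} (PostLie k) ⥤ OperadAlg.{u, max u w} (RBLie k) :=
  Adjunction.leftAdjointOfEquiv (G := OperadAlg.pullback (alpha k)) envHomEquiv.{u, w}
    (fun _ _ _ _ _ => rfl)

/-- The universal enveloping Rota-Baxter Lie algebra functor is left adjoint to the pullback
functor. -/
def envAdjunction (k : Type u) [Field k] [CharZero k] :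
    envFunctor.{u, w} k ⊣ OperadAlg.pullback.{u, max u w} (alpha k) :=
  Adjunction.adjunctionOfEquivLeft (G := OperadAlg.pullback (alpha k)) envHomEquiv.{u, w}
    (fun _ _ _ _ _ => rfl)

/-- On morphisms the functor is defined by transposition through the bijection of morphism sets.
Being a homomorphism with the same values on generators, the result is the explicit map. -/
theorem envFunctor_map {A A' : OperadAlg.{u, max u w} (PostLie k)} (f : A ⟶ A')
    (x : EnvRB k (PostLieCar A)) : ((envFunctor k).map f).hom.hom x =
      EnvRB.map (PostLieCar.mapHom f) (PostLieCar.mapHom_tri f) x := by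
  let g : EnvRB k (PostLieCar A) →ₗ⁅k⁆ EnvRB k (PostLieCar A') :=
    { toLinearMap := ((envFunctor.{u, w} k).map f).hom.hom
      map_lie' := fun {x y} => ((ofEnvAlg ((envFunctor.{u, w} k).map f)).map_lie x y).trans
        (algOps_algOfModel_bin (T := rbLiePresentation k)
          (rbOps_isModel (k := k) (EnvRB k (PostLieCar A'))) .bracket _ _) }
  have hg : ∀ x, g (RotaBaxterLie.R (k := k) x) = RotaBaxterLie.R (k := k) (g x) := fun x =>
    (ofEnvAlg_R ((envFunctor.{u, w} k).map f) x).trans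
      (algOps_algOfModel_un (T := rbLiePresentation k)
        (rbOps_isModel (k := k) (EnvRB k (PostLieCar A'))) .R _)
  exact DFunLike.congr_fun (EnvRB.hom_ext (F := g)
    (G := EnvRB.map (PostLieCar.mapHom f) (PostLieCar.mapHom_tri f)) hg (EnvRB.map_R _ _)
    (fun _ => rfl)) x

/-- The endofunctor of vector spaces underlying the universal enveloping Rota-Baxter Lie
algebras. -/
def envSpace (k : Type u) [Field k] : ModuleCat.{max u w} k ⥤ ModuleCat.{max u w} k where
  obj V := ModuleCat.of k (EnvRB k (TrivialPostLie k V))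
  map f := ModuleCat.ofHom (EnvRB.map (TrivialPostLie.map f.hom) (TrivialPostLie.map_tri f.hom) :
    EnvRB k (TrivialPostLie k _) →ₗ[k] EnvRB k (TrivialPostLie k _))
  map_id V := ModuleCat.hom_ext (LinearMap.ext fun x => DFunLike.congr_fun (EnvRB.hom_ext
    (F := EnvRB.map (TrivialPostLie.map (𝟙 V : V ⟶ V).hom) (TrivialPostLie.map_tri _))
    (G := LieHom.id) (EnvRB.map_R _ _) (fun _ => rfl) (fun _ => rfl)) x)
  map_comp f g := ModuleCat.hom_ext (LinearMap.ext fun x => DFunLike.congr_fun (EnvRB.hom_ext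
    (F := EnvRB.map (TrivialPostLie.map (f ≫ g).hom) (TrivialPostLie.map_tri _))
    (G := (EnvRB.map (TrivialPostLie.map g.hom) (TrivialPostLie.map_tri _)).comp
      (EnvRB.map (TrivialPostLie.map f.hom) (TrivialPostLie.map_tri _)))
    (EnvRB.map_R _ _) (fun x => by
      rw [LieHom.comp_apply, EnvRB.map_R, EnvRB.map_R]
      rfl) (fun _ => rfl)) x)

/-- The underlying vector space of the universal enveloping Rota-Baxter Lie algebra. -/
def envForgetIso (k : Type u) [Field k] [CharZero k] :
    envFunctor.{u, w} k ⋙ OperadAlg.forget (RBLie k) ≅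
      OperadAlg.forget (PostLie k) ⋙ envSpace.{u, w} k :=
  NatIso.ofComponents (fun _ => (EnvRB.trivialEquiv k (PostLieCar _)).toModuleIso)
    (fun {_ B} f => ModuleCat.hom_ext (LinearMap.ext fun x =>
      (congrArg (EnvRB.trivialEquiv k (PostLieCar B)) (envFunctor_map f x)).trans
        (EnvRB.trivialEquiv_map (PostLieCar.mapHom f) (PostLieCar.mapHom_tri f) x)))

end EnvelopingAlgebra

end RotaBaxterPBW

end

theorem mainTheorem1 (k : Type u) [Field k] [CharZero k] :
    OperadPBW.HasPBWProperty.{u, w} (OperadPBW.alpha k) :=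
  ⟨RotaBaxterPBW.envFunctor.{u, w} k, RotaBaxterPBW.envAdjunction.{u, w} k,
    RotaBaxterPBW.envSpace.{u, w} k, ⟨RotaBaxterPBW.envForgetIso.{u, w} k⟩⟩
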